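/- **Conventions.** Let $\omega=\{1,2,\dots\}$, and let $\mathcal M$ be the monoid of injections $\omega\rightarrowtail\omega$. A *parsummable category* is a small category $\mathcal C$ with a strict action of $E\mathcal M$ (the chaotic category on $\mathcal M$, with the strict monoidal structure given by composition) such that every object is supported on some finite set, together with an object $0$ with empty support and an $E\mathcal M$-equivariant sum functor $+$, defined on pairs of objects with disjoint supports and on all morphisms between such pairs, which is strictly unital, associative and commutative; morphisms of parsummable categories strictly preserve all of this structure. For $u,v\in\mathcal M$, the action provides functors $u_*$ and natural isomorphisms $[v,u]\colon u_*\Rightarrow v_*$. For an injection $\varphi\colon\{1,\dots,m\}\times\omega\rightarrowtail\omega$ put $\varphi_*(X_1,\dots,X_m)=\varphi(1,-)_*(X_1)+\cdots+\varphi(m,-)_*(X_m)$, and for two such injections let $[\psi,\varphi]=[\psi(1,-),\varphi(1,-)]+\dots+[\psi(m,-),\varphi(m,-)]\colon\varphi_*\Rightarrow\psi_*$. * $\mathbf{SymMonCat}$ is the category of small symmetric monoidal categories and strong symmetric monoidal functors; $\mathbf{PermCat}$ is the category of small permutative categories and strict symmetric monoidal functors; $\mathbf{ParSumCat}$ is the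 category of parsummable categories. An *equivalence* in $\mathbf{SymMonCat}$ or $\mathbf{PermCat}$ is a morphism whose underlying functor is an equivalence of categories. * $\Sigma\colon\mathbf{ParSumCat}\to\mathbf{PermCat}$: objects of $\Sigma(\mathcal C)$ are finite (possibly empty) sequences of objects of $\mathcal C$; morphisms $(X_1,\dots,X_m)\to(Y_1,\dots,Y_n)$ are equivalence classes $[\psi,f,\varphi]$ with $\varphi\colon\{1,\dots,m\}\times\omega\rightarrowtail\omega$, $\psi\colon\{1,\dots,n\}\times\omega\rightarrowtail\omega$ and $f\colon\varphi_*(X_\bullet)\to\psi_*(Y_\bullet)$, where $(\psi,f,\varphi)\sim(\psi',f',\varphi')$ iff $f'=[\psi',\psi]\circ f\circ[\varphi,\varphi']$. Composition is $[\rho,g,\theta]\circ[\psi,f,\varphi]=[\rho,g\circ[\theta,\psi]\circ f,\varphi]$; the tensor product is concatenation of sequences, with $[\psi,f,\varphi]\otimes[\rho,g,\theta]=[\psi+\rho,f+g,\varphi+\theta]$ for representatives with disjoint images (where $\varphi+\theta$ is $\varphi$ on the first and $\theta$ on the second block of indices); the symmetry is $[\bar\varphi,\mathrm{id},\varphi]$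 with $\bar\varphi$ obtained from $\varphi$ by exchanging the two blocks. Moreover $\Sigma(F)(X_1,\dots,X_m)=(FX_1,\dots,FX_m)$ and $\Sigma(F)[\psi,f,\varphi]=[\psi,Ff,\varphi]$. * For an injection $\mu\colon\{1,2\}\times\omega\rightarrowtail\omega$, the functor $\mu^*\colon\mathbf{ParSumCat}\to\mathbf{SymMonCat}$ sends $\mathcal C$ to its underlying category with tensor product $\mu_*$, unit $0$, unitality isomorphisms $[1,\mu(2,-)]\colon\mu_*(0,X)\to X$ and $[1,\mu(1,-)]\colon\mu_*(X,0)\to X$, symmetry $[\mu\circ(\pi\times\mathrm{id}),\mu]$ with $\pi$ the transposition, and associativity isomorphism $[\mu\circ(1\amalg\mu),\mu\circ(\mu\amalg1)]\colon\mu_*(\mu_*(X,Y),Z)\to\mu_*(X,\mu_*(Y,Z))$. A morphism $F$ is sent to itself, as a strict symmetric monoidal functor. * $\Phi\colon\mathbf{PermCat}\to\mathbf{ParSumCat}$: objects of $\Phi(\mathcal K)$ are sequences $X=(X_1,X_2,\dots)$ in $\mathcal K$ with almost all $X_j=\mathbf 1$, and $\mathrm{Hom}(X,Y)=\mathrm{Hom}_{\mathcal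 K}(\bigotimes_jX_j,\bigotimes_jY_j)$. Here $u_*(X)_{u(j)}=X_j$, with all remaining entries $\mathbf 1$, and $[u,1]\colon X\to u_*X$ is the coherence isomorphism permuting the factors according to $u$; $(X+Y)_j$ is $X_j$ if $X_j\ne\mathbf 1$, and $Y_j$ otherwise; $f+g$ is $f\otimes g$ conjugated with the coherence isomorphisms $\bigotimes_j(X+Y)_j\cong\bigotimes_jX_j\otimes\bigotimes_jY_j$. Moreover $\Phi(F)(X)_j=F(X_j)$ and $\Phi(F)(f)=F(f)$. **Proposition.** Let $\mu\colon\{1,2\}\times\omega\rightarrowtail\omega$ be any injection. 1. For every parsummable category $\mathcal C$, the assignments $X\mapsto(X)$ on objects and $f\mapsto[1,f,1]$ on morphisms define a functor $\tilde\nu_{\mathcal C}\colon\mu^*\mathcal C\to\Sigma(\mathcal C)$, which is strong symmetric monoidal with structure isomorphisms $[1,\mathrm{id},\varnothing]\colon()\to(0)$ and $[1,\mathrm{id},\mu]\colon(X,Y)\to(\mu_*(X,Y))$, and which is an equivalence of categories. These functors are natural in $\mathcal C$: they form a natural transformation $\tilde\nu\colon\mu^*\Rightarrow\mathrm{incl}\circ\Sigma$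 of functors $\mathbf{ParSumCat}\to\mathbf{SymMonCat}$, where $\mathrm{incl}\colon\mathbf{PermCat}\to\mathbf{SymMonCat}$ is the inclusion. 2. There is a natural transformation $T\colon\Sigma\circ\Phi\Rightarrow\mathrm{id}$ of functors $\mathbf{PermCat}\to\mathbf{PermCat}$ all of whose components are equivalences, such that $T_{\mathcal K}$ is given on objects by $(X^{(1)},\dots,X^{(m)})\mapsto\bigotimes_{i=1}^m\bigotimes_{j\in\omega}X^{(i)}_j$ and on morphisms by $[\psi,f,\varphi]\mapsto f$ whenever $\varphi$ is $X^{(\bullet)}$-monotone and $\psi$ is $Y^{(\bullet)}$-monotone. Here $\varphi$ is called $X^{(\bullet)}$-monotone if $\varphi(i,j)<\varphi(i',j')$ whenever $(i,j)$ is lexicographically smaller than $(i',j')$ and $X^{(i)}_j\ne\mathbf 1\ne X^{(i')}_{j'}$. 3. The strong symmetric monoidal functors $\mathrm{incl}(T_{\mathcal K})\circ\tilde\nu_{\Phi(\mathcal K)}\colon\mu^*\Phi(\mathcal K)\to\mathcal K$, for $\mathcal K$ a small permutative category, form a natural transformation $\mu^*\circ\Phi\Rightarrow\mathrm{incl}$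 of functors $\mathbf{PermCat}\to\mathbf{SymMonCat}$ all of whose components are equivalences. -/

import Mathlib

open CategoryTheory MonoidalCategory

universe v u v₁ u₁ v₂ u₂ v₃ u₃

noncomputable section

namespace ParSum

/-! ## Heterogeneous equality of morphisms

Throughout, `f ≍ g` is used for equality of two morphisms whose sources and targets are equal, but
not definitionally so. -/

section HEq

variable {C : Type u₁} [Category.{v₁} C] {D : Type u₂} [Category.{v₂} D]

theorem functor_map_heq (F : C ⥤ D) {X X' Y Y' : C} {f : X ⟶ Y} {f' : X' ⟶ Y'}
    (hX : X = X') (hY : Y = Y') (hf : f ≍ f') : F.map f ≍ F.map f' := by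
  subst hX hY; cases hf; rfl

theorem square_of_heq {X X' Y Y' : C} {f : X ⟶ Y} {g : X' ⟶ Y'} (hX : X = X') (hY : Y = Y')
    (h : f ≍ g) : f ≫ eqToHom hY = eqToHom hX ≫ g := by
  subst hX hY; cases h; simp

theorem id_heq {X Y : C} (h : X = Y) : 𝟙 X ≍ 𝟙 Y := by subst h; rfl

theorem tensorHom_heq [MonoidalCategory C] {X X' Y Y' X₁ X₁' Y₁ Y₁' : C} {f : X ⟶ Y} {f' : X' ⟶ Y'}
    {g : X₁ ⟶ Y₁} {g' : X₁' ⟶ Y₁'} (hX : X = X') (hY : Y = Y') (hX₁ : X₁ = X₁') (hY₁ : Y₁ = Y₁')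
    (hf : f ≍ f') (hg : g ≍ g') : (f ⊗ₘ g) ≍ (f' ⊗ₘ g') := by
  subst hX hY hX₁ hY₁; cases hf; cases hg; rfl

theorem braiding_heq [MonoidalCategory C] [BraidedCategory C] {X X' Y Y' : C}
    (hX : X = X') (hY : Y = Y') : (β_ X Y).hom ≍ (β_ X' Y').hom := by
  subst hX hY; rfl

end HEq

/-! ## Symmetric monoidal categories and strict functors -/

/-- Small symmetric monoidal categories. -/
structure SymMonCat where
  carrier : Type u
  [cat : Category.{v} carrier]
  [monoidal : MonoidalCategory carrier]
  [symmetric : SymmetricCategory carrier]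

attribute [instance] SymMonCat.cat SymMonCat.monoidal SymMonCat.symmetric

namespace SymMonCat

/-- Strong symmetric monoidal functors. -/
structure Hom (C D : SymMonCat.{v, u}) where
  functor : C.carrier ⥤ D.carrier
  [braided : functor.Braided]

attribute [instance] Hom.braided

theorem Hom.ext' {C D : SymMonCat.{v, u}} {F G : Hom C D} (h : F.functor = G.functor)
    (hε : Functor.LaxMonoidal.ε F.functor ≍ Functor.LaxMonoidal.ε G.functor)
    (hμ : ∀ X Y, Functor.LaxMonoidal.μ F.functor X Y ≍ Functor.LaxMonoidal.μ G.functor X Y) :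
    F = G := by
  obtain ⟨F, hF⟩ := F
  obtain ⟨G, hG⟩ := G
  obtain rfl : F = G := h
  congr 1
  apply Functor.Braided.toMonoidal_injective
  apply Functor.Monoidal.toLaxMonoidal_injective
  apply Functor.LaxMonoidal.ext
  · exact eq_of_heq hε
  · funext X Y
    exact eq_of_heq (hμ X Y)

/-- The category of small symmetric monoidal categories and strong symmetric monoidal functors. -/
instance : Category SymMonCat.{v, u} where
  Hom := Hom
  id C := { functor := 𝟭 _ }
  comp F G := { functor := F.functor ⋙ G.functor }
  id_comp F := Hom.ext' rfl (by simp) (fun X Y => by simp)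
  comp_id F := Hom.ext' rfl (by simp) (fun X Y => by simp)
  assoc F G H := Hom.ext' rfl (by simp) (fun X Y => by simp)

end SymMonCat

section Strict

variable {C : Type u₁} [Category.{v₁} C] [MonoidalCategory C] [SymmetricCategory C]
  {D : Type u₂} [Category.{v₂} D] [MonoidalCategory D] [SymmetricCategory D]
  {E : Type u₃} [Category.{v₃} E] [MonoidalCategory E] [SymmetricCategory E]

/-- Strict symmetric monoidal functors: all structure is preserved on the nose. -/
structure IsStrictSymm (F : C ⥤ D) : Prop where
  obj_unit : F.obj (𝟙_ C) = 𝟙_ D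
  obj_tensor (X Y : C) : F.obj (X ⊗ Y) = F.obj X ⊗ F.obj Y
  map_tensor {X X' Y Y' : C} (f : X ⟶ X') (g : Y ⟶ Y') : F.map (f ⊗ₘ g) ≍ F.map f ⊗ₘ F.map g
  map_associator (X Y Z : C) : F.map (α_ X Y Z).hom ≍ (α_ (F.obj X) (F.obj Y) (F.obj Z)).hom
  map_leftUnitor (X : C) : F.map (λ_ X).hom ≍ (λ_ (F.obj X)).hom
  map_rightUnitor (X : C) : F.map (ρ_ X).hom ≍ (ρ_ (F.obj X)).hom
  map_braiding (X Y : C) : F.map (β_ X Y).hom ≍ (β_ (F.obj X) (F.obj Y)).hom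

namespace IsStrictSymm

theorem id : IsStrictSymm (𝟭 C) := by constructor <;> intros <;> rfl

theorem comp {F : C ⥤ D} {G : D ⥤ E} (hF : IsStrictSymm F) (hG : IsStrictSymm G) :
    IsStrictSymm (F ⋙ G) where
  obj_unit := (congrArg G.obj hF.obj_unit).trans hG.obj_unit
  obj_tensor X Y := (congrArg G.obj (hF.obj_tensor X Y)).trans (hG.obj_tensor _ _)
  map_tensor f g := (functor_map_heq G (hF.obj_tensor _ _) (hF.obj_tensor _ _)
    (hF.map_tensor f g)).trans (hG.map_tensor _ _)
  map_associator X Y Z := (functor_map_heq G (by simp [hF.obj_tensor]) (by simp [hF.obj_tensor])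
    (hF.map_associator X Y Z)).trans (hG.map_associator _ _ _)
  map_leftUnitor X := (functor_map_heq G (by simp [hF.obj_tensor, hF.obj_unit]) rfl
    (hF.map_leftUnitor X)).trans (hG.map_leftUnitor _)
  map_rightUnitor X := (functor_map_heq G (by simp [hF.obj_tensor, hF.obj_unit]) rfl
    (hF.map_rightUnitor X)).trans (hG.map_rightUnitor _)
  map_braiding X Y := (functor_map_heq G (by simp [hF.obj_tensor]) (by simp [hF.obj_tensor])
    (hF.map_braiding X Y)).trans (hG.map_braiding _ _)

/-- A strict symmetric monoidal functor is strong symmetric monoidal, with identities as structure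
isomorphisms. -/
@[reducible] def braided {F : C ⥤ D} (hF : IsStrictSymm F) : F.Braided :=
  letI core : F.CoreMonoidal :=
    { εIso := eqToIso hF.obj_unit.symm
      μIso := fun X Y => eqToIso (hF.obj_tensor X Y).symm
      μIso_hom_natural_left := fun f X' => by
        have := hF.map_tensor f (𝟙 X')
        rw [F.map_id, tensorHom_id, tensorHom_id] at this
        exact square_of_heq (hF.obj_tensor _ _).symm (hF.obj_tensor _ _).symm this.symm
      μIso_hom_natural_right := fun X' f => by
        have := hF.map_tensor (𝟙 X') f
        rw [F.map_id, id_tensorHom, id_tensorHom] at this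
        exact square_of_heq (hF.obj_tensor _ _).symm (hF.obj_tensor _ _).symm this.symm
      associativity := fun X Y Z => by
        simpa [eqToHom_whiskerRight, whiskerLeft_eqToHom] using
          (square_of_heq (by simp [hF.obj_tensor]) (by simp [hF.obj_tensor])
            (hF.map_associator X Y Z).symm).symm
      left_unitality := fun X => by
        simpa [eqToHom_whiskerRight] using
          square_of_heq (by simp [hF.obj_tensor, hF.obj_unit]) rfl (hF.map_leftUnitor X).symm
      right_unitality := fun X => by
        simpa [whiskerLeft_eqToHom] using
          square_of_heq (by simp [hF.obj_tensor, hF.obj_unit]) rfl (hF.map_rightUnitor X).symm }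
  letI := core.toMonoidal
  { braided := fun X Y => (square_of_heq (hF.obj_tensor _ _).symm (hF.obj_tensor _ _).symm
      (hF.map_braiding X Y).symm).symm }

theorem braided_ε {F : C ⥤ D} (hF : IsStrictSymm F) :
    letI := hF.braided
    Functor.LaxMonoidal.ε F = eqToHom hF.obj_unit.symm := rfl

theorem braided_μ {F : C ⥤ D} (hF : IsStrictSymm F) (X Y : C) :
    letI := hF.braided
    Functor.LaxMonoidal.μ F X Y = eqToHom (hF.obj_tensor X Y).symm := rfl

end IsStrictSymm

/-- The strong symmetric monoidal functor given by a strict one. -/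
def SymMonCat.Hom.ofStrict {C D : SymMonCat.{v, u}} (F : C.carrier ⥤ D.carrier)
    (hF : IsStrictSymm F) : C ⟶ D :=
  letI := hF.braided
  SymMonCat.Hom.mk F

theorem SymMonCat.Hom.ofStrict_id (C : SymMonCat.{v, u}) :
    SymMonCat.Hom.ofStrict (𝟭 C.carrier) IsStrictSymm.id = 𝟙 C :=
  SymMonCat.Hom.ext' rfl HEq.rfl (fun _ _ => HEq.rfl)

theorem SymMonCat.Hom.ofStrict_comp {C D E : SymMonCat.{v, u}} (F : C.carrier ⥤ D.carrier)
    (hF : IsStrictSymm F) (G : D.carrier ⥤ E.carrier) (hG : IsStrictSymm G) :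
    SymMonCat.Hom.ofStrict (F ⋙ G) (hF.comp hG) =
      SymMonCat.Hom.ofStrict F hF ≫ SymMonCat.Hom.ofStrict G hG := by
  refine SymMonCat.Hom.ext' rfl ?_ (fun X Y => ?_)
  · change eqToHom (hF.comp hG).obj_unit.symm ≍
      eqToHom hG.obj_unit.symm ≫ G.map (eqToHom hF.obj_unit.symm)
    rw [eqToHom_map, eqToHom_trans]
  · change eqToHom ((hF.comp hG).obj_tensor X Y).symm ≍
      eqToHom (hG.obj_tensor _ _).symm ≫ G.map (eqToHom (hF.obj_tensor X Y).symm)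
    rw [eqToHom_map, eqToHom_trans]

/-- A symmetric monoidal category is permutative if its tensor product is strictly associative and
unital, with identities as associativity and unitality isomorphisms. -/
class Permutative (C : Type u₁) [Category.{v₁} C] [MonoidalCategory C] [SymmetricCategory C] :
    Prop where
  tensor_assoc (X Y Z : C) : (X ⊗ Y) ⊗ Z = X ⊗ (Y ⊗ Z)
  unit_tensor (X : C) : 𝟙_ C ⊗ X = X
  tensor_unit (X : C) : X ⊗ 𝟙_ C = X
  associator_eq (X Y Z : C) : (α_ X Y Z).hom = eqToHom (tensor_assoc X Y Z)
  leftUnitor_eq (X : C) : (λ_ X).hom = eqToHom (unit_tensor X)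
  rightUnitor_eq (X : C) : (ρ_ X).hom = eqToHom (tensor_unit X)

end Strict

/-- Small permutative categories. -/
structure PermCat extends SymMonCat.{v, u} where
  [permutative : Permutative carrier]

attribute [instance] PermCat.permutative

namespace PermCat

/-- Strict symmetric monoidal functors. -/
@[ext]
structure Hom (C D : PermCat.{v, u}) where
  functor : C.carrier ⥤ D.carrier
  strict : IsStrictSymm functor

/-- The category of small permutative categories and strict symmetric monoidal functors. -/
instance : Category PermCat.{v, u} where
  Hom := Hom
  id C := ⟨𝟭 _, IsStrictSymm.id⟩
  comp F G := ⟨F.functor ⋙ G.functor, F.strict.comp G.strict⟩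

/-- The inclusion of permutative categories into symmetric monoidal categories. -/
def incl : PermCat.{v, u} ⥤ SymMonCat.{v, u} where
  obj C := C.toSymMonCat
  map F := SymMonCat.Hom.ofStrict F.functor F.strict
  map_id _ := SymMonCat.Hom.ofStrict_id _
  map_comp F G := SymMonCat.Hom.ofStrict_comp _ F.strict _ G.strict

end PermCat

/-! ## Parsummable categories

We take `ω = ℕ`; the monoid of injective self-maps of `ω` is `ℕ ↪ ℕ`, in which the product `u v` is
the composite `v.trans u`. -/

/-- A strict action on the category `C` of the strict monoidal category `Eℳ`, the chaotic category
on the monoid `ℳ` of injective self-maps of `ω`: `act u` is the functor `u_*` and `tr u v` is the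
natural isomorphism `[v, u] : u_* ⟶ v_*` given by the unique morphism `u ⟶ v` of `Eℳ`. -/
structure EMAction (C : Type u) [Category.{v} C] where
  act : (ℕ ↪ ℕ) → C ⥤ C
  tr (u v : ℕ ↪ ℕ) : act u ⟶ act v
  tr_self (u : ℕ ↪ ℕ) : tr u u = 𝟙 (act u)
  tr_trans (u v w : ℕ ↪ ℕ) : tr u v ≫ tr v w = tr u w
  act_one : act (Function.Embedding.refl ℕ) = 𝟭 C
  act_mul (u v : ℕ ↪ ℕ) : act (v.trans u) = act v ⋙ act u
  tr_mul (u u' v v' : ℕ ↪ ℕ) (X : C) : (tr (v.trans u) (v'.trans u')).app X ≍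
    (act u).map ((tr v v').app X) ≫ (tr u u').app ((act v').obj X)

namespace EMAction

variable {C : Type u} [Category.{v} C] (a : EMAction C)

/-- `X` is supported on the finite set `A` if `u_* X = X` for all `u` fixing `A` pointwise. -/
def SupportedOn (X : C) (A : Finset ℕ) : Prop :=
  ∀ u : ℕ ↪ ℕ, (∀ n ∈ A, u n = n) → (a.act u).obj X = X

/-- The support: the intersection of all finite sets on which `X` is supported. -/
def supp (X : C) : Set ℕ := {n | ∀ A : Finset ℕ, a.SupportedOn X A → n ∈ A}

/-- All objects are finitely supported. -/
def IsTame : Prop := ∀ X : C, ∃ A : Finset ℕ, a.SupportedOn X A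

theorem act_mul_obj (u v : ℕ ↪ ℕ) (X : C) :
    (a.act (v.trans u)).obj X = (a.act u).obj ((a.act v).obj X) :=
  congrArg (fun F : C ⥤ C => F.obj X) (a.act_mul u v)

theorem act_one_obj (X : C) : (a.act (Function.Embedding.refl ℕ)).obj X = X :=
  congrArg (fun F : C ⥤ C => F.obj X) a.act_one

theorem tr_app_self (u : ℕ ↪ ℕ) (X : C) : (a.tr u u).app X = 𝟙 _ := by rw [a.tr_self]; rfl

theorem tr_app_trans (u v w : ℕ ↪ ℕ) (X : C) :
    (a.tr u v).app X ≫ (a.tr v w).app X = (a.tr u w).app X := by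
  rw [← a.tr_trans u v w]; rfl

theorem act_map_heq_one {X Y : C} (f : X ⟶ Y) :
    (a.act (Function.Embedding.refl ℕ)).map f ≍ f := by
  rw [a.act_one]; rfl

theorem exists_infinite_split (A : Finset ℕ) (u u' : ℕ ↪ ℕ) :
    ∃ h h' : ℕ ↪ ℕ, (∀ n, h n ∉ A) ∧ (∀ n, h' n ∉ A) ∧ ∀ m n, u (h m) ≠ u' (h' n) := by
  have hinf : Infinite {n // n ∉ A} := (Finset.finite_toSet A).infinite_compl.to_subtype
  let ι : ℕ ↪ {n // n ∉ A} := Infinite.natEmbedding _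
  have key : ∀ p : ℕ ↪ ℕ, {m | ∀ n, u (ι (p n)) ≠ u' (ι m)}.Infinite →
      ∃ h h' : ℕ ↪ ℕ, (∀ n, h n ∉ A) ∧ (∀ n, h' n ∉ A) ∧ ∀ m n, u (h m) ≠ u' (h' n) := by
    intro p hp
    have : Infinite {m // ∀ n, u (ι (p n)) ≠ u' (ι m)} := hp.to_subtype
    let κ := Infinite.natEmbedding {m // ∀ n, u (ι (p n)) ≠ u' (ι m)}
    exact ⟨(p.trans ι).trans (Function.Embedding.subtype _),
      ((κ.trans (Function.Embedding.subtype _)).trans ι).trans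
        (Function.Embedding.subtype _), fun n => (ι (p n)).2, fun n => (ι (κ n)).2,
        fun m n => (κ n).2 m⟩
  by_cases h0 : {m | ∀ n, u (ι (2 * n)) ≠ u' (ι m)}.Infinite
  · exact key ⟨fun n => 2 * n, fun a b h => by simpa using h⟩ h0
  · refine key ⟨fun n => 2 * n + 1, fun a b h => by simpa using h⟩ ?_
    refine (Set.not_infinite.mp h0).infinite_compl.mono fun m hm => ?_
    simp only [Set.mem_compl_iff, Set.mem_ofPred_eq, not_forall, not_not] at hm
    obtain ⟨k, hk⟩ := hm
    intro n hn
    have h1 : 2 * k = 2 * n + 1 :=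
      ι.injective (Subtype.ext (u.injective (hk.trans hn.symm)))
    omega

theorem exists_interleave (A : Finset ℕ) (u u' : ℕ ↪ ℕ) (h : ∀ n ∈ A, u n = u' n) :
    ∃ s e e' o o' : ℕ ↪ ℕ, (∀ n ∈ A, e n = n) ∧ (∀ n ∈ A, e' n = n) ∧ (∀ n ∈ A, o n = n) ∧
      (∀ n ∈ A, o' n = n) ∧ e.trans s = e'.trans u ∧ o.trans s = o'.trans u' := by
  obtain ⟨p, q, hp, hq, hpq⟩ := exists_infinite_split A u u'
  have hinf : Infinite {n // n ∉ A} := (Finset.finite_toSet A).infinite_compl.to_subtype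
  obtain ⟨ι⟩ : Nonempty ({n // n ∉ A} ≃ ℕ) := nonempty_equiv_of_countable
  have ext : ∀ f : ℕ → ℕ, Function.Injective f → (∀ n, f n ∉ A) →
      ∃ g : ℕ ↪ ℕ, (∀ n ∈ A, g n = n) ∧ ∀ n (hn : n ∉ A), g n = f (ι ⟨n, hn⟩) := by
    intro f hf' hf
    refine ⟨⟨fun n => if hn : n ∈ A then n else f (ι ⟨n, hn⟩), fun a b hab => ?_⟩,
      fun n hn => dif_pos hn, fun n hn => dif_neg hn⟩
    by_cases ha : a ∈ A <;> by_cases hb : b ∈ A <;> simp only [ha, hb, dite_true, dite_false] at hab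
    · exact hab
    · exact absurd (hab ▸ ha) (hf _)
    · exact absurd (hab.symm ▸ hb) (hf _)
    · exact congrArg Subtype.val (ι.injective (hf' hab))
  obtain ⟨e', he', he''⟩ := ext p p.injective hp
  obtain ⟨o', ho', ho''⟩ := ext q q.injective hq
  obtain ⟨e, he, hee⟩ := ext (fun n => (ι.symm (2 * n)).1) (fun a b hab => by
    have := ι.symm.injective (Subtype.ext hab); omega) (fun n => (ι.symm _).2)
  obtain ⟨o, ho, hoo⟩ := ext (fun n => (ι.symm (2 * n + 1)).1) (fun a b hab => by
    have := ι.symm.injective (Subtype.ext hab); omega) (fun n => (ι.symm _).2)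
  have hup : ∀ a ∈ A, ∀ k, u a ≠ u (p k) := fun a ha k hk => hp k (u.injective hk ▸ ha)
  have huq : ∀ a ∈ A, ∀ k, u a ≠ u' (q k) := fun a ha k hk =>
    hq k (u'.injective ((h a ha).symm.trans hk) ▸ ha)
  obtain ⟨s, hsA, hs⟩ : ∃ s : ℕ ↪ ℕ, (∀ n ∈ A, s n = u n) ∧ ∀ n (hn : n ∉ A), s n =
      if ι ⟨n, hn⟩ % 2 = 0 then u (p (ι ⟨n, hn⟩ / 2)) else u' (q (ι ⟨n, hn⟩ / 2)) := by
    refine ⟨⟨fun n => if hn : n ∈ A then u n else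
      if ι ⟨n, hn⟩ % 2 = 0 then u (p (ι ⟨n, hn⟩ / 2)) else u' (q (ι ⟨n, hn⟩ / 2)),
      fun a b hab => ?_⟩, fun n hn => dif_pos hn, fun n hn => dif_neg hn⟩
    by_cases ha : a ∈ A <;> by_cases hb : b ∈ A <;> simp only [ha, hb, dite_true, dite_false] at hab
    · exact u.injective hab
    · split_ifs at hab
      · exact absurd hab (hup a ha _)
      · exact absurd hab (huq a ha _)
    · split_ifs at hab
      · exact absurd hab.symm (hup b hb _)
      · exact absurd hab.symm (huq b hb _)
    · have : ι ⟨a, ha⟩ = ι ⟨b, hb⟩ := by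
        split_ifs at hab
        · have := p.injective (u.injective hab); omega
        · exact absurd hab (hpq _ _)
        · exact absurd hab.symm (hpq _ _)
        · have := q.injective (u'.injective hab); omega
      exact congrArg Subtype.val (ι.injective this)
  refine ⟨s, e, e', o, o', he, he', ho, ho', ?_, ?_⟩
  · ext n
    by_cases hn : n ∈ A
    · simp [he n hn, he' n hn, hsA n hn]
    · simp [hee n hn, he'' n hn, hs _ (ι.symm (2 * ι ⟨n, hn⟩)).2]
  · ext n
    by_cases hn : n ∈ A
    · simp [ho n hn, ho' n hn, hsA n hn, h n hn]
    · have h2 : (2 * ι ⟨n, hn⟩ + 1) / 2 = ι ⟨n, hn⟩ := by omega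
      simp [hoo n hn, ho'' n hn, hs _ (ι.symm (2 * ι ⟨n, hn⟩ + 1)).2, h2]

theorem SupportedOn.act_congr {X : C} {A : Finset ℕ} (hX : a.SupportedOn X A) {u u' : ℕ ↪ ℕ}
    (h : ∀ n ∈ A, u n = u' n) : (a.act u).obj X = (a.act u').obj X := by
  obtain ⟨s, e, e', o, o', he, he', ho, ho', h1, h2⟩ := exists_interleave A u u' h
  have k1 := a.act_mul_obj s e X
  have k2 := a.act_mul_obj u e' X
  have k3 := a.act_mul_obj s o X
  have k4 := a.act_mul_obj u' o' X
  rw [hX e he, h1] at k1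
  rw [hX e' he'] at k2
  rw [hX o ho, h2] at k3
  rw [hX o' ho'] at k4
  rw [← k2, k1, ← k3, k4]

/-- `X` is supported on a finite subset of `S`. -/
def Within (X : C) (S : Set ℕ) : Prop := ∃ A : Finset ℕ, ↑A ⊆ S ∧ a.SupportedOn X A

variable {a}

theorem Within.mono {X : C} {S T : Set ℕ} (h : a.Within X S) (hST : S ⊆ T) : a.Within X T :=
  ⟨h.choose, h.choose_spec.1.trans hST, h.choose_spec.2⟩

theorem Within.supp_subset {X : C} {S : Set ℕ} (h : a.Within X S) : a.supp X ⊆ S :=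
  fun _ hn => h.choose_spec.1 (hn _ h.choose_spec.2)

theorem Within.disjoint {X Y : C} {S T : Set ℕ} (hX : a.Within X S) (hY : a.Within Y T)
    (h : Disjoint S T) : Disjoint (a.supp X) (a.supp Y) :=
  h.mono hX.supp_subset hY.supp_subset

theorem IsTame.within_act (ha : a.IsTame) (u : ℕ ↪ ℕ) (X : C) :
    a.Within ((a.act u).obj X) (Set.range u) := by
  obtain ⟨A, hA⟩ := ha X
  refine ⟨A.map u, by simp, fun w hw => ?_⟩
  rw [← a.act_mul_obj]
  exact hA.act_congr a (fun n hn => hw _ (Finset.mem_map_of_mem u hn))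

theorem Within.act {X : C} {S : Set ℕ} (h : a.Within X S) (u : ℕ ↪ ℕ) :
    a.Within ((a.act u).obj X) (u '' S) := by
  obtain ⟨A, hS, hA⟩ := h
  refine ⟨A.map u, by simpa using Set.image_mono hS, fun w hw => ?_⟩
  rw [← a.act_mul_obj]
  exact hA.act_congr a (fun n hn => hw _ (Finset.mem_map_of_mem u hn))

end EMAction

/-- Parsummable categories: small tame `Eℳ`-categories `C` together with a zero object and a sum
functor, defined on the full subcategory of `C × C` given by the disjointly supported pairs, which
are `Eℳ`-equivariant, and strictly unital, associative and commutative. -/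
structure ParSumCat where
  carrier : Type u
  [cat : Category.{v} carrier]
  em : EMAction carrier
  tame : em.IsTame
  zero : carrier
  act_zero (u : ℕ ↪ ℕ) : (em.act u).obj zero = zero
  tr_zero (u v : ℕ ↪ ℕ) : (em.tr u v).app zero ≍ 𝟙 zero
  add (X Y : carrier) (h : Disjoint (em.supp X) (em.supp Y)) : carrier
  addMap {X X' Y Y' : carrier} (h : Disjoint (em.supp X) (em.supp Y))
    (h' : Disjoint (em.supp X') (em.supp Y')) (f : X ⟶ X') (g : Y ⟶ Y') : add X Y h ⟶ add X' Y' h'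
  addMap_id (X Y : carrier) (h : Disjoint (em.supp X) (em.supp Y)) :
    addMap h h (𝟙 X) (𝟙 Y) = 𝟙 (add X Y h)
  addMap_comp {X X' X'' Y Y' Y'' : carrier} (h : Disjoint (em.supp X) (em.supp Y))
    (h' : Disjoint (em.supp X') (em.supp Y')) (h'' : Disjoint (em.supp X'') (em.supp Y''))
    (f : X ⟶ X') (f' : X' ⟶ X'') (g : Y ⟶ Y') (g' : Y' ⟶ Y'') :
    addMap h h'' (f ≫ f') (g ≫ g') = addMap h h' f g ≫ addMap h' h'' f' g'
  act_add (u : ℕ ↪ ℕ) (X Y : carrier) (h : Disjoint (em.supp X) (em.supp Y))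
    (hu : Disjoint (em.supp ((em.act u).obj X)) (em.supp ((em.act u).obj Y))) :
    (em.act u).obj (add X Y h) = add ((em.act u).obj X) ((em.act u).obj Y) hu
  act_addMap (u : ℕ ↪ ℕ) {X X' Y Y' : carrier} (h : Disjoint (em.supp X) (em.supp Y))
    (h' : Disjoint (em.supp X') (em.supp Y')) (f : X ⟶ X') (g : Y ⟶ Y')
    (hu : Disjoint (em.supp ((em.act u).obj X)) (em.supp ((em.act u).obj Y)))
    (hu' : Disjoint (em.supp ((em.act u).obj X')) (em.supp ((em.act u).obj Y'))) :
    (em.act u).map (addMap h h' f g) ≍ addMap hu hu' ((em.act u).map f) ((em.act u).map g)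
  tr_add (u v : ℕ ↪ ℕ) (X Y : carrier) (h : Disjoint (em.supp X) (em.supp Y))
    (hu : Disjoint (em.supp ((em.act u).obj X)) (em.supp ((em.act u).obj Y)))
    (hv : Disjoint (em.supp ((em.act v).obj X)) (em.supp ((em.act v).obj Y))) :
    (em.tr u v).app (add X Y h) ≍ addMap hu hv ((em.tr u v).app X) ((em.tr u v).app Y)
  zero_add (X : carrier) (h : Disjoint (em.supp zero) (em.supp X)) : add zero X h = X
  zero_addMap {X X' : carrier} (h : Disjoint (em.supp zero) (em.supp X))
    (h' : Disjoint (em.supp zero) (em.supp X')) (f : X ⟶ X') : addMap h h' (𝟙 zero) f ≍ f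
  add_comm (X Y : carrier) (h : Disjoint (em.supp X) (em.supp Y)) : add X Y h = add Y X h.symm
  addMap_comm {X X' Y Y' : carrier} (h : Disjoint (em.supp X) (em.supp Y))
    (h' : Disjoint (em.supp X') (em.supp Y')) (f : X ⟶ X') (g : Y ⟶ Y') :
    addMap h h' f g ≍ addMap h.symm h'.symm g f
  add_assoc (X Y Z : carrier) (hXY : Disjoint (em.supp X) (em.supp Y))
    (hXZ : Disjoint (em.supp X) (em.supp Z)) (hYZ : Disjoint (em.supp Y) (em.supp Z))
    (h : Disjoint (em.supp (add X Y hXY)) (em.supp Z))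
    (h' : Disjoint (em.supp X) (em.supp (add Y Z hYZ))) :
    add (add X Y hXY) Z h = add X (add Y Z hYZ) h'
  addMap_assoc {X X' Y Y' Z Z' : carrier} (f : X ⟶ X') (g : Y ⟶ Y') (k : Z ⟶ Z')
    (hXY : Disjoint (em.supp X) (em.supp Y)) (hXZ : Disjoint (em.supp X) (em.supp Z))
    (hYZ : Disjoint (em.supp Y) (em.supp Z))
    (h : Disjoint (em.supp (add X Y hXY)) (em.supp Z))
    (h' : Disjoint (em.supp X) (em.supp (add Y Z hYZ)))
    (hXY' : Disjoint (em.supp X') (em.supp Y')) (hXZ' : Disjoint (em.supp X') (em.supp Z'))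
    (hYZ' : Disjoint (em.supp Y') (em.supp Z'))
    (k' : Disjoint (em.supp (add X' Y' hXY')) (em.supp Z'))
    (k'' : Disjoint (em.supp X') (em.supp (add Y' Z' hYZ'))) :
    addMap h k' (addMap hXY hXY' f g) k ≍ addMap h' k'' f (addMap hYZ hYZ' g k)

attribute [instance] ParSumCat.cat

namespace ParSumCat

/-- Morphisms of parsummable categories: strictly `Eℳ`-equivariant functors that strictly preserve
zero and sums. -/
@[ext]
structure Hom (C D : ParSumCat.{v, u}) where
  functor : C.carrier ⥤ D.carrier
  act_comm (u : ℕ ↪ ℕ) : C.em.act u ⋙ functor = functor ⋙ D.em.act u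
  tr_comm (u v : ℕ ↪ ℕ) (X : C.carrier) :
    functor.map ((C.em.tr u v).app X) ≍ (D.em.tr u v).app (functor.obj X)
  map_zero : functor.obj C.zero = D.zero
  map_add (X Y : C.carrier) (h : Disjoint (C.em.supp X) (C.em.supp Y))
    (h' : Disjoint (D.em.supp (functor.obj X)) (D.em.supp (functor.obj Y))) :
    functor.obj (C.add X Y h) = D.add (functor.obj X) (functor.obj Y) h'
  map_addMap {X X' Y Y' : C.carrier} (h : Disjoint (C.em.supp X) (C.em.supp Y))
    (h' : Disjoint (C.em.supp X') (C.em.supp Y')) (f : X ⟶ X') (g : Y ⟶ Y')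
    (k : Disjoint (D.em.supp (functor.obj X)) (D.em.supp (functor.obj Y)))
    (k' : Disjoint (D.em.supp (functor.obj X')) (D.em.supp (functor.obj Y'))) :
    functor.map (C.addMap h h' f g) ≍ D.addMap k k' (functor.map f) (functor.map g)

namespace Hom

variable {C D E : ParSumCat.{v, u}}

theorem act_comm_obj (F : Hom C D) (u : ℕ ↪ ℕ) (X : C.carrier) :
    F.functor.obj ((C.em.act u).obj X) = (D.em.act u).obj (F.functor.obj X) :=
  congrArg (fun G : C.carrier ⥤ D.carrier => G.obj X) (F.act_comm u)

theorem act_comm_map (F : Hom C D) (u : ℕ ↪ ℕ) {X Y : C.carrier} (f : X ⟶ Y) :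
    F.functor.map ((C.em.act u).map f) ≍ (D.em.act u).map (F.functor.map f) := by
  change (C.em.act u ⋙ F.functor).map f ≍ (F.functor ⋙ D.em.act u).map f
  rw [F.act_comm]

theorem supp_subset (F : Hom C D) (X : C.carrier) :
    D.em.supp (F.functor.obj X) ⊆ C.em.supp X := fun n hn A hA =>
  hn A (fun u hu => by rw [← F.act_comm_obj, hA u hu])

theorem disjoint (F : Hom C D) {X Y : C.carrier} (h : Disjoint (C.em.supp X) (C.em.supp Y)) :
    Disjoint (D.em.supp (F.functor.obj X)) (D.em.supp (F.functor.obj Y)) :=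
  h.mono (F.supp_subset X) (F.supp_subset Y)

end Hom

theorem addMap_heq {C : ParSumCat.{v, u}} {X X' Y Y' X₁ X₁' Y₁ Y₁' : C.carrier}
    {h : Disjoint (C.em.supp X) (C.em.supp Y)} {h' : Disjoint (C.em.supp X') (C.em.supp Y')}
    {k : Disjoint (C.em.supp X₁) (C.em.supp Y₁)} {k' : Disjoint (C.em.supp X₁') (C.em.supp Y₁')}
    {f : X ⟶ X'} {g : Y ⟶ Y'} {f₁ : X₁ ⟶ X₁'} {g₁ : Y₁ ⟶ Y₁'}
    (hX : X = X₁) (hX' : X' = X₁') (hY : Y = Y₁) (hY' : Y' = Y₁') (hf : f ≍ f₁) (hg : g ≍ g₁) :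
    C.addMap h h' f g ≍ C.addMap k k' f₁ g₁ := by
  subst hX hX' hY hY'; cases hf; cases hg; rfl

theorem add_congr {C : ParSumCat.{v, u}} {X Y X₁ Y₁ : C.carrier}
    {h : Disjoint (C.em.supp X) (C.em.supp Y)}
    {k : Disjoint (C.em.supp X₁) (C.em.supp Y₁)} (hX : X = X₁) (hY : Y = Y₁) :
    C.add X Y h = C.add X₁ Y₁ k := by
  subst hX hY; rfl

/-- The category of parsummable categories. -/
instance : Category ParSumCat.{v, u} where
  Hom := Hom
  id C :=
    { functor := 𝟭 _
      act_comm := fun _ => rfl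
      tr_comm := fun _ _ _ => HEq.rfl
      map_zero := rfl
      map_add := fun _ _ _ _ => rfl
      map_addMap := fun _ _ _ _ _ _ => HEq.rfl }
  comp F G :=
    { functor := F.functor ⋙ G.functor
      act_comm := fun u => by
        rw [← Functor.assoc, F.act_comm, Functor.assoc, G.act_comm, Functor.assoc]
      tr_comm := fun u v X =>
        (functor_map_heq G.functor (F.act_comm_obj u X) (F.act_comm_obj v X)
          (F.tr_comm u v X)).trans (G.tr_comm u v _)
      map_zero := (congrArg G.functor.obj F.map_zero).trans G.map_zero
      map_add := fun X Y h h' =>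
        (congrArg G.functor.obj (F.map_add X Y h (F.disjoint h))).trans (G.map_add _ _ _ h')
      map_addMap := fun h h' f g k k' =>
        (functor_map_heq G.functor (F.map_add _ _ h (F.disjoint h))
          (F.map_add _ _ h' (F.disjoint h')) (F.map_addMap h h' f g _ _)).trans
          (G.map_addMap _ _ _ _ k k') }

end ParSumCat

theorem comp_heq {C : Type u} [Category.{v} C] {X Y Z X' Y' Z' : C} {f : X ⟶ Y} {g : Y ⟶ Z}
    {f' : X' ⟶ Y'} {g' : Y' ⟶ Z'} (hX : X = X') (hY : Y = Y') (hZ : Z = Z') (hf : f ≍ f')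
    (hg : g ≍ g') : f ≫ g ≍ f' ≫ g' := by
  subst hX hY hZ; cases hf; cases hg; rfl

/-! ## Injections `{1, …, n} × ω ↣ ω` and the generalized sums -/

/-- Injections `φ : {1, …, n} × ω ↣ ω`. -/
abbrev Inj (n : ℕ) := Fin n × ℕ ↪ ℕ

namespace Inj

variable {m n k : ℕ}

/-- The injection `φ(i, -) : ω ↣ ω`. -/
def row (φ : Inj n) (i : Fin n) : ℕ ↪ ℕ :=
  ⟨fun x => φ (i, x), fun _ _ h => (Prod.mk.inj (φ.injective h)).2⟩

/-- The restriction of `φ` to the indices other than the first one. -/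
def tail (φ : Inj (n + 1)) : Inj n :=
  ⟨fun p => φ (p.1.succ, p.2), fun p q h => by
    have := φ.injective h
    simp only [Prod.mk.injEq, Fin.succ_inj] at this
    exact Prod.ext this.1 this.2⟩

/-- The injection `φ + θ`, for `φ` and `θ` with disjoint images. The equation `k = m + n` is an
argument since `k` will be the length of a concatenation of lists of lengths `m` and `n`. -/
def join (φ : Inj m) (θ : Inj n) (h : Disjoint (Set.range φ) (Set.range θ)) (e : k = m + n) :
    Inj k where
  toFun p := if hp : p.1.1 < m then φ (⟨p.1.1, hp⟩, p.2) else θ (⟨p.1.1 - m, by omega⟩, p.2)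
  inj' p q hpq := by
    have hne : ∀ x y, φ x ≠ θ y := fun x y hxy =>
      Set.disjoint_left.mp h (Set.mem_range_self x) (hxy ▸ Set.mem_range_self y)
    obtain ⟨⟨i, hi⟩, x⟩ := p
    obtain ⟨⟨j, hj⟩, y⟩ := q
    by_cases h1 : i < m <;> by_cases h2 : j < m <;>
      simp only [h1, h2, dite_true, dite_false] at hpq
    · have := φ.injective hpq
      simp only [Prod.mk.injEq, Fin.mk.injEq] at this ⊢
      exact this
    · exact absurd hpq (hne _ _)
    · exact absurd hpq.symm (hne _ _)
    · have := θ.injective hpq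
      simp only [Prod.mk.injEq, Fin.mk.injEq] at this ⊢
      exact ⟨by omega, this.2⟩

theorem row_apply (φ : Inj n) (i : Fin n) (x : ℕ) : φ.row i x = φ (i, x) := rfl

theorem tail_apply (φ : Inj (n + 1)) (p : Fin n × ℕ) : φ.tail p = φ (p.1.succ, p.2) := rfl

theorem join_apply_lt (φ : Inj m) (θ : Inj n) (h) (e : k = m + n) (i : Fin k) (hi : i.1 < m)
    (x : ℕ) : join φ θ h e (i, x) = φ (⟨i.1, hi⟩, x) := dif_pos hi

theorem join_apply_ge (φ : Inj m) (θ : Inj n) (h) (e : k = m + n) (i : Fin k) (hi : ¬ i.1 < m)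
    (x : ℕ) : join φ θ h e (i, x) = θ (⟨i.1 - m, by omega⟩, x) := dif_neg hi

theorem range_row_subset (φ : Inj n) (i : Fin n) : Set.range (φ.row i) ⊆ Set.range φ := by
  rintro _ ⟨x, rfl⟩; exact ⟨(i, x), rfl⟩

theorem range_tail_subset (φ : Inj (n + 1)) : Set.range φ.tail ⊆ Set.range φ := by
  rintro _ ⟨p, rfl⟩; exact ⟨(p.1.succ, p.2), rfl⟩

theorem disjoint_row_tail (φ : Inj (n + 1)) :
    Disjoint (Set.range (φ.row 0)) (Set.range φ.tail) := by
  rw [Set.disjoint_left]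
  rintro _ ⟨x, rfl⟩ ⟨p, hp⟩
  have := φ.injective hp
  simp only [Prod.mk.injEq] at this
  exact Fin.succ_ne_zero _ this.1

theorem range_join (φ : Inj m) (θ : Inj n) (h) (e : k = m + n) :
    Set.range (join φ θ h e) = Set.range φ ∪ Set.range θ := by
  subst e
  ext y
  constructor
  · rintro ⟨⟨⟨i, hi⟩, x⟩, rfl⟩
    by_cases h1 : i < m
    · left; exact ⟨(⟨i, h1⟩, x), (join_apply_lt φ θ h rfl ⟨i, hi⟩ h1 x).symm⟩
    · right; exact ⟨(⟨i - m, by omega⟩, x), (join_apply_ge φ θ h rfl ⟨i, hi⟩ h1 x).symm⟩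
  · rintro (⟨⟨⟨i, hi⟩, x⟩, rfl⟩ | ⟨⟨⟨i, hi⟩, x⟩, rfl⟩)
    · exact ⟨(⟨i, by omega⟩, x), join_apply_lt φ θ h rfl _ hi x⟩
    · exact ⟨(⟨m + i, by omega⟩, x),
        (join_apply_ge φ θ h rfl _ (by simp) x).trans (by simp)⟩

end Inj

namespace ParSumCat

variable (C : ParSumCat.{v, u})

/-- The generalized sum `φ_*(X₁, …, X_m)`, together with the fact that it is supported on a finite
subset of the image of `φ`. -/
def tensAux : (L : List C.carrier) → (φ : Inj L.length) →
    {Z : C.carrier // C.em.Within Z (Set.range φ)}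
  | [], _ => ⟨C.zero, ∅, by simp, fun u _ => C.act_zero u⟩
  | X :: L, φ =>
    have hX := C.tame.within_act (φ.row 0) X
    have hL := (tensAux L φ.tail).2
    ⟨C.add ((C.em.act (φ.row 0)).obj X) (tensAux L φ.tail).1
      (hX.disjoint hL φ.disjoint_row_tail), by
      obtain ⟨A, hA, hA'⟩ := hX.mono (φ.range_row_subset 0)
      obtain ⟨B, hB, hB'⟩ := hL.mono φ.range_tail_subset
      refine ⟨A ∪ B, by simpa using ⟨hA, hB⟩, fun u hu => ?_⟩
      have h1 := hA' u (fun n hn => hu n (Finset.mem_union_left _ hn))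
      have h2 := hB' u (fun n hn => hu n (Finset.mem_union_right _ hn))
      rw [C.act_add u _ _ _ (by rw [h1, h2]; exact hX.disjoint hL φ.disjoint_row_tail)]
      exact add_congr h1 h2⟩

/-- The generalized sum `φ_*(X₁, …, X_m) = φ(1, -)_*(X₁) + ⋯ + φ(m, -)_*(X_m)`. -/
def tens (L : List C.carrier) (φ : Inj L.length) : C.carrier := (C.tensAux L φ).1

variable {C}

theorem within_tens (L : List C.carrier) (φ : Inj L.length) :
    C.em.Within (C.tens L φ) (Set.range φ) := (C.tensAux L φ).2

theorem disjoint_tens {L L' : List C.carrier} {φ : Inj L.length} {φ' : Inj L'.length}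
    (h : Disjoint (Set.range φ) (Set.range φ')) :
    Disjoint (C.em.supp (C.tens L φ)) (C.em.supp (C.tens L' φ')) :=
  (within_tens L φ).disjoint (within_tens L' φ') h

theorem disjoint_act_tens (X : C.carrier) (L : List C.carrier) (φ : Inj (L.length + 1)) :
    Disjoint (C.em.supp ((C.em.act (φ.row 0)).obj X)) (C.em.supp (C.tens L φ.tail)) :=
  (C.tame.within_act (φ.row 0) X).disjoint (within_tens L φ.tail) φ.disjoint_row_tail

theorem tens_nil (φ : Inj 0) : C.tens [] φ = C.zero := rfl

theorem tens_cons (X : C.carrier) (L : List C.carrier) (φ : Inj (L.length + 1)) :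
    C.tens (X :: L) φ = C.add ((C.em.act (φ.row 0)).obj X) (C.tens L φ.tail)
      (disjoint_act_tens X L φ) := rfl

variable (C) in
/-- The natural isomorphism `[ψ, φ] : φ_* ⟶ ψ_*`, that is, the sum of the morphisms
`[ψ(i, -), φ(i, -)]`. -/
def trans : (L : List C.carrier) → (φ ψ : Inj L.length) → (C.tens L φ ⟶ C.tens L ψ)
  | [], _, _ => 𝟙 C.zero
  | X :: L, φ, ψ => C.addMap (disjoint_act_tens X L φ) (disjoint_act_tens X L ψ)
      ((C.em.tr (φ.row 0) (ψ.row 0)).app X) (trans L φ.tail ψ.tail)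

theorem trans_self (L : List C.carrier) (φ : Inj L.length) : C.trans L φ φ = 𝟙 _ := by
  induction L with
  | nil => rfl
  | cons X L ih =>
    simp only [trans, ih, C.em.tr_app_self]
    exact C.addMap_id _ _ _

theorem trans_trans (L : List C.carrier) (φ ψ θ : Inj L.length) :
    C.trans L φ ψ ≫ C.trans L ψ θ = C.trans L φ θ := by
  induction L with
  | nil => exact Category.id_comp _
  | cons X L ih =>
    simp only [trans]
    refine (C.addMap_comp _ _ _ _ _ _ _).symm.trans ?_
    rw [ih, C.em.tr_app_trans]

theorem act_tens (u : ℕ ↪ ℕ) (L : List C.carrier) (φ : Inj L.length) :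
    (C.em.act u).obj (C.tens L φ) = C.tens L (φ.trans u) := by
  induction L with
  | nil => exact C.act_zero u
  | cons X L ih =>
    have h1 := (C.em.act_mul_obj u (φ.row 0) X).symm
    have h2 := ih φ.tail
    rw [tens_cons, C.act_add u _ _ _ (by
      rw [h1, h2]; exact disjoint_act_tens X L (φ.trans u))]
    exact add_congr h1 h2

theorem tr_tens (u v : ℕ ↪ ℕ) (L : List C.carrier) (φ : Inj L.length) :
    (C.em.tr u v).app (C.tens L φ) ≍ C.trans L (φ.trans u) (φ.trans v) := by
  induction L with
  | nil => exact C.tr_zero u v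
  | cons X L ih =>
    have h1 := fun u => (C.em.act_mul_obj u (φ.row 0) X).symm
    have h2 := fun u => act_tens u L φ.tail
    have hd : ∀ u, Disjoint (C.em.supp ((C.em.act u).obj ((C.em.act (φ.row 0)).obj X)))
        (C.em.supp ((C.em.act u).obj (C.tens L φ.tail))) := fun u => by
      rw [h1, h2]; exact disjoint_act_tens X L (φ.trans u)
    refine (C.tr_add u v _ _ (disjoint_act_tens X L φ) (hd u) (hd v)).trans ?_
    refine addMap_heq (h1 u) (h1 v) (h2 u) (h2 v) ?_ (ih φ.tail)
    have := C.em.tr_mul u v (φ.row 0) (φ.row 0) X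
    rw [C.em.tr_app_self, CategoryTheory.Functor.map_id, Category.id_comp] at this
    exact this.symm

theorem act_trans (u : ℕ ↪ ℕ) (L : List C.carrier) (φ ψ : Inj L.length) :
    (C.em.act u).map (C.trans L φ ψ) ≍ C.trans L (φ.trans u) (ψ.trans u) := by
  induction L with
  | nil =>
    exact (heq_of_eq ((C.em.act u).map_id C.zero)).trans (id_heq (C.act_zero u))
  | cons X L ih =>
    have h1 := fun φ : Inj (L.length + 1) => (C.em.act_mul_obj u (φ.row 0) X).symm
    have h2 := fun φ : Inj (L.length + 1) => act_tens u L φ.tail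
    have hd : ∀ φ : Inj (L.length + 1),
        Disjoint (C.em.supp ((C.em.act u).obj ((C.em.act (φ.row 0)).obj X)))
        (C.em.supp ((C.em.act u).obj (C.tens L φ.tail))) := fun φ => by
      rw [h1, h2]; exact disjoint_act_tens X L (φ.trans u)
    refine (C.act_addMap u (disjoint_act_tens X L φ) (disjoint_act_tens X L ψ) _ _
      (hd φ) (hd ψ)).trans ?_
    refine addMap_heq (h1 φ) (h1 ψ) (h2 φ) (h2 ψ) ?_ (ih φ.tail ψ.tail)
    have := C.em.tr_mul u u (φ.row 0) (ψ.row 0) X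
    rw [C.em.tr_app_self, Category.comp_id] at this
    exact this.symm

theorem tens_congr {L L' : List C.carrier} (h : L = L') {φ : Inj L.length} {φ' : Inj L'.length}
    (hφ : ∀ i (hi : i < L.length) (hi' : i < L'.length) x, φ (⟨i, hi⟩, x) = φ' (⟨i, hi'⟩, x)) :
    C.tens L φ = C.tens L' φ' := by
  subst h
  congr 1
  ext ⟨⟨i, hi⟩, x⟩
  exact hφ i hi hi x

theorem trans_congr {L L' : List C.carrier} (h : L = L') {φ ψ : Inj L.length}
    {φ' ψ' : Inj L'.length}
    (hφ : ∀ i (hi : i < L.length) (hi' : i < L'.length) x, φ (⟨i, hi⟩, x) = φ' (⟨i, hi'⟩, x))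
    (hψ : ∀ i (hi : i < L.length) (hi' : i < L'.length) x, ψ (⟨i, hi⟩, x) = ψ' (⟨i, hi'⟩, x)) :
    C.trans L φ ψ ≍ C.trans L' φ' ψ' := by
  subst h
  have h1 : φ = φ' := by ext ⟨⟨i, hi⟩, x⟩; exact hφ i hi hi x
  have h2 : ψ = ψ' := by ext ⟨⟨i, hi⟩, x⟩; exact hψ i hi hi x
  subst h1 h2
  rfl

theorem trans_congr' {L : List C.carrier} {φ ψ φ' ψ' : Inj L.length} (hφ : φ = φ')
    (hψ : ψ = ψ') : C.trans L φ ψ ≍ C.trans L φ' ψ' := by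
  subst hφ hψ; rfl

theorem tr_congr {u v u' v' : ℕ ↪ ℕ} (hu : u = u') (hv : v = v') (X : C.carrier) :
    (C.em.tr u v).app X ≍ (C.em.tr u' v').app X := by
  subst hu hv; rfl

theorem tail_join {m n k : ℕ} (φ : Inj (m + 1)) (θ : Inj n)
    (h : Disjoint (Set.range φ) (Set.range θ)) (e : k + 1 = (m + 1) + n) :
    (Inj.join φ θ h e).tail =
      Inj.join φ.tail θ (h.mono_left φ.range_tail_subset) (by omega) := by
  ext ⟨⟨i, hi⟩, x⟩
  by_cases hm : i < m
  · rw [Inj.tail_apply, Inj.join_apply_lt _ _ _ _ _ (by simpa using hm),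
      Inj.join_apply_lt _ _ _ _ _ hm]
    rfl
  · rw [Inj.tail_apply, Inj.join_apply_ge _ _ _ _ _ (by simpa using hm),
      Inj.join_apply_ge _ _ _ _ _ hm]
    simp

theorem join_nil {n : ℕ} (φ : Inj 0) (θ : Inj n) (h) (e : n = 0 + n) :
    Inj.join φ θ h e = θ := by
  ext ⟨⟨i, hi⟩, x⟩
  exact Inj.join_apply_ge φ θ h e _ (by simp) x

theorem row_join {m n k : ℕ} (φ : Inj (m + 1)) (θ : Inj n)
    (h : Disjoint (Set.range φ) (Set.range θ)) (e : k + 1 = (m + 1) + n) :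
    (Inj.join φ θ h e).row 0 = φ.row 0 := by
  ext x
  exact Inj.join_apply_lt φ θ h e 0 (by simp) x

theorem act_row_join (X : C.carrier) (L L' : List C.carrier) (φ : Inj (L.length + 1))
    (θ : Inj L'.length) (h : Disjoint (Set.range φ) (Set.range θ)) (e) :
    (C.em.act ((Inj.join (k := (L ++ L').length + 1) φ θ h e).row 0)).obj X =
      (C.em.act (φ.row 0)).obj X :=
  congrArg (fun u => (C.em.act u).obj X) (row_join φ θ h e)

theorem tens_append (L L' : List C.carrier) (φ : Inj L.length) (θ : Inj L'.length)
    (h : Disjoint (Set.range φ) (Set.range θ)) (e) :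
    C.tens (L ++ L') (Inj.join φ θ h e) = C.add (C.tens L φ) (C.tens L' θ) (disjoint_tens h) := by
  induction L with
  | nil => exact (congrArg (C.tens L') (join_nil φ θ h _)).trans (C.zero_add _ (disjoint_tens h)).symm
  | cons X L ih =>
    have h' := h.mono_left φ.range_tail_subset
    have h1 := act_row_join X L L' φ θ h e
    have h2 : C.tens (L ++ L') (Inj.join (k := (L ++ L').length + 1) φ θ h e).tail =
        C.add (C.tens L φ.tail) (C.tens L' θ) (disjoint_tens h') :=
      (congrArg (C.tens (L ++ L')) (tail_join φ θ h e)).trans (ih φ.tail h' _)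
    have hd : Disjoint (C.em.supp ((C.em.act (φ.row 0)).obj X))
        (C.em.supp (C.add (C.tens L φ.tail) (C.tens L' θ) (disjoint_tens h'))) := by
      rw [← h1, ← h2]; exact disjoint_act_tens X (L ++ L') _
    refine Eq.trans (add_congr (k := hd) h1 h2) ?_
    exact (C.add_assoc _ _ _ (disjoint_act_tens X L φ)
      ((C.tame.within_act (φ.row 0) X).disjoint (within_tens L' θ)
        (h.mono_left (φ.range_row_subset 0))) (disjoint_tens h') (disjoint_tens h) hd).symm

theorem trans_append (L L' : List C.carrier) (φ φ' : Inj L.length) (θ θ' : Inj L'.length)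
    (h : Disjoint (Set.range φ) (Set.range θ)) (h' : Disjoint (Set.range φ') (Set.range θ')) (e) :
    C.trans (L ++ L') (Inj.join φ θ h e) (Inj.join φ' θ' h' e) ≍
      C.addMap (disjoint_tens h) (disjoint_tens h') (C.trans L φ φ') (C.trans L' θ θ') := by
  induction L with
  | nil =>
    exact (trans_congr' (L := L') (join_nil φ θ h _) (join_nil φ' θ' h' _)).trans
      (C.zero_addMap (disjoint_tens h) (disjoint_tens h') _).symm
  | cons X L ih =>
    have h2 : ∀ (φ : Inj (L.length + 1)) (θ : Inj L'.length)
        (h : Disjoint (Set.range φ) (Set.range θ)),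
        C.tens (L ++ L') (Inj.join (k := (L ++ L').length + 1) φ θ h e).tail =
        C.add (C.tens L φ.tail) (C.tens L' θ)
          (disjoint_tens (h.mono_left φ.range_tail_subset)) := fun φ θ h =>
      (congrArg (C.tens (L ++ L')) (tail_join φ θ h e)).trans
        (tens_append L L' φ.tail θ (h.mono_left φ.range_tail_subset) _)
    have hd : ∀ (φ : Inj (L.length + 1)) (θ : Inj L'.length)
        (h : Disjoint (Set.range φ) (Set.range θ)),
        Disjoint (C.em.supp ((C.em.act (φ.row 0)).obj X))
        (C.em.supp (C.add (C.tens L φ.tail) (C.tens L' θ)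
          (disjoint_tens (h.mono_left φ.range_tail_subset)))) := fun φ θ h => by
      rw [← act_row_join X L L' φ θ h e, ← h2 φ θ h]; exact disjoint_act_tens X (L ++ L') _
    have hr : ∀ (φ : Inj (L.length + 1)) (θ : Inj L'.length)
        (_ : Disjoint (Set.range φ) (Set.range θ)),
        Disjoint (C.em.supp ((C.em.act (φ.row 0)).obj X)) (C.em.supp (C.tens L' θ)) :=
      fun φ θ h => (C.tame.within_act (φ.row 0) X).disjoint (within_tens L' θ)
        (h.mono_left (φ.range_row_subset 0))
    refine HEq.trans (addMap_heq (k := hd φ θ h) (k' := hd φ' θ' h')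
      (act_row_join X L L' φ θ h e) (act_row_join X L L' φ' θ' h' e)
      (h2 φ θ h) (h2 φ' θ' h')
      (tr_congr (row_join φ θ h e) (row_join φ' θ' h' e) X)
      ((trans_congr' (tail_join φ θ h e) (tail_join φ' θ' h' e)).trans
        (ih φ.tail φ'.tail (h.mono_left φ.range_tail_subset) (h'.mono_left φ'.range_tail_subset) _)))
      ?_
    exact (C.addMap_assoc _ _ _ (disjoint_act_tens X L φ) (hr φ θ h)
      (disjoint_tens (h.mono_left φ.range_tail_subset)) (disjoint_tens h) _
      (disjoint_act_tens X L φ') (hr φ' θ' h')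
      (disjoint_tens (h'.mono_left φ'.range_tail_subset)) (disjoint_tens h') _).symm

end ParSumCat

/-! ## The permutative category `Σ(C)` -/

/-- A standard injection `{1, …, n} × ω ↣ ω`, one for each `k`; for distinct values of `k` the
images are disjoint. -/
def Inj.std (n k : ℕ) : Inj n where
  toFun p := Nat.pair k (Nat.pair p.1.1 p.2)
  inj' p q h := by
    obtain ⟨⟨i, hi⟩, x⟩ := p
    obtain ⟨⟨j, hj⟩, y⟩ := q
    simpa [Nat.pair_eq_pair] using h

theorem Inj.disjoint_std (m n : ℕ) {k l : ℕ} (h : k ≠ l) :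
    Disjoint (Set.range (Inj.std m k)) (Set.range (Inj.std n l)) := by
  rw [Set.disjoint_left]
  rintro _ ⟨p, rfl⟩ ⟨q, hq⟩
  exact h (Nat.pair_eq_pair.mp hq).1.symm

namespace ParSumCat

variable {C : ParSumCat.{v, u}}

/-- Triples `(ψ, f, φ)` with `f : φ_*(X) ⟶ ψ_*(Y)`. -/
structure SigmaRep (X Y : List C.carrier) where
  src : Inj X.length
  tgt : Inj Y.length
  hom : C.tens X src ⟶ C.tens Y tgt

/-- `(ψ, f, φ) ∼ (ψ', f', φ')` if and only if `f' = [ψ', ψ] ∘ f ∘ [φ, φ']`. -/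
def sigmaSetoid (X Y : List C.carrier) : Setoid (SigmaRep X Y) where
  r a b := b.hom = C.trans X b.src a.src ≫ a.hom ≫ C.trans Y a.tgt b.tgt
  iseqv :=
    { refl := fun a => by simp [trans_self]
      symm := fun {a b} h => by
        rw [h]
        simp only [Category.assoc, trans_trans, trans_self, Category.comp_id]
        rw [← Category.assoc, trans_trans, trans_self, Category.id_comp]
      trans := fun {a b c} h h' => by
        rw [h', h]
        simp only [Category.assoc, trans_trans]
        rw [← Category.assoc (C.trans X _ _), trans_trans] }

/-- The morphisms of `Σ(C)`: equivalence classes `[ψ, f, φ]`. -/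
def SigmaHom (X Y : List C.carrier) : Type v := Quotient (sigmaSetoid X Y)

namespace SigmaHom

variable {X Y Z : List C.carrier}

/-- The class `[ψ, f, φ]`. -/
def mk (φ : Inj X.length) (ψ : Inj Y.length) (f : C.tens X φ ⟶ C.tens Y ψ) : SigmaHom X Y :=
  Quotient.mk (sigmaSetoid X Y) ⟨φ, ψ, f⟩

theorem mk_eq_mk {φ φ' : Inj X.length} {ψ ψ' : Inj Y.length} {f : C.tens X φ ⟶ C.tens Y ψ}
    {f' : C.tens X φ' ⟶ C.tens Y ψ'} :
    mk φ ψ f = mk φ' ψ' f' ↔ f' = C.trans X φ' φ ≫ f ≫ C.trans Y ψ ψ' :=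
  Quotient.eq (r := sigmaSetoid X Y)

/-- The unique `f` with `α = [ψ, f, φ]`. -/
def rep (α : SigmaHom X Y) (φ : Inj X.length) (ψ : Inj Y.length) : C.tens X φ ⟶ C.tens Y ψ :=
  Quotient.lift (s := sigmaSetoid X Y)
    (fun a => C.trans X φ a.src ≫ a.hom ≫ C.trans Y a.tgt ψ) (fun a b h => by
      have h : b.hom = C.trans X b.src a.src ≫ a.hom ≫ C.trans Y a.tgt b.tgt := h
      rw [h]
      simp only [Category.assoc, trans_trans]
      rw [← Category.assoc (C.trans X φ b.src), trans_trans]) α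

theorem rep_mk (φ φ' : Inj X.length) (ψ ψ' : Inj Y.length) (f : C.tens X φ ⟶ C.tens Y ψ) :
    (mk φ ψ f).rep φ' ψ' = C.trans X φ' φ ≫ f ≫ C.trans Y ψ ψ' := rfl

theorem rep_mk_self (φ : Inj X.length) (ψ : Inj Y.length) (f : C.tens X φ ⟶ C.tens Y ψ) :
    (mk φ ψ f).rep φ ψ = f := by
  simp [rep_mk, trans_self]

theorem exists_rep (α : SigmaHom X Y) (φ : Inj X.length) (ψ : Inj Y.length) :
    ∃ f, mk φ ψ f = α := by
  induction α using Quotient.inductionOn with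
  | h a =>
    obtain ⟨φ', ψ', f⟩ := a
    exact ⟨C.trans X φ φ' ≫ f ≫ C.trans Y ψ' ψ, (mk_eq_mk.mpr rfl).symm⟩

theorem mk_rep (α : SigmaHom X Y) (φ : Inj X.length) (ψ : Inj Y.length) :
    mk φ ψ (α.rep φ ψ) = α := by
  obtain ⟨f, rfl⟩ := exists_rep α φ ψ
  rw [rep_mk_self]

theorem ext_rep {α β : SigmaHom X Y} (φ : Inj X.length) (ψ : Inj Y.length)
    (h : α.rep φ ψ = β.rep φ ψ) : α = β := by
  rw [← mk_rep α φ ψ, h, mk_rep]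

theorem heq_of_rep {X' Y' : List C.carrier} {α : SigmaHom X Y} {β : SigmaHom X' Y'}
    (hX : X = X') (hY : Y = Y') (φ : Inj X.length) (ψ : Inj Y.length)
    (φ' : Inj X'.length) (ψ' : Inj Y'.length)
    (hφ : ∀ i (hi : i < X.length) (hi' : i < X'.length) x, φ (⟨i, hi⟩, x) = φ' (⟨i, hi'⟩, x))
    (hψ : ∀ i (hi : i < Y.length) (hi' : i < Y'.length) x, ψ (⟨i, hi⟩, x) = ψ' (⟨i, hi'⟩, x))
    (h : α.rep φ ψ ≍ β.rep φ' ψ') : α ≍ β := by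
  subst hX hY
  have h1 : φ = φ' := by ext ⟨⟨i, hi⟩, x⟩; exact hφ i hi hi x
  have h2 : ψ = ψ' := by ext ⟨⟨i, hi⟩, x⟩; exact hψ i hi hi x
  subst h1 h2
  exact heq_of_eq (ext_rep φ ψ (eq_of_heq h))

variable (X) in
/-- The identity `[φ, id, φ]`, for any `φ`. -/
def id : SigmaHom X X := mk (Inj.std _ 0) (Inj.std _ 0) (𝟙 _)

/-- The composition `[ρ, g, θ] ∘ [ψ, f, φ] = [ρ, g ∘ [θ, ψ] ∘ f, φ]`. -/
def comp (α : SigmaHom X Y) (β : SigmaHom Y Z) : SigmaHom X Z :=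
  Quotient.lift₂ (s₁ := sigmaSetoid X Y) (s₂ := sigmaSetoid Y Z)
    (fun a b => mk a.src b.tgt (a.hom ≫ C.trans Y a.tgt b.src ≫ b.hom))
    (fun a b a' b' (ha : a'.hom = _) (hb : b'.hom = _) => mk_eq_mk.mpr (by
      rw [ha, hb]
      simp only [Category.assoc]
      rw [← Category.assoc (C.trans Y a'.tgt b'.src), trans_trans,
        ← Category.assoc (C.trans Y a.tgt a'.tgt), trans_trans])) α β

theorem rep_id (φ ψ : Inj X.length) : (id X).rep φ ψ = C.trans X φ ψ := by
  simp [id, rep_mk, trans_trans]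

theorem mk_comp_mk (φ : Inj X.length) (ψ θ : Inj Y.length) (ρ : Inj Z.length)
    (f : C.tens X φ ⟶ C.tens Y ψ) (g : C.tens Y θ ⟶ C.tens Z ρ) :
    (mk φ ψ f).comp (mk θ ρ g) = mk φ ρ (f ≫ C.trans Y ψ θ ≫ g) := rfl

theorem rep_comp (α : SigmaHom X Y) (β : SigmaHom Y Z) (φ : Inj X.length) (ψ : Inj Y.length)
    (ρ : Inj Z.length) : (α.comp β).rep φ ρ = α.rep φ ψ ≫ β.rep ψ ρ := by
  obtain ⟨f, rfl⟩ := exists_rep α φ ψ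
  obtain ⟨g, rfl⟩ := exists_rep β ψ ρ
  simp only [mk_comp_mk, rep_mk_self, trans_self, Category.id_comp]

theorem id_comp (α : SigmaHom X Y) : (id X).comp α = α :=
  ext_rep (Inj.std _ 0) (Inj.std _ 0) (by
    rw [rep_comp _ _ _ (Inj.std _ 0), rep_id, trans_self, Category.id_comp])

theorem comp_id (α : SigmaHom X Y) : α.comp (id Y) = α :=
  ext_rep (Inj.std _ 0) (Inj.std _ 0) (by
    rw [rep_comp _ _ _ (Inj.std _ 0), rep_id, trans_self, Category.comp_id])

theorem assoc {W : List C.carrier} (α : SigmaHom X Y) (β : SigmaHom Y Z) (γ : SigmaHom Z W) :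
    (α.comp β).comp γ = α.comp (β.comp γ) :=
  ext_rep (Inj.std _ 0) (Inj.std _ 0) (by
    rw [rep_comp _ _ _ (Inj.std _ 0), rep_comp α _ _ (Inj.std _ 0), rep_comp α _ _ (Inj.std _ 0),
      rep_comp β _ _ (Inj.std _ 0), Category.assoc])

end SigmaHom

variable (C) in
/-- The objects of `Σ(C)`: finite sequences of objects of `C`. -/
def SigmaCat : Type u := List C.carrier

instance : Category.{v} C.SigmaCat where
  Hom X Y := SigmaHom (C := C) X Y
  id X := SigmaHom.id (C := C) X
  comp α β := SigmaHom.comp α β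
  id_comp α := SigmaHom.id_comp α
  comp_id α := SigmaHom.comp_id α
  assoc α β γ := SigmaHom.assoc α β γ

namespace SigmaHom

variable {X Y Z X' Y' Z' : List C.carrier}

/-- The tensor product of morphisms of `Σ(C)`: for representatives of `α = [ψ, f, φ]` and
`β = [ρ, g, θ]` such that `φ`, `θ` and `ψ`, `ρ` have disjoint images,
`α ⊗ β = [ψ + ρ, f + g, φ + θ]`. Here we pick particular such representatives; see `tensor_mk` for
the independence of this choice. -/
def tensor (α : SigmaHom X Y) (β : SigmaHom X' Y') : SigmaHom (X ++ X') (Y ++ Y') :=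
  mk (Inj.join (Inj.std _ 0) (Inj.std _ 1) (Inj.disjoint_std _ _ (by decide)) List.length_append)
    (Inj.join (Inj.std _ 0) (Inj.std _ 1) (Inj.disjoint_std _ _ (by decide)) List.length_append)
    (eqToHom (tens_append _ _ _ _ _ _) ≫
      C.addMap _ _ (α.rep (Inj.std _ 0) (Inj.std _ 0)) (β.rep (Inj.std _ 1) (Inj.std _ 1)) ≫
      eqToHom (tens_append _ _ _ _ _ _).symm)

theorem rep_tensor (α : SigmaHom X Y) (β : SigmaHom X' Y')
    (φ : Inj X.length) (θ : Inj X'.length) (ψ : Inj Y.length) (ρ : Inj Y'.length)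
    (h : Disjoint (Set.range φ) (Set.range θ)) (h' : Disjoint (Set.range ψ) (Set.range ρ)) (e e') :
    (tensor α β).rep (Inj.join φ θ h e) (Inj.join ψ ρ h' e') ≍
      C.addMap (disjoint_tens h) (disjoint_tens h') (α.rep φ ψ) (β.rep θ ρ) := by
  rw [tensor, rep_mk]
  have hs := fun m n => Inj.disjoint_std m n (k := 0) (l := 1) (by decide)
  have e1 : α.rep φ ψ = C.trans X φ (Inj.std _ 0) ≫ α.rep (Inj.std _ 0) (Inj.std _ 0) ≫
      C.trans Y (Inj.std _ 0) ψ := by rw [← rep_mk, mk_rep]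
  have e2 : β.rep θ ρ = C.trans X' θ (Inj.std _ 1) ≫ β.rep (Inj.std _ 1) (Inj.std _ 1) ≫
      C.trans Y' (Inj.std _ 1) ρ := by rw [← rep_mk, mk_rep]
  rw [e1, e2, C.addMap_comp _ (disjoint_tens (hs _ _)) _,
    C.addMap_comp _ (disjoint_tens (hs _ _)) _]
  refine comp_heq (tens_append _ _ _ _ _ _) (tens_append _ _ _ _ _ _) (tens_append _ _ _ _ _ _)
    (trans_append _ _ _ _ _ _ _ _ _) ?_
  refine comp_heq (tens_append _ _ _ _ _ _) (tens_append _ _ _ _ _ _) (tens_append _ _ _ _ _ _)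
    ?_ (trans_append _ _ _ _ _ _ _ _ _)
  simp

theorem tensor_mk (φ : Inj X.length) (θ : Inj X'.length) (ψ : Inj Y.length) (ρ : Inj Y'.length)
    (h : Disjoint (Set.range φ) (Set.range θ)) (h' : Disjoint (Set.range ψ) (Set.range ρ))
    (f : C.tens X φ ⟶ C.tens Y ψ) (g : C.tens X' θ ⟶ C.tens Y' ρ) :
    tensor (mk φ ψ f) (mk θ ρ g) =
      mk (Inj.join φ θ h List.length_append) (Inj.join ψ ρ h' List.length_append)
        (eqToHom (tens_append _ _ _ _ _ _) ≫ C.addMap (disjoint_tens h) (disjoint_tens h') f g ≫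
          eqToHom (tens_append _ _ _ _ _ _).symm) := by
  refine ext_rep (Inj.join φ θ h List.length_append) (Inj.join ψ ρ h' List.length_append) ?_
  apply eq_of_heq
  refine (rep_tensor _ _ _ _ _ _ _ _ _ _).trans ?_
  simp [rep_mk_self]

variable (X Y) in
/-- The symmetry isomorphism `[φ̄, id, φ]` of `Σ(C)`, where `φ̄` arises from `φ` by exchanging the
two blocks. Here we pick a particular `φ`; see `rep_swap` for the independence of this choice. -/
def swap : SigmaHom (X ++ Y) (Y ++ X) :=
  mk (Inj.join (Inj.std _ 0) (Inj.std _ 1) (Inj.disjoint_std _ _ (by decide)) List.length_append)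
    (Inj.join (Inj.std _ 1) (Inj.std _ 0) (Inj.disjoint_std _ _ (by decide)) List.length_append)
    (eqToHom (by rw [tens_append, tens_append, C.add_comm]))

/-- `α = [ψ, id, φ]`. -/
def IsId (α : SigmaHom X Y) (φ : Inj X.length) (ψ : Inj Y.length) : Prop :=
  ∃ h : C.tens X φ = C.tens Y ψ, α.rep φ ψ = eqToHom h

theorem IsId.eq {α β : SigmaHom X Y} {φ : Inj X.length} {ψ : Inj Y.length} (h : α.IsId φ ψ)
    (h' : β.IsId φ ψ) : α = β :=
  ext_rep φ ψ (h.choose_spec.trans h'.choose_spec.symm)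

theorem IsId.comp {α : SigmaHom X Y} {β : SigmaHom Y Z} {φ : Inj X.length} {ψ : Inj Y.length}
    {ρ : Inj Z.length} (h : α.IsId φ ψ) (h' : β.IsId ψ ρ) : (α.comp β).IsId φ ρ := by
  obtain ⟨h1, h2⟩ := h
  obtain ⟨h3, h4⟩ := h'
  exact ⟨h1.trans h3, by rw [rep_comp _ _ _ ψ, h2, h4, eqToHom_trans]⟩

theorem IsId.id (φ : Inj X.length) : (id X).IsId φ φ :=
  ⟨rfl, by rw [rep_id, trans_self, eqToHom_refl]⟩

theorem IsId.mk {φ : Inj X.length} {ψ : Inj Y.length} (h : C.tens X φ = C.tens Y ψ) :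
    (mk φ ψ (eqToHom h)).IsId φ ψ :=
  ⟨h, rep_mk_self _ _ _⟩

theorem IsId.tensor {α : SigmaHom X Y} {β : SigmaHom X' Y'}
    {φ : Inj X.length} {θ : Inj X'.length} {ψ : Inj Y.length} {ρ : Inj Y'.length}
    (hα : α.IsId φ ψ) (hβ : β.IsId θ ρ)
    (h : Disjoint (Set.range φ) (Set.range θ)) (h' : Disjoint (Set.range ψ) (Set.range ρ)) (e e') :
    (tensor α β).IsId (Inj.join φ θ h e) (Inj.join ψ ρ h' e') := by
  obtain ⟨h1, h2⟩ := hα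
  obtain ⟨h3, h4⟩ := hβ
  have h5 : C.tens (X ++ X') (Inj.join φ θ h e) = C.tens (Y ++ Y') (Inj.join ψ ρ h' e') := by
    rw [tens_append, tens_append]; exact add_congr h1 h3
  refine ⟨h5, eq_of_heq ?_⟩
  refine (rep_tensor α β φ θ ψ ρ h h' e e').trans ?_
  rw [h2, h4]
  refine (addMap_heq (h' := disjoint_tens h') (k := disjoint_tens h) (k' := disjoint_tens h)
    (f₁ := 𝟙 _) (g₁ := 𝟙 _) rfl h1.symm rfl h3.symm (eqToHom_heq_id_dom _ _ _) (eqToHom_heq_id_dom _ _ _)).trans ?_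
  rw [C.addMap_id]
  refine HEq.trans ?_ (eqToHom_heq_id_dom _ _ h5).symm
  exact id_heq (tens_append _ _ _ _ _ _).symm

theorem IsId.swap (φ : Inj X.length) (θ : Inj Y.length)
    (h : Disjoint (Set.range φ) (Set.range θ)) (e e') :
    (swap X Y).IsId (Inj.join φ θ h e) (Inj.join θ φ h.symm e') := by
  have h5 : C.tens (X ++ Y) (Inj.join φ θ h e) = C.tens (Y ++ X) (Inj.join θ φ h.symm e') := by
    rw [tens_append, tens_append, C.add_comm]
  have hs := fun m n => Inj.disjoint_std m n (k := 0) (l := 1) (by decide)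
  refine ⟨h5, eq_of_heq ?_⟩
  rw [SigmaHom.swap, rep_mk]
  refine HEq.trans ?_ (eqToHom_heq_id_dom _ _ h5).symm
  refine HEq.trans (comp_heq (X' := C.add (C.tens X φ) (C.tens Y θ) (disjoint_tens h))
    (Y' := C.add (C.tens X (Inj.std _ 0)) (C.tens Y (Inj.std _ 1)) (disjoint_tens (hs _ _)))
    (Z' := C.add (C.tens X φ) (C.tens Y θ) (disjoint_tens h))
    (tens_append _ _ _ _ _ _) (tens_append _ _ _ _ _ _)
    ((tens_append _ _ _ _ _ _).trans (C.add_comm _ _ _))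
    (trans_append _ _ _ _ _ _ _ _ _)
    (g' := C.addMap (disjoint_tens (hs _ _)) (disjoint_tens h) (C.trans X (Inj.std _ 0) φ)
      (C.trans Y (Inj.std _ 1) θ)) ?_) ?_
  · rw [eqToHom_comp_heq_iff]
    exact (trans_append _ _ _ _ _ _ _ _ _).trans (C.addMap_comm _ _ _ _)
  · rw [← C.addMap_comp, trans_trans, trans_trans, trans_self, trans_self, C.addMap_id]
    exact id_heq (tens_append _ _ _ _ _ _).symm

theorem IsId.eqToHom {X Y : C.SigmaCat} (h : X = Y) (φ : Inj (List.length X))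
    (ψ : Inj (List.length Y))
    (hφ : ∀ i (hi : i < List.length X) (hi' : i < List.length Y) x,
      φ (⟨i, hi⟩, x) = ψ (⟨i, hi'⟩, x)) :
    IsId (X := X) (Y := Y) (eqToHom h) φ ψ := by
  subst h
  have h1 : φ = ψ := by ext ⟨⟨i, hi⟩, x⟩; exact hφ i hi hi x
  subst h1
  exact IsId.id φ

end SigmaHom

end ParSumCat

namespace ParSumCat

variable {C : ParSumCat.{v, u}}

namespace SigmaHom

variable {X Y Z X' Y' Z' X'' Y'' : List C.carrier}

theorem tensor_id (X X' : List C.carrier) : tensor (id X) (id X') = id (X ++ X') :=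
  IsId.eq ((IsId.id (Inj.std _ 0)).tensor (IsId.id (Inj.std _ 1)) (Inj.disjoint_std _ _ (by decide))
    (Inj.disjoint_std _ _ (by decide)) List.length_append List.length_append) (IsId.id _)

theorem tensor_comp (α : SigmaHom X Y) (β : SigmaHom Y Z) (α' : SigmaHom X' Y')
    (β' : SigmaHom Y' Z') :
    tensor (α.comp β) (α'.comp β') = (tensor α α').comp (tensor β β') := by
  have hs := fun m n => Inj.disjoint_std m n (k := 0) (l := 1) (by decide)
  refine ext_rep (Inj.join (Inj.std _ 0) (Inj.std _ 1) (hs _ _) List.length_append)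
    (Inj.join (Inj.std _ 0) (Inj.std _ 1) (hs _ _) List.length_append) (eq_of_heq ?_)
  refine (rep_tensor _ _ _ _ _ _ _ _ _ _).trans ?_
  rw [rep_comp _ _ _ (Inj.std _ 0), rep_comp _ _ _ (Inj.std _ 1),
    C.addMap_comp _ (disjoint_tens (hs _ _)) _,
    rep_comp _ _ _ (Inj.join (Inj.std _ 0) (Inj.std _ 1) (hs _ _) List.length_append)]
  exact (comp_heq (tens_append _ _ _ _ _ _) (tens_append _ _ _ _ _ _) (tens_append _ _ _ _ _ _)
    (rep_tensor _ _ _ _ _ _ _ _ _ _) (rep_tensor _ _ _ _ _ _ _ _ _ _)).symm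

theorem join_join {k l m n o : ℕ} (φ : Inj k) (θ : Inj l) (ρ : Inj m) (h1) (e1 : n = k + l)
    (h2) (e2 : o = n + m) {n' o' : ℕ} (h3) (e3 : n' = l + m) (h4) (e4 : o' = k + n') (i : ℕ)
    (hi : i < o) (hi' : i < o') (x : ℕ) :
    Inj.join (Inj.join φ θ h1 e1) ρ h2 e2 (⟨i, hi⟩, x) =
      Inj.join φ (Inj.join θ ρ h3 e3) h4 e4 (⟨i, hi'⟩, x) := by
  subst e1 e2 e3 e4
  by_cases c1 : i < k
  · rw [Inj.join_apply_lt _ _ _ _ _ (by simpa using by omega), Inj.join_apply_lt _ _ _ _ _ c1,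
      Inj.join_apply_lt _ _ _ _ _ c1]
  · by_cases c2 : i < k + l
    · rw [Inj.join_apply_lt _ _ _ _ _ (by simpa using by omega), Inj.join_apply_ge _ _ _ _ _ c1,
        Inj.join_apply_ge _ _ _ _ _ c1, Inj.join_apply_lt _ _ _ _ _ (by simpa using by omega)]
    · rw [Inj.join_apply_ge _ _ _ _ _ (by simpa using by omega), Inj.join_apply_ge _ _ _ _ _ c1,
        Inj.join_apply_ge _ _ _ _ _ (by simpa using by omega)]
      congr 3
      simp only
      omega

theorem join_right_nil {n k : ℕ} (φ : Inj n) (θ : Inj 0) (h) (e : k = n + 0) (i : ℕ) (hi : i < k)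
    (hi' : i < n) (x : ℕ) : Inj.join φ θ h e (⟨i, hi⟩, x) = φ (⟨i, hi'⟩, x) :=
  Inj.join_apply_lt φ θ h e _ hi' x

theorem disjoint_join_left {k l m n : ℕ} {φ : Inj k} {θ : Inj l} {ρ : Inj m} {h1} {e1 : n = k + l}
    (h2 : Disjoint (Set.range φ) (Set.range ρ)) (h3 : Disjoint (Set.range θ) (Set.range ρ)) :
    Disjoint (Set.range (Inj.join φ θ h1 e1)) (Set.range ρ) := by
  rw [Inj.range_join]; exact h2.union_left h3

theorem disjoint_join_right {k l m n : ℕ} {φ : Inj k} {θ : Inj l} {ρ : Inj m} {h1} {e1 : n = k + l}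
    (h2 : Disjoint (Set.range ρ) (Set.range φ)) (h3 : Disjoint (Set.range ρ) (Set.range θ)) :
    Disjoint (Set.range ρ) (Set.range (Inj.join φ θ h1 e1)) := by
  rw [Inj.range_join]; exact h2.union_right h3

theorem tensor_assoc (α : SigmaHom X Y) (β : SigmaHom X' Y') (γ : SigmaHom X'' Y'') :
    tensor (tensor α β) γ ≍ tensor α (tensor β γ) := by
  have h01 := fun m n => Inj.disjoint_std m n (k := 0) (l := 1) (by decide)
  have h02 := fun m n => Inj.disjoint_std m n (k := 0) (l := 2) (by decide)
  have h12 := fun m n => Inj.disjoint_std m n (k := 1) (l := 2) (by decide)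
  refine heq_of_rep (List.append_assoc _ _ _) (List.append_assoc _ _ _)
    (Inj.join (Inj.join (Inj.std _ 0) (Inj.std _ 1) (h01 _ _) List.length_append) (Inj.std _ 2)
      (disjoint_join_left (h02 _ _) (h12 _ _)) List.length_append)
    (Inj.join (Inj.join (Inj.std _ 0) (Inj.std _ 1) (h01 _ _) List.length_append) (Inj.std _ 2)
      (disjoint_join_left (h02 _ _) (h12 _ _)) List.length_append)
    (Inj.join (Inj.std _ 0) (Inj.join (Inj.std _ 1) (Inj.std _ 2) (h12 _ _) List.length_append)
      (disjoint_join_right (h01 _ _) (h02 _ _)) List.length_append)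
    (Inj.join (Inj.std _ 0) (Inj.join (Inj.std _ 1) (Inj.std _ 2) (h12 _ _) List.length_append)
      (disjoint_join_right (h01 _ _) (h02 _ _)) List.length_append)
    (fun i hi hi' x => join_join _ _ _ _ _ _ _ _ _ _ _ _ _ _ _)
    (fun i hi hi' x => join_join _ _ _ _ _ _ _ _ _ _ _ _ _ _ _) ?_
  have d1 := fun L L' L'' : List C.carrier => (tens_append L L' _ _ (h01 _ _) List.length_append) ▸
    (disjoint_tens (C := C) (L := L ++ L') (L' := L'')
      (disjoint_join_left (e1 := List.length_append) (h1 := h01 _ _) (h02 _ _) (h12 _ _)))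
  have d2 := fun L L' L'' : List C.carrier => (tens_append L' L'' _ _ (h12 _ _) List.length_append) ▸
    (disjoint_tens (C := C) (L := L) (L' := L' ++ L'')
      (disjoint_join_right (e1 := List.length_append) (h1 := h12 _ _) (h01 _ _) (h02 _ _)))
  refine (rep_tensor _ _ _ _ _ _ _ _ _ _).trans ?_
  refine (addMap_heq (k := d1 _ _ _) (k' := d1 _ _ _) (tens_append _ _ _ _ _ _)
    (tens_append _ _ _ _ _ _) rfl rfl (rep_tensor _ _ _ _ _ _ _ _ _ _) HEq.rfl).trans ?_
  refine HEq.trans ?_ (rep_tensor _ _ _ _ _ _ _ _ _ _).symm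
  refine HEq.trans ?_ (addMap_heq (h := d2 _ _ _) (h' := d2 _ _ _) rfl rfl
    (tens_append _ _ _ _ _ _).symm (tens_append _ _ _ _ _ _).symm HEq.rfl
    (rep_tensor _ _ _ _ _ _ _ _ _ _).symm)
  exact C.addMap_assoc _ _ _ _ (disjoint_tens (h02 _ _)) _ _ _ _ (disjoint_tens (h02 _ _)) _ _ _

theorem id_tensor (α : SigmaHom X Y) : tensor (id []) α = α := by
  have h01 := fun m n => Inj.disjoint_std m n (k := 0) (l := 1) (by decide)
  refine eq_of_heq (heq_of_rep rfl rfl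
    (Inj.join (Inj.std _ 0) (Inj.std _ 1) (h01 _ _) List.length_append)
    (Inj.join (Inj.std _ 0) (Inj.std _ 1) (h01 _ _) List.length_append)
    (Inj.std _ 1) (Inj.std _ 1)
    (fun i hi hi' x => by exact congrArg (fun φ : Inj X.length => φ (⟨i, hi'⟩, x)) (join_nil _ _ _ _))
    (fun i hi hi' x => by exact congrArg (fun φ : Inj Y.length => φ (⟨i, hi'⟩, x)) (join_nil _ _ _ _)) ?_)
  refine (rep_tensor _ _ _ _ _ _ _ _ _ _).trans ?_
  rw [rep_id]
  exact C.zero_addMap _ _ _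

theorem tensor_id_nil (α : SigmaHom X Y) : tensor α (id []) ≍ α := by
  have h01 := fun m n => Inj.disjoint_std m n (k := 0) (l := 1) (by decide)
  refine heq_of_rep (List.append_nil _) (List.append_nil _)
    (Inj.join (Inj.std _ 0) (Inj.std _ 1) (h01 _ _) List.length_append)
    (Inj.join (Inj.std _ 0) (Inj.std _ 1) (h01 _ _) List.length_append)
    (Inj.std _ 0) (Inj.std _ 0)
    (fun i hi hi' x => join_right_nil _ _ _ _ _ _ _ _)
    (fun i hi hi' x => join_right_nil _ _ _ _ _ _ _ _) ?_
  refine (rep_tensor _ _ _ _ _ _ _ _ _ _).trans ?_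
  rw [rep_id]
  exact (C.addMap_comm _ _ _ _).trans (C.zero_addMap _ _ _)

theorem rep_swap (φ : Inj X.length) (θ : Inj Y.length)
    (h : Disjoint (Set.range φ) (Set.range θ)) (e e') :
    (swap X Y).rep (Inj.join φ θ h e) (Inj.join θ φ h.symm e') =
      CategoryTheory.eqToHom (by rw [tens_append, tens_append, C.add_comm]) :=
  (IsId.swap φ θ h e e').choose_spec

theorem tensor_swap (α : SigmaHom X Y) (β : SigmaHom X' Y') :
    (tensor α β).comp (swap Y Y') = (swap X X').comp (tensor β α) := by
  have h01 := fun m n => Inj.disjoint_std m n (k := 0) (l := 1) (by decide)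
  refine ext_rep (Inj.join (Inj.std _ 0) (Inj.std _ 1) (h01 _ _) List.length_append)
    (Inj.join (Inj.std _ 1) (Inj.std _ 0) (h01 _ _).symm List.length_append) ?_
  rw [rep_comp _ _ _ (Inj.join (Inj.std _ 0) (Inj.std _ 1) (h01 _ _) List.length_append),
    rep_comp (swap X X') _ _ (Inj.join (Inj.std _ 1) (Inj.std _ 0) (h01 _ _).symm
      List.length_append), rep_swap, rep_swap]
  apply eq_of_heq
  rw [comp_eqToHom_heq_iff, heq_eqToHom_comp_iff]
  exact (rep_tensor _ _ _ _ _ _ _ _ _ _).trans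
    ((C.addMap_comm _ _ _ _).trans (rep_tensor _ _ _ _ _ _ _ _ _ _).symm)

theorem swap_swap (X Y : List C.carrier) : (swap X Y).comp (swap Y X) = id (X ++ Y) := by
  have h01 := fun m n => Inj.disjoint_std m n (k := 0) (l := 1) (by decide)
  exact IsId.eq ((IsId.swap (Inj.std _ 0) (Inj.std _ 1) (h01 _ _) List.length_append
    List.length_append).comp (IsId.swap (Inj.std _ 1) (Inj.std _ 0) (h01 _ _).symm
    List.length_append List.length_append)) (IsId.id _)

end SigmaHom

open SigmaHom

/-- The tensor product of `Σ(C)` is concatenation, strictly associative and unital. -/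
instance : MonoidalCategoryStruct C.SigmaCat where
  tensorObj X Y := List.append X Y
  tensorHom {X X' Y Y'} α β := SigmaHom.tensor (X := X) (Y := X') (X' := Y) (Y' := Y') α β
  whiskerLeft X {Y Y'} β := SigmaHom.tensor (X := X) (Y := X) (X' := Y) (Y' := Y') (SigmaHom.id X) β
  whiskerRight {X X'} α Y := SigmaHom.tensor (X := X) (Y := X') (X' := Y) (Y' := Y) α (SigmaHom.id Y)
  tensorUnit := ([] : List C.carrier)
  associator X Y Z := eqToIso (List.append_assoc X Y Z)
  leftUnitor X := Iso.refl X
  rightUnitor X := eqToIso (List.append_nil X)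

namespace SigmaCat

theorem eqToHom_tensorHom {X Y X' Y' : C.SigmaCat} (h : X = Y) (h' : X' = Y') :
    (eqToHom h ⊗ₘ eqToHom h') = eqToHom (by rw [h, h'] : X ⊗ X' = Y ⊗ Y') := by
  subst h h'
  exact SigmaHom.tensor_id X X'

theorem associator_hom (X Y Z : C.SigmaCat) :
    (α_ X Y Z).hom = eqToHom (show (X ⊗ Y) ⊗ Z = X ⊗ Y ⊗ Z from List.append_assoc X Y Z) := rfl

theorem leftUnitor_hom (X : C.SigmaCat) :
    (λ_ X).hom = eqToHom (show 𝟙_ _ ⊗ X = X from rfl) := rfl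

theorem rightUnitor_hom (X : C.SigmaCat) :
    (ρ_ X).hom = eqToHom (show X ⊗ 𝟙_ _ = X from List.append_nil X) := rfl

instance : MonoidalCategory C.SigmaCat :=
  MonoidalCategory.ofTensorHom
    (id_tensorHom_id := fun X Y => SigmaHom.tensor_id X Y)
    (id_tensorHom := fun X _ _ f => rfl)
    (tensorHom_id := fun f Y => rfl)
    (tensorHom_comp_tensorHom := fun f g h k => (SigmaHom.tensor_comp f h g k).symm)
    (associator_naturality := fun {X₁ X₂ X₃ Y₁ Y₂ Y₃} f g h =>
      square_of_heq (C := C.SigmaCat) (List.append_assoc X₁ X₂ X₃) (List.append_assoc Y₁ Y₂ Y₃)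
        (SigmaHom.tensor_assoc f g h))
    (leftUnitor_naturality := fun f =>
      (Category.comp_id _).trans ((SigmaHom.id_tensor f).trans (Category.id_comp _).symm))
    (rightUnitor_naturality := fun {X Y} f =>
      square_of_heq (C := C.SigmaCat) (List.append_nil X) (List.append_nil Y)
        (SigmaHom.tensor_id_nil f))
    (pentagon := fun W X Y Z => by
      simp only [associator_hom, ← eqToHom_refl _ rfl, eqToHom_tensorHom, eqToHom_trans])
    (triangle := fun X Y => by
      simp only [associator_hom, leftUnitor_hom, rightUnitor_hom, ← eqToHom_refl _ rfl,
        eqToHom_tensorHom, eqToHom_trans])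

theorem hexagon_forward_aux (X Y Z : C.SigmaCat) :
    (eqToHom (List.append_assoc X Y Z) : ((X ⊗ Y) ⊗ Z : C.SigmaCat) ⟶ X ⊗ Y ⊗ Z) ≫
      SigmaHom.swap (Y := List.append Y Z) X ≫
        (eqToHom (List.append_assoc Y Z X) : ((Y ⊗ Z) ⊗ X : C.SigmaCat) ⟶ Y ⊗ Z ⊗ X) =
    (SigmaHom.tensor (SigmaHom.swap X Y) (SigmaHom.id Z) : ((X ⊗ Y) ⊗ Z : C.SigmaCat) ⟶ (Y ⊗ X) ⊗ Z) ≫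
      (eqToHom (List.append_assoc Y X Z) : ((Y ⊗ X) ⊗ Z : C.SigmaCat) ⟶ Y ⊗ X ⊗ Z) ≫
        SigmaHom.tensor (SigmaHom.id Y) (SigmaHom.swap X Z) := by
  have h01 := fun m n => Inj.disjoint_std m n (k := 0) (l := 1) (by decide)
  have h02 := fun m n => Inj.disjoint_std m n (k := 0) (l := 2) (by decide)
  have h12 := fun m n => Inj.disjoint_std m n (k := 1) (l := 2) (by decide)
  refine SigmaHom.IsId.eq (X := List.append (List.append X Y) Z)
    (Y := List.append Y (List.append Z X))
    (φ := Inj.join (Inj.join (Inj.std _ 0) (Inj.std _ 1) (h01 _ _) List.length_append) (Inj.std _ 2)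
      (disjoint_join_left (h02 _ _) (h12 _ _)) List.length_append)
    (ψ := Inj.join (Inj.std _ 1) (Inj.join (Inj.std _ 2) (Inj.std _ 0) (h02 _ _).symm
        List.length_append)
      (disjoint_join_right (h12 _ _) (h01 _ _).symm) List.length_append) ?_ ?_
  · refine SigmaHom.IsId.comp (SigmaHom.IsId.eqToHom _ _
      (Inj.join (Inj.std _ 0) (Inj.join (Inj.std _ 1) (Inj.std _ 2) (h12 _ _)
        List.length_append) (disjoint_join_right (h01 _ _) (h02 _ _)) List.length_append)
      (fun i hi hi' x => join_join _ _ _ _ _ _ _ _ _ _ _ _ _ _ _)) ?_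
    refine SigmaHom.IsId.comp (SigmaHom.IsId.swap _ _ _ _ List.length_append) ?_
    exact SigmaHom.IsId.eqToHom _ _ _
      (fun i hi hi' x => join_join _ _ _ _ _ _ _ _ _ _ _ _ _ _ _)
  · refine SigmaHom.IsId.comp (SigmaHom.IsId.tensor (SigmaHom.IsId.swap _ _ _ _
      List.length_append) (SigmaHom.IsId.id _) _
      (disjoint_join_left (h12 _ _) (h02 _ _)) _ List.length_append) ?_
    refine SigmaHom.IsId.comp (SigmaHom.IsId.eqToHom _ _
      (Inj.join (Inj.std _ 1) (Inj.join (Inj.std _ 0) (Inj.std _ 2) (h02 _ _)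
        List.length_append) (disjoint_join_right (h01 _ _).symm (h12 _ _)) List.length_append)
      (fun i hi hi' x => join_join _ _ _ _ _ _ _ _ _ _ _ _ _ _ _)) ?_
    exact SigmaHom.IsId.tensor (SigmaHom.IsId.id _) (SigmaHom.IsId.swap _ _ _ _ _) _ _ _ _

theorem hexagon_reverse_aux (X Y Z : C.SigmaCat) :
    (eqToHom (List.append_assoc X Y Z).symm : (X ⊗ Y ⊗ Z : C.SigmaCat) ⟶ (X ⊗ Y) ⊗ Z) ≫
      SigmaHom.swap (X := List.append X Y) Z ≫
        (eqToHom (List.append_assoc Z X Y).symm : (Z ⊗ X ⊗ Y : C.SigmaCat) ⟶ (Z ⊗ X) ⊗ Y) =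
    (SigmaHom.tensor (SigmaHom.id X) (SigmaHom.swap Y Z) : (X ⊗ Y ⊗ Z : C.SigmaCat) ⟶ X ⊗ Z ⊗ Y) ≫
      (eqToHom (List.append_assoc X Z Y).symm : (X ⊗ Z ⊗ Y : C.SigmaCat) ⟶ (X ⊗ Z) ⊗ Y) ≫
        SigmaHom.tensor (SigmaHom.swap X Z) (SigmaHom.id Y) := by
  have h01 := fun m n => Inj.disjoint_std m n (k := 0) (l := 1) (by decide)
  have h02 := fun m n => Inj.disjoint_std m n (k := 0) (l := 2) (by decide)
  have h12 := fun m n => Inj.disjoint_std m n (k := 1) (l := 2) (by decide)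
  refine SigmaHom.IsId.eq (X := List.append X (List.append Y Z))
    (Y := List.append (List.append Z X) Y)
    (φ := Inj.join (Inj.std _ 0) (Inj.join (Inj.std _ 1) (Inj.std _ 2) (h12 _ _)
        List.length_append) (disjoint_join_right (h01 _ _) (h02 _ _)) List.length_append)
    (ψ := Inj.join (Inj.join (Inj.std _ 2) (Inj.std _ 0) (h02 _ _).symm List.length_append)
      (Inj.std _ 1) (disjoint_join_left (h12 _ _).symm (h01 _ _)) List.length_append) ?_ ?_
  · refine SigmaHom.IsId.comp (SigmaHom.IsId.eqToHom _ _
      (Inj.join (Inj.join (Inj.std _ 0) (Inj.std _ 1) (h01 _ _) List.length_append) (Inj.std _ 2)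
      (disjoint_join_left (h02 _ _) (h12 _ _)) List.length_append)
      (fun i hi hi' x => (join_join _ _ _ _ _ _ _ _ _ _ _ _ _ _ _).symm)) ?_
    refine SigmaHom.IsId.comp (SigmaHom.IsId.swap _ _ _ _ List.length_append) ?_
    exact SigmaHom.IsId.eqToHom _ _ _
      (fun i hi hi' x => (join_join _ _ _ _ _ _ _ _ _ _ _ _ _ _ _).symm)
  · refine SigmaHom.IsId.comp (SigmaHom.IsId.tensor (SigmaHom.IsId.id _) (SigmaHom.IsId.swap _ _ _ _
      List.length_append) _ (disjoint_join_right (h02 _ _) (h01 _ _)) _ List.length_append) ?_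
    refine SigmaHom.IsId.comp (SigmaHom.IsId.eqToHom _ _
      (Inj.join (Inj.join (Inj.std _ 0) (Inj.std _ 2) (h02 _ _) List.length_append) (Inj.std _ 1)
      (disjoint_join_left (h01 _ _) (h12 _ _).symm) List.length_append)
      (fun i hi hi' x => (join_join _ _ _ _ _ _ _ _ _ _ _ _ _ _ _).symm)) ?_
    exact SigmaHom.IsId.tensor (SigmaHom.IsId.swap _ _ _ _ _) (SigmaHom.IsId.id _) _ _ _ _

instance : SymmetricCategory C.SigmaCat where
  braiding X Y := ⟨SigmaHom.swap X Y, SigmaHom.swap Y X, SigmaHom.swap_swap X Y,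
    SigmaHom.swap_swap Y X⟩
  braiding_naturality_right X {_ _} f := SigmaHom.tensor_swap (SigmaHom.id X) f
  braiding_naturality_left f Z := SigmaHom.tensor_swap f (SigmaHom.id Z)
  hexagon_forward X Y Z := hexagon_forward_aux X Y Z
  hexagon_reverse X Y Z := hexagon_reverse_aux X Y Z
  symmetry X Y := SigmaHom.swap_swap X Y

instance : Permutative C.SigmaCat where
  tensor_assoc X Y Z := List.append_assoc X Y Z
  unit_tensor X := List.nil_append X
  tensor_unit X := List.append_nil X
  associator_eq _ _ _ := rfl
  leftUnitor_eq _ := rfl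
  rightUnitor_eq _ := rfl

end SigmaCat

end ParSumCat

/-- Reindexing along an equality of lengths. -/
def Inj.cast {m n : ℕ} (φ : Inj m) (e : n = m) : Inj n where
  toFun p := φ (Fin.cast e p.1, p.2)
  inj' p q h := by
    have := φ.injective h
    simp only [Prod.mk.injEq, Fin.cast_inj] at this
    exact Prod.ext this.1 this.2

theorem Inj.range_cast {m n : ℕ} (φ : Inj m) (e : n = m) :
    Set.range (φ.cast e) = Set.range φ := by
  subst e; rfl

theorem eqToHom_heq_eqToHom {C : Type u} [Category.{v} C] {X Y X' Y' : C} (hX : X = X')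
    (hY : Y = Y') (h : X = Y) (h' : X' = Y') : eqToHom h ≍ eqToHom h' := by
  subst hX hY; rfl

namespace ParSumCat

variable {C D E : ParSumCat.{v, u}}

namespace Hom

theorem map_tens (F : Hom C D) (L : List C.carrier) (φ : Inj L.length) (e) :
    F.functor.obj (C.tens L φ) = D.tens (L.map F.functor.obj) (φ.cast e) := by
  induction L with
  | nil => exact F.map_zero
  | cons X L ih =>
    refine (F.map_add _ _ (disjoint_act_tens X L φ) (F.disjoint (disjoint_act_tens X L φ))).trans ?_
    exact add_congr (F.act_comm_obj _ _) (ih φ.tail (List.length_map _))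

theorem map_trans (F : Hom C D) (L : List C.carrier) (φ ψ : Inj L.length) (e) :
    F.functor.map (C.trans L φ ψ) ≍ D.trans (L.map F.functor.obj) (φ.cast e) (ψ.cast e) := by
  induction L with
  | nil => exact (heq_of_eq (F.functor.map_id _)).trans (id_heq F.map_zero)
  | cons X L ih =>
    refine (F.map_addMap (disjoint_act_tens X L φ) (disjoint_act_tens X L ψ) _ _
      (F.disjoint (disjoint_act_tens X L φ)) (F.disjoint (disjoint_act_tens X L ψ))).trans ?_
    exact addMap_heq (F.act_comm_obj _ _) (F.act_comm_obj _ _) (F.map_tens _ _ (List.length_map _))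
      (F.map_tens _ _ (List.length_map _)) (F.tr_comm _ _ _) (ih φ.tail ψ.tail (List.length_map _))

end Hom

namespace SigmaHom

variable {X Y Z X' Y' Z' : List C.carrier}

/-- The map `[ψ, f, φ] ↦ [ψ, F(f), φ]` given by a morphism `F` of parsummable categories. Here we
pick particular representatives; see `map_mk` for the independence of this choice. -/
def map (F : Hom C D) (α : SigmaHom X Y) :
    SigmaHom (X.map F.functor.obj) (Y.map F.functor.obj) :=
  mk ((Inj.std _ 0).cast (List.length_map _)) ((Inj.std _ 0).cast (List.length_map _))
    (eqToHom (F.map_tens _ _ _).symm ≫ F.functor.map (α.rep (Inj.std _ 0) (Inj.std _ 0)) ≫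
      eqToHom (F.map_tens _ _ _))

theorem rep_map (F : Hom C D) (α : SigmaHom X Y) (φ : Inj X.length) (ψ : Inj Y.length) (e e') :
    (map F α).rep (φ.cast e) (ψ.cast e') ≍ F.functor.map (α.rep φ ψ) := by
  rw [map, rep_mk]
  have e1 : α.rep φ ψ = C.trans X φ (Inj.std _ 0) ≫ α.rep (Inj.std _ 0) (Inj.std _ 0) ≫
      C.trans Y (Inj.std _ 0) ψ := by rw [← rep_mk, mk_rep]
  rw [e1, Functor.map_comp, Functor.map_comp]
  refine comp_heq (F.map_tens _ _ _).symm (F.map_tens _ _ _).symm (F.map_tens _ _ _).symm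
    (F.map_trans _ _ _ _).symm ?_
  refine comp_heq (F.map_tens _ _ _).symm (F.map_tens _ _ _).symm (F.map_tens _ _ _).symm
    ?_ (F.map_trans _ _ _ _).symm
  simp

theorem map_mk (F : Hom C D) (φ : Inj X.length) (ψ : Inj Y.length)
    (f : C.tens X φ ⟶ C.tens Y ψ) :
    map F (mk φ ψ f) = mk (φ.cast (List.length_map _)) (ψ.cast (List.length_map _))
      (eqToHom (F.map_tens _ _ _).symm ≫ F.functor.map f ≫ eqToHom (F.map_tens _ _ _)) := by
  refine ext_rep (φ.cast (List.length_map _)) (ψ.cast (List.length_map _)) (eq_of_heq ?_)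
  refine (rep_map F _ _ _ _ _).trans ?_
  simp [rep_mk_self]

theorem map_id (F : Hom C D) (X : List C.carrier) :
    map F (id X) = id (X.map F.functor.obj) := by
  refine ext_rep ((Inj.std _ 0).cast (List.length_map _)) ((Inj.std _ 0).cast (List.length_map _))
    (eq_of_heq ?_)
  refine (rep_map F _ _ _ _ _).trans ?_
  rw [rep_id, rep_id]
  exact F.map_trans _ _ _ _

theorem map_comp (F : Hom C D) (α : SigmaHom X Y) (β : SigmaHom Y Z) :
    map F (α.comp β) = (map F α).comp (map F β) := by
  refine ext_rep ((Inj.std _ 0).cast (List.length_map _)) ((Inj.std _ 0).cast (List.length_map _))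
    (eq_of_heq ?_)
  refine (rep_map F _ _ _ _ _).trans ?_
  rw [rep_comp _ _ _ ((Inj.std _ 0).cast (List.length_map _)), rep_comp _ _ _ (Inj.std _ 0),
    Functor.map_comp]
  exact comp_heq (F.map_tens _ _ _) (F.map_tens _ _ _) (F.map_tens _ _ _)
    (rep_map F _ _ _ _ _).symm (rep_map F _ _ _ _ _).symm

theorem join_cast {k l k' l' n n' : ℕ} (φ : Inj k) (θ : Inj l) (h) (e : n = k + l)
    (a : n' = n) (b : k' = k) (c : l' = l) (h') (d : n' = k' + l') (i : ℕ) (hi : i < n') (x : ℕ) :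
    (Inj.join φ θ h e).cast a (⟨i, hi⟩, x) =
      Inj.join (φ.cast b) (θ.cast c) h' d (⟨i, hi⟩, x) := by
  subst b c a e; rfl

theorem map_tensor (F : Hom C D) (α : SigmaHom X Y) (β : SigmaHom X' Y') :
    map F (tensor α β) ≍ tensor (map F α) (map F β) := by
  have h01 := fun m n => Inj.disjoint_std m n (k := 0) (l := 1) (by decide)
  have h01' := fun {m n m' n' : ℕ} (a : m' = m) (b : n' = n) =>
    (show Disjoint (Set.range ((Inj.std m 0).cast a)) (Set.range ((Inj.std n 1).cast b)) by
      rw [Inj.range_cast, Inj.range_cast]; exact h01 _ _)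
  refine heq_of_rep List.map_append List.map_append
    ((Inj.join (Inj.std _ 0) (Inj.std _ 1) (h01 _ _) List.length_append).cast (List.length_map _))
    ((Inj.join (Inj.std _ 0) (Inj.std _ 1) (h01 _ _) List.length_append).cast (List.length_map _))
    (Inj.join ((Inj.std _ 0).cast (List.length_map _)) ((Inj.std _ 1).cast (List.length_map _))
      (h01' _ _) List.length_append)
    (Inj.join ((Inj.std _ 0).cast (List.length_map _)) ((Inj.std _ 1).cast (List.length_map _))
      (h01' _ _) List.length_append)
    (fun i hi hi' x => ?_) (fun i hi hi' x => ?_) ?_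
  · exact join_cast _ _ _ _ _ (List.length_map _) (List.length_map _) (h01' _ _) (by simp) _ _ _
  · exact join_cast _ _ _ _ _ (List.length_map _) (List.length_map _) (h01' _ _) (by simp) _ _ _
  refine (rep_map F _ _ _ _ _).trans ?_
  refine (functor_map_heq F.functor (tens_append _ _ _ _ _ _) (tens_append _ _ _ _ _ _)
    (rep_tensor _ _ _ _ _ _ _ _ _ _)).trans ?_
  refine HEq.trans ?_ (rep_tensor _ _ _ _ _ _ _ _ _ _).symm
  refine (F.map_addMap _ _ _ _ (F.disjoint (disjoint_tens (h01 _ _)))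
    (F.disjoint (disjoint_tens (h01 _ _)))).trans ?_
  exact addMap_heq (F.map_tens _ _ _) (F.map_tens _ _ _) (F.map_tens _ _ _) (F.map_tens _ _ _)
    (rep_map F _ _ _ _ _).symm (rep_map F _ _ _ _ _).symm

theorem IsId.map {α : SigmaHom X Y} {φ : Inj X.length} {ψ : Inj Y.length} (h : α.IsId φ ψ)
    (F : Hom C D) : (α.map F).IsId (φ.cast (List.length_map _)) (ψ.cast (List.length_map _)) := by
  obtain ⟨h1, h2⟩ := h
  refine ⟨(F.map_tens _ _ _).symm.trans ((congrArg F.functor.obj h1).trans (F.map_tens _ _ _)),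
    eq_of_heq ((rep_map F _ _ _ _ _).trans ?_)⟩
  rw [h2, eqToHom_map]
  refine (eqToHom_heq_id_dom _ _ _).trans (HEq.trans ?_ (eqToHom_heq_id_dom _ _ _).symm)
  exact id_heq (F.map_tens _ _ _)

theorem IsId.heq {X Y X' Y' : List C.carrier} {α : SigmaHom X Y} {β : SigmaHom X' Y'}
    (hX : X = X') (hY : Y = Y') {φ : Inj X.length} {ψ : Inj Y.length}
    {φ' : Inj X'.length} {ψ' : Inj Y'.length} (hα : α.IsId φ ψ) (hβ : β.IsId φ' ψ')
    (hφ : ∀ i (hi : i < X.length) (hi' : i < X'.length) x, φ (⟨i, hi⟩, x) = φ' (⟨i, hi'⟩, x))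
    (hψ : ∀ i (hi : i < Y.length) (hi' : i < Y'.length) x, ψ (⟨i, hi⟩, x) = ψ' (⟨i, hi'⟩, x)) :
    α ≍ β := by
  subst hX hY
  have h1 : φ = φ' := by ext ⟨⟨i, hi⟩, x⟩; exact hφ i hi hi x
  have h2 : ψ = ψ' := by ext ⟨⟨i, hi⟩, x⟩; exact hψ i hi hi x
  subst h1 h2
  exact heq_of_eq (hα.eq hβ)

theorem map_swap (F : Hom C D) (X Y : List C.carrier) :
    map F (swap X Y) ≍ swap (X.map F.functor.obj) (Y.map F.functor.obj) := by
  have h01 := fun m n => Inj.disjoint_std m n (k := 0) (l := 1) (by decide)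
  have h01' := fun {m n m' n' : ℕ} (a : m' = m) (b : n' = n) =>
    (show Disjoint (Set.range ((Inj.std m 0).cast a)) (Set.range ((Inj.std n 1).cast b)) by
      rw [Inj.range_cast, Inj.range_cast]; exact h01 _ _)
  refine IsId.heq List.map_append List.map_append
    ((IsId.swap (Inj.std _ 0) (Inj.std _ 1) (h01 _ _) List.length_append List.length_append).map F)
    (IsId.swap ((Inj.std _ 0).cast (List.length_map _)) ((Inj.std _ 1).cast (List.length_map _))
      (h01' _ _) List.length_append List.length_append)
    (fun i hi hi' x => ?_) (fun i hi hi' x => ?_)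
  · exact join_cast _ _ _ _ _ (List.length_map _) (List.length_map _) (h01' _ _) (by simp) _ _ _
  · exact join_cast _ _ _ _ _ (List.length_map _) (List.length_map _) (h01' _ _).symm (by simp) _ _ _

end SigmaHom

/-- The functor `Σ(F) : Σ(C) ⥤ Σ(D)`. -/
def sigmaFunctor (F : Hom C D) : C.SigmaCat ⥤ D.SigmaCat where
  obj X := List.map F.functor.obj X
  map α := SigmaHom.map F α
  map_id X := SigmaHom.map_id F X
  map_comp α β := SigmaHom.map_comp F α β

theorem sigmaFunctor_strict (F : Hom C D) : IsStrictSymm (sigmaFunctor F) where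
  obj_unit := rfl
  obj_tensor X Y := List.map_append
  map_tensor f g := SigmaHom.map_tensor F f g
  map_associator X Y Z := by
    rw [SigmaCat.associator_hom, SigmaCat.associator_hom, eqToHom_map]
    exact eqToHom_heq_eqToHom (C := D.SigmaCat)
      (List.map_append.trans (congrArg (· ++ List.map F.functor.obj Z) List.map_append))
      (List.map_append.trans (congrArg (List.map F.functor.obj X ++ ·) List.map_append)) _ _
  map_leftUnitor X := by
    rw [SigmaCat.leftUnitor_hom, eqToHom_map]
    exact HEq.rfl
  map_rightUnitor X := by
    rw [SigmaCat.rightUnitor_hom, SigmaCat.rightUnitor_hom, eqToHom_map]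
    exact eqToHom_heq_eqToHom (C := D.SigmaCat) List.map_append rfl _ _
  map_braiding X Y := SigmaHom.map_swap F X Y

/-- The small permutative category `Σ(C)`. -/
def sigmaObj (C : ParSumCat.{v, u}) : PermCat.{v, u} where
  carrier := C.SigmaCat

/-- The functor `Σ` from parsummable categories to permutative categories. -/
def Sigma : ParSumCat.{v, u} ⥤ PermCat.{v, u} where
  obj C := sigmaObj C
  map F := ⟨sigmaFunctor F, sigmaFunctor_strict F⟩
  map_id C := by
    refine PermCat.Hom.ext (Functor.hext (fun X => List.map_id X) (fun X Y α => ?_))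
    refine SigmaHom.heq_of_rep (List.map_id _) (List.map_id _)
      ((Inj.std _ 0).cast (List.length_map _)) ((Inj.std _ 0).cast (List.length_map _))
      (Inj.std _ 0) (Inj.std _ 0) (fun _ _ _ _ => rfl) (fun _ _ _ _ => rfl) ?_
    exact SigmaHom.rep_map _ _ _ _ _ _
  map_comp {C D E} F G := by
    have hm : ∀ X : List C.carrier, List.map (F ≫ G : C ⟶ E).functor.obj X =
        List.map G.functor.obj (List.map F.functor.obj X) := fun X =>
        (List.map_map (f := F.functor.obj) (g := G.functor.obj) (l := X)).symm
    refine PermCat.Hom.ext (Functor.hext (fun X => hm X) (fun X Y α => ?_))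
    refine SigmaHom.heq_of_rep (hm X) (hm Y)
      ((Inj.std _ 0).cast (List.length_map _)) ((Inj.std _ 0).cast (List.length_map _))
      (((Inj.std _ 0).cast (List.length_map _)).cast (List.length_map _))
      (((Inj.std _ 0).cast (List.length_map _)).cast (List.length_map _))
      (fun _ _ _ _ => rfl) (fun _ _ _ _ => rfl) ?_
    refine (SigmaHom.rep_map (F ≫ G : C ⟶ E) _ _ _ _ _).trans ?_
    refine HEq.trans ?_ (SigmaHom.rep_map _ _ _ _ _ _).symm
    exact functor_map_heq G.functor (F.map_tens _ _ _) (F.map_tens _ _ _)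
      (SigmaHom.rep_map _ _ _ _ _ _).symm

end ParSumCat

/-! ## The symmetric monoidal category `μ^*(C)` -/

namespace Inj

/-- The canonical bijection `{1} × ω ≅ ω`. -/
def one : Inj 1 := ⟨fun p => p.2, fun _ _ h => Prod.ext (Subsingleton.elim _ _) h⟩

/-- The unique injection `∅ × ω ↣ ω`. -/
def nil : Inj 0 := ⟨fun p => p.1.elim0, fun p => p.1.elim0⟩

theorem disjoint_row {n : ℕ} (φ : Inj n) {i j : Fin n} (h : i ≠ j) :
    Disjoint (Set.range (φ.row i)) (Set.range (φ.row j)) := by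
  rw [Set.disjoint_left]
  rintro _ ⟨x, rfl⟩ ⟨y, hy⟩
  have := φ.injective hy
  simp only [Prod.mk.injEq] at this
  exact h this.1.symm

theorem range_trans_subset {n : ℕ} (φ : Inj n) (u : ℕ ↪ ℕ) :
    Set.range (φ.trans u) ⊆ Set.range u := by
  rintro _ ⟨x, rfl⟩; exact ⟨φ x, rfl⟩

theorem disjoint_trans {m n k : ℕ} (φ : Inj m) (θ : Inj n) (μ : Inj k) {i j : Fin k} (h : i ≠ j) :
    Disjoint (Set.range (φ.trans (μ.row i))) (Set.range (θ.trans (μ.row j))) :=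
  (μ.disjoint_row h).mono (range_trans_subset _ _) (range_trans_subset _ _)

/-- The injection `μ ∘ (π × id)`, where `π` exchanges the two indices. -/
def flip (μ : Inj 2) : Inj 2 :=
  ⟨fun p => μ (p.1.rev, p.2), fun p q h => by
    have := μ.injective h
    simp only [Prod.mk.injEq, Fin.rev_inj] at this
    exact Prod.ext this.1 this.2⟩

/-- The injection `μ ∘ (μ ⨿ 1) = μ(1, -) ∘ μ + μ(2, -)`. -/
def assocLeft (μ : Inj 2) : Inj 3 :=
  join (μ.trans (μ.row 0)) (one.trans (μ.row 1)) (disjoint_trans _ _ _ (by decide)) rfl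

/-- The injection `μ ∘ (1 ⨿ μ) = μ(1, -) + μ(2, -) ∘ μ`. -/
def assocRight (μ : Inj 2) : Inj 3 :=
  join (one.trans (μ.row 0)) (μ.trans (μ.row 1)) (disjoint_trans _ _ _ (by decide)) rfl

theorem join_at (μ : Inj 2) (e : 2 = 1 + 1) : join (one.trans (μ.row 0)) (one.trans (μ.row 1))
    (disjoint_trans _ _ _ (by decide)) e = μ := by
  ext ⟨⟨i, hi⟩, x⟩
  by_cases h : i < 1
  · obtain rfl : i = 0 := by omega
    exact join_apply_lt _ _ _ _ _ h x
  · obtain rfl : i = 1 := by omega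
    exact join_apply_ge _ _ _ _ _ h x

theorem join_flip (μ : Inj 2) (e : 2 = 1 + 1) : join (one.trans (μ.row 1)) (one.trans (μ.row 0))
    (disjoint_trans _ _ _ (by decide)) e = μ.flip := by
  ext ⟨⟨i, hi⟩, x⟩
  by_cases h : i < 1
  · obtain rfl : i = 0 := by omega
    exact join_apply_lt _ _ _ _ _ h x
  · obtain rfl : i = 1 := by omega
    exact join_apply_ge _ _ _ _ _ h x

end Inj

namespace ParSumCat

variable {C D E : ParSumCat.{v, u}}

theorem addMap_zero {X X' : C.carrier} (h : Disjoint (C.em.supp X) (C.em.supp C.zero))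
    (h' : Disjoint (C.em.supp X') (C.em.supp C.zero)) (f : X ⟶ X') :
    C.addMap h h' f (𝟙 C.zero) ≍ f :=
  (C.addMap_comm _ _ _ _).trans (C.zero_addMap _ _ _)

theorem add_zero (X : C.carrier) (h : Disjoint (C.em.supp X) (C.em.supp C.zero)) :
    C.add X C.zero h = X :=
  (C.add_comm _ _ _).trans (C.zero_add _ _)

theorem tens_singleton (X : C.carrier) (φ : Inj 1) :
    C.tens [X] φ = (C.em.act (φ.row 0)).obj X :=
  add_zero _ _

theorem trans_singleton (X : C.carrier) (φ ψ : Inj 1) :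
    C.trans [X] φ ψ ≍ (C.em.tr (φ.row 0) (ψ.row 0)).app X :=
  addMap_zero _ _ _

theorem tens_one (X : C.carrier) : C.tens [X] Inj.one = X :=
  (tens_singleton X Inj.one).trans (C.em.act_one_obj X)

theorem tens_trans_row (X : C.carrier) (u : ℕ ↪ ℕ) :
    C.tens [X] (Inj.one.trans u) = (C.em.act u).obj X :=
  tens_singleton X (Inj.one.trans u)

theorem act_zero_map (u : ℕ ↪ ℕ) : (C.em.act u).map (𝟙 C.zero) ≍ 𝟙 C.zero := by
  rw [CategoryTheory.Functor.map_id]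
  exact id_heq (C.act_zero u)

namespace SigmaHom

variable {X Y Z X' Y' Z' : List C.carrier}

theorem rep_change (α : SigmaHom X Y) (φ φ' : Inj X.length) (ψ ψ' : Inj Y.length) :
    α.rep φ' ψ' = C.trans X φ' φ ≫ α.rep φ ψ ≫ C.trans Y ψ ψ' := by
  rw [← rep_mk, mk_rep]

theorem nat_tr {A B : C.carrier} (f : A ⟶ B) (u : ℕ ↪ ℕ) :
    (C.em.act u).map f ≍ (C.em.tr u (Function.Embedding.refl ℕ)).app A ≫
      (C.em.act (Function.Embedding.refl ℕ)).map f ≫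
        (C.em.tr (Function.Embedding.refl ℕ) u).app B := by
  rw [(C.em.tr (Function.Embedding.refl ℕ) u).naturality f, ← Category.assoc,
    C.em.tr_app_trans, C.em.tr_app_self, Category.id_comp]

/-- `[u ∘ ψ, u_*(f), u ∘ φ] = [ψ, f, φ]`. -/
theorem rep_trans (α : SigmaHom X Y) (φ : Inj X.length) (ψ : Inj Y.length) (u : ℕ ↪ ℕ) :
    α.rep (φ.trans u) (ψ.trans u) ≍ (C.em.act u).map (α.rep φ ψ) := by
  rw [rep_change α φ (φ.trans u) ψ (ψ.trans u)]
  refine HEq.trans ?_ (nat_tr _ _).symm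
  have h : ∀ (L : List C.carrier) (φ : Inj L.length),
      φ.trans (Function.Embedding.refl ℕ) = φ := fun L φ => rfl
  exact comp_heq (act_tens _ _ _).symm (C.em.act_one_obj _).symm (act_tens _ _ _).symm
    (tr_tens u (Function.Embedding.refl ℕ) X φ).symm
    (comp_heq (C.em.act_one_obj _).symm (C.em.act_one_obj _).symm (act_tens _ _ _).symm
      (C.em.act_map_heq_one _).symm (tr_tens (Function.Embedding.refl ℕ) u Y ψ).symm)

theorem IsId.trans {α : SigmaHom X Y} {φ : Inj X.length} {ψ : Inj Y.length} (h : α.IsId φ ψ)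
    (u : ℕ ↪ ℕ) : α.IsId (φ.trans u) (ψ.trans u) := by
  obtain ⟨h1, h2⟩ := h
  have h3 : C.tens X (φ.trans u) = C.tens Y (ψ.trans u) := by
    rw [← act_tens, ← act_tens, h1]
  refine ⟨h3, eq_of_heq ((rep_trans _ _ _ _).trans ?_)⟩
  rw [h2, eqToHom_map]
  exact eqToHom_heq_eqToHom (act_tens _ _ _) (act_tens _ _ _) _ _

/-- The isomorphism `[ψ, id, φ]`. -/
def idIso (X Y : List C.carrier) (φ : Inj X.length) (ψ : Inj Y.length)
    (h : C.tens X φ = C.tens Y ψ) : Iso (C := C.SigmaCat) X Y where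
  hom := mk φ ψ (CategoryTheory.eqToHom h)
  inv := mk ψ φ (CategoryTheory.eqToHom h.symm)
  hom_inv_id := ((IsId.mk h).comp (IsId.mk h.symm)).eq (IsId.id φ)
  inv_hom_id := ((IsId.mk h.symm).comp (IsId.mk h)).eq (IsId.id ψ)

/-- The morphism `[1, f, 1] : (A) ⟶ (B)`. -/
def nu {A B : C.carrier} (f : A ⟶ B) : SigmaHom [A] [B] :=
  mk Inj.one Inj.one
    (CategoryTheory.eqToHom (tens_one A) ≫ f ≫ CategoryTheory.eqToHom (tens_one B).symm)

theorem rep_nu {A B : C.carrier} (f : A ⟶ B) : (nu f).rep Inj.one Inj.one ≍ f := by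
  rw [nu, rep_mk_self]; simp

theorem rep_nu_trans {A B : C.carrier} (f : A ⟶ B) (u : ℕ ↪ ℕ) :
    (nu f).rep (Inj.one.trans u) (Inj.one.trans u) ≍ (C.em.act u).map f :=
  (rep_trans _ _ _ _).trans (functor_map_heq _ (tens_one _) (tens_one _) (rep_nu f))

theorem IsId.rep_comp_left {α : SigmaHom X Y} {φ : Inj X.length} {ψ : Inj Y.length}
    (h : α.IsId φ ψ) (β : SigmaHom Y Z) (ρ : Inj Z.length) :
    (α.comp β).rep φ ρ ≍ β.rep ψ ρ := by
  obtain ⟨h1, h2⟩ := h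
  rw [rep_comp α β φ ψ ρ, h2, eqToHom_comp_heq_iff]

theorem IsId.rep_comp_right {β : SigmaHom Y Z} {ψ : Inj Y.length} {ρ : Inj Z.length}
    (h : β.IsId ψ ρ) (α : SigmaHom X Y) (φ : Inj X.length) :
    (α.comp β).rep φ ρ ≍ α.rep φ ψ := by
  obtain ⟨h1, h2⟩ := h
  rw [rep_comp α β φ ψ ρ, h2, comp_eqToHom_heq_iff]

theorem IsId.comp_nu {A B : C.carrier} {L : List C.carrier} {φ φ' : Inj L.length}
    {δ : SigmaHom L [A]} {δ' : SigmaHom L [B]} (h : δ.IsId φ Inj.one) (h' : δ'.IsId φ' Inj.one)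
    {g : A ⟶ B} (hg : g ≍ C.trans L φ φ') : δ.comp (nu g) = δ' := by
  refine ext_rep φ Inj.one (eq_of_heq ?_)
  obtain ⟨h1, h2⟩ := h
  obtain ⟨h3, h4⟩ := h'
  rw [rep_comp δ (nu g) φ Inj.one Inj.one, rep_change δ' φ' φ Inj.one Inj.one, trans_self, h2, h4,
    Category.comp_id, eqToHom_comp_heq_iff]
  refine ((rep_nu g).trans hg).trans ?_
  rw [heq_comp_eqToHom_iff]

end SigmaHom

/-- The underlying category of `μ^*(C)`. -/
def MuStarCat (_ : Inj 2) (C : ParSumCat.{v, u}) : Type u := C.carrier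

instance (μ : Inj 2) : Category.{v} (MuStarCat μ C) := inferInstanceAs (Category C.carrier)

/-- The functor `μ_*(-, -)` on morphisms: the sum of `μ(1, -)_*(f)` and `μ(2, -)_*(g)`. -/
def tensMap₂ (μ : Inj 2) {X X' Y Y' : C.carrier} (f : X ⟶ X') (g : Y ⟶ Y') :
    C.tens [X, Y] μ ⟶ C.tens [X', Y'] μ :=
  C.addMap (disjoint_act_tens X [Y] μ) (disjoint_act_tens X' [Y'] μ) ((C.em.act (μ.row 0)).map f)
    (C.addMap (disjoint_act_tens Y [] μ.tail) (disjoint_act_tens Y' [] μ.tail)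
      ((C.em.act (μ.row 1)).map g) (𝟙 C.zero))

theorem tens_pair (μ : Inj 2) (X Y : C.carrier)
    (h : Disjoint (C.em.supp ((C.em.act (μ.row 0)).obj X))
      (C.em.supp ((C.em.act (μ.row 1)).obj Y))) :
    C.tens [X, Y] μ = C.add ((C.em.act (μ.row 0)).obj X) ((C.em.act (μ.row 1)).obj Y) h :=
  add_congr rfl (add_zero _ _)

theorem tensMap₂_eq (μ : Inj 2) {X X' Y Y' : C.carrier} (f : X ⟶ X') (g : Y ⟶ Y')
    (h : Disjoint (C.em.supp ((C.em.act (μ.row 0)).obj X))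
      (C.em.supp ((C.em.act (μ.row 1)).obj Y)))
    (h' : Disjoint (C.em.supp ((C.em.act (μ.row 0)).obj X'))
      (C.em.supp ((C.em.act (μ.row 1)).obj Y'))) :
    tensMap₂ μ f g ≍ C.addMap h h' ((C.em.act (μ.row 0)).map f) ((C.em.act (μ.row 1)).map g) :=
  addMap_heq rfl rfl (add_zero _ _) (add_zero _ _) HEq.rfl (addMap_zero _ _ _)

theorem disjoint_rows (μ : Inj 2) (X Y : C.carrier) :
    Disjoint (C.em.supp ((C.em.act (μ.row 0)).obj X))
      (C.em.supp ((C.em.act (μ.row 1)).obj Y)) :=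
  (C.tame.within_act _ X).disjoint (C.tame.within_act _ Y) (μ.disjoint_row (by decide))

theorem tens_zero_left (μ : Inj 2) (X : C.carrier) :
    C.tens [C.zero, X] μ = (C.em.act (μ.row 1)).obj X :=
  (tens_pair μ _ _ (disjoint_rows μ _ _)).trans
    ((add_congr (k := C.act_zero (μ.row 0) ▸ disjoint_rows μ C.zero X)
      (C.act_zero _) rfl).trans (C.zero_add _ _))

theorem tens_zero_right (μ : Inj 2) (X : C.carrier) :
    C.tens [X, C.zero] μ = (C.em.act (μ.row 0)).obj X :=
  (tens_pair μ _ _ (disjoint_rows μ _ _)).trans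
    ((add_congr (k := C.act_zero (μ.row 1) ▸ disjoint_rows μ X C.zero)
      rfl (C.act_zero _)).trans (add_zero _ _))

theorem tens_flip (μ : Inj 2) (X Y : C.carrier) : C.tens [X, Y] μ.flip = C.tens [Y, X] μ :=
  (tens_pair μ.flip X Y (disjoint_rows _ _ _)).trans
    ((C.add_comm _ _ _).trans (tens_pair μ Y X _).symm)

theorem tens_assocLeft (μ : Inj 2) (X Y Z : C.carrier) :
    C.tens [X, Y, Z] μ.assocLeft = C.tens [C.tens [X, Y] μ, Z] μ := by
  refine (tens_append [X, Y] [Z] _ _ _ _).trans ?_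
  exact (add_congr (k := disjoint_rows μ (C.tens [X, Y] μ) Z) (act_tens (μ.row 0) [X, Y] μ).symm
    (tens_trans_row Z _)).trans (tens_pair μ _ _ _).symm

theorem tens_assocRight (μ : Inj 2) (X Y Z : C.carrier) :
    C.tens [X, Y, Z] μ.assocRight = C.tens [X, C.tens [Y, Z] μ] μ := by
  refine (tens_append [X] [Y, Z] _ _ _ _).trans ?_
  exact (add_congr (k := disjoint_rows μ X (C.tens [Y, Z] μ)) (tens_trans_row X _)
    (act_tens (μ.row 1) [Y, Z] μ).symm).trans (tens_pair μ _ _ _).symm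

/-- An isomorphism of the form `[ψ, φ]`, between objects equal to `φ_*(X₁, …)` and `ψ_*(X₁, …)`. -/
def transIso (L : List C.carrier) (φ ψ : Inj L.length) {A B : C.carrier} (hA : C.tens L φ = A)
    (hB : C.tens L ψ = B) : A ≅ B where
  hom := eqToHom hA.symm ≫ C.trans L φ ψ ≫ eqToHom hB
  inv := eqToHom hB.symm ≫ C.trans L ψ φ ≫ eqToHom hA
  hom_inv_id := by subst hA hB; simp [trans_trans, trans_self]
  inv_hom_id := by subst hA hB; simp [trans_trans, trans_self]

theorem transIso_hom (L : List C.carrier) (φ ψ : Inj L.length) {A B : C.carrier}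
    (hA : C.tens L φ = A) (hB : C.tens L ψ = B) : (transIso L φ ψ hA hB).hom ≍ C.trans L φ ψ := by
  subst hA hB; simp [transIso]

/-- The isomorphism `[v, u] : u_*(X) ⟶ v_*(X)`, for `A = u_*(X)` and `B = v_*(X)`. -/
def trIso (X : C.carrier) (u v : ℕ ↪ ℕ) {A B : C.carrier} (hA : (C.em.act u).obj X = A)
    (hB : (C.em.act v).obj X = B) : A ≅ B where
  hom := eqToHom hA.symm ≫ (C.em.tr u v).app X ≫ eqToHom hB
  inv := eqToHom hB.symm ≫ (C.em.tr v u).app X ≫ eqToHom hA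
  hom_inv_id := by
    subst hA hB; simp [C.em.tr_app_trans, C.em.tr_app_self]
  inv_hom_id := by
    subst hA hB; simp [C.em.tr_app_trans, C.em.tr_app_self]

theorem trIso_hom (X : C.carrier) (u v : ℕ ↪ ℕ) {A B : C.carrier} (hA : (C.em.act u).obj X = A)
    (hB : (C.em.act v).obj X = B) : (trIso X u v hA hB).hom ≍ (C.em.tr u v).app X := by
  subst hA hB; simp [trIso]

/-- The tensor product `μ_*`, the unit `0`, the associativity isomorphism
`[μ ∘ (1 ⨿ μ), μ ∘ (μ ⨿ 1)]` and the unit isomorphisms `[1, μ(2, -)]` and `[1, μ(1, -)]`. -/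
instance (μ : Inj 2) : MonoidalCategoryStruct (MuStarCat μ C) where
  tensorObj X Y := C.tens [X, Y] μ
  tensorUnit := C.zero
  tensorHom f g := tensMap₂ (C := C) μ f g
  whiskerLeft X {_ _} g := tensMap₂ (C := C) μ (𝟙 X) g
  whiskerRight f Y := tensMap₂ (C := C) μ f (𝟙 Y)
  associator X Y Z := transIso (C := C) [X, Y, Z] μ.assocLeft μ.assocRight
    (tens_assocLeft μ X Y Z) (tens_assocRight μ X Y Z)
  leftUnitor X := trIso (C := C) X (μ.row 1) (Function.Embedding.refl ℕ)
    (tens_zero_left μ X).symm (C.em.act_one_obj X)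
  rightUnitor X := trIso (C := C) X (μ.row 0) (Function.Embedding.refl ℕ)
    (tens_zero_right μ X).symm (C.em.act_one_obj X)

namespace MuStarCat

variable (μ : Inj 2) (C)

/-- The functor underlying `ν̃`, given by `X ↦ (X)` and `f ↦ [1, f, 1]`. -/
def nuFunctor : MuStarCat μ C ⥤ C.SigmaCat where
  obj X := ([X] : List C.carrier)
  map f := SigmaHom.nu (C := C) f
  map_id X := by
    refine SigmaHom.ext_rep (X := [X]) (Y := [X]) Inj.one Inj.one (eq_of_heq ?_)
    refine (SigmaHom.rep_nu (C := C) _).trans (HEq.trans ?_ (heq_of_eq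
      ((SigmaHom.rep_id (X := [X]) Inj.one Inj.one).trans (trans_self _ _))).symm)
    exact id_heq (tens_one (C := C) X).symm
  map_comp {X Y Z} f g := by
    refine SigmaHom.ext_rep (X := [X]) (Y := [Z]) Inj.one Inj.one (eq_of_heq ?_)
    refine (SigmaHom.rep_nu (C := C) _).trans (HEq.trans ?_ (heq_of_eq
      (SigmaHom.rep_comp (SigmaHom.nu (C := C) f) (SigmaHom.nu g) Inj.one Inj.one Inj.one)).symm)
    exact comp_heq (tens_one (C := C) X).symm (tens_one (C := C) Y).symm
      (tens_one (C := C) Z).symm (SigmaHom.rep_nu f).symm (SigmaHom.rep_nu g).symm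

instance : (nuFunctor C μ).Faithful where
  map_injective {X Y} f g h := by
    have h : SigmaHom.nu (C := C) f = SigmaHom.nu (C := C) g := h
    have := SigmaHom.rep_nu (C := C) f
    rw [h] at this
    exact eq_of_heq (this.symm.trans (SigmaHom.rep_nu (C := C) g))

/-- The isomorphism `ι = [1, id, ∅] : ε ⟶ (0)`. -/
def iota : 𝟙_ C.SigmaCat ≅ (nuFunctor C μ).obj (𝟙_ (MuStarCat μ C)) :=
  SigmaHom.idIso [] [C.zero] Inj.nil Inj.one (tens_one C.zero).symm

/-- The isomorphism `∇ = [1, id, μ] : (X, Y) ⟶ (μ_*(X, Y))`. -/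
def nabla (X Y : MuStarCat μ C) :
    (nuFunctor C μ).obj X ⊗ (nuFunctor C μ).obj Y ≅ (nuFunctor C μ).obj (X ⊗ Y) :=
  SigmaHom.idIso (C := C) [X, Y] [C.tens [X, Y] μ] μ Inj.one (tens_one _).symm

variable {C}

theorem nabla_isId (X Y : C.carrier) :
    SigmaHom.IsId (X := [X, Y]) (Y := [C.tens [X, Y] μ]) (nabla C μ X Y).hom μ Inj.one :=
  SigmaHom.IsId.mk _

theorem iota_isId (φ : Inj 0) (u : ℕ ↪ ℕ) :
    SigmaHom.IsId (X := []) (Y := [C.zero]) (iota C μ).hom φ (Inj.one.trans u) := by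
  have h : φ = Inj.nil.trans u := by ext p; exact p.1.elim0
  rw [h]
  exact SigmaHom.IsId.trans (SigmaHom.IsId.mk _) u

theorem nu_tensor {X X' Y Y' : C.carrier} (f : X ⟶ X') (g : Y ⟶ Y') :
    SigmaHom.comp (X := [X, Y]) (Y := [C.tens [X, Y] μ]) (nabla C μ X Y).hom
      (SigmaHom.nu (tensMap₂ μ f g)) =
    SigmaHom.comp (SigmaHom.tensor (SigmaHom.nu f) (SigmaHom.nu g)) (nabla C μ X' Y').hom := by
  refine SigmaHom.ext_rep (X := [X, Y]) (Y := [C.tens [X', Y'] μ]) μ Inj.one (eq_of_heq ?_)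
  have key : (SigmaHom.tensor (SigmaHom.nu f) (SigmaHom.nu g)).rep μ μ ≍ tensMap₂ μ f g := by
    have h := SigmaHom.rep_tensor (SigmaHom.nu f) (SigmaHom.nu g) (Inj.one.trans (μ.row 0))
      (Inj.one.trans (μ.row 1)) (Inj.one.trans (μ.row 0)) (Inj.one.trans (μ.row 1))
      (Inj.disjoint_trans _ _ _ (by decide)) (Inj.disjoint_trans _ _ _ (by decide)) rfl rfl
    rw [Inj.join_at] at h
    refine h.trans (HEq.trans ?_ (tensMap₂_eq μ f g (disjoint_rows _ _ _)
      (disjoint_rows _ _ _)).symm)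
    exact addMap_heq (tens_trans_row _ _) (tens_trans_row _ _) (tens_trans_row _ _)
      (tens_trans_row _ _) (SigmaHom.rep_nu_trans _ _) (SigmaHom.rep_nu_trans _ _)
  exact (SigmaHom.IsId.rep_comp_left (nabla_isId μ X Y) _ _).trans ((SigmaHom.rep_nu _).trans
    (key.symm.trans (SigmaHom.IsId.rep_comp_right (nabla_isId μ X' Y') _ _).symm))

theorem nabla_unit_left (X : C.carrier) :
    SigmaHom.IsId (X := [X]) (Y := [C.tens [C.zero, X] μ])
      (((iota C μ).hom ▷ (nuFunctor C μ).obj X) ≫ (nabla C μ (𝟙_ (MuStarCat μ C)) X).hom)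
      (Inj.one.trans (μ.row 1)) Inj.one := by
  have h : SigmaHom.IsId (X := [X]) (Y := [C.zero, X])
      ((iota C μ).hom ▷ (nuFunctor C μ).obj X) (Inj.one.trans (μ.row 1)) μ := by
    have := (iota_isId (C := C) μ Inj.nil (μ.row 0)).tensor
      (SigmaHom.IsId.id (X := [X]) (Inj.one.trans (μ.row 1)))
      (by rw [Set.disjoint_left]; rintro _ ⟨p, _⟩; exact p.1.elim0)
      (Inj.disjoint_trans _ _ _ (by decide)) rfl rfl
    rw [Inj.join_at] at this
    rw [join_nil] at this
    exact this
  exact h.comp (nabla_isId μ C.zero X)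

theorem nabla_unit_right (X : C.carrier) :
    SigmaHom.IsId (X := [X]) (Y := [C.tens [X, C.zero] μ])
      (((nuFunctor C μ).obj X ◁ (iota C μ).hom) ≫ (nabla C μ X (𝟙_ (MuStarCat μ C))).hom)
      (Inj.one.trans (μ.row 0)) Inj.one := by
  have h : SigmaHom.IsId (X := [X]) (Y := [X, C.zero])
      ((nuFunctor C μ).obj X ◁ (iota C μ).hom) (Inj.one.trans (μ.row 0)) μ := by
    have := (SigmaHom.IsId.id (X := [X]) (Inj.one.trans (μ.row 0))).tensor
      (iota_isId (C := C) μ Inj.nil (μ.row 1))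
      (by rw [Set.disjoint_right]; rintro _ ⟨p, _⟩; exact p.1.elim0)
      (Inj.disjoint_trans _ _ _ (by decide)) rfl rfl
    rw [Inj.join_at] at this
    have h2 : Inj.join (Inj.one.trans (μ.row 0)) Inj.nil
        (by rw [Set.disjoint_right]; rintro _ ⟨p, _⟩; exact p.1.elim0) rfl =
        Inj.one.trans (μ.row 0) := by
      ext ⟨⟨i, hi⟩, x⟩
      exact Inj.join_apply_lt _ _ _ _ _ hi x
    rw [h2] at this
    exact this
  exact h.comp (nabla_isId μ X C.zero)

theorem nabla_assoc_left (X Y Z : C.carrier) :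
    SigmaHom.IsId (X := [X, Y, Z]) (Y := [C.tens [C.tens [X, Y] μ, Z] μ])
      (((nabla C μ X Y).hom ▷ (nuFunctor C μ).obj Z) ≫
        (nabla C μ (C.tens [X, Y] μ : C.carrier) Z).hom)
      μ.assocLeft Inj.one := by
  have h : SigmaHom.IsId (X := [X, Y, Z]) (Y := [C.tens [X, Y] μ, Z])
      ((nabla C μ X Y).hom ▷ (nuFunctor C μ).obj Z) μ.assocLeft μ := by
    have := ((nabla_isId (C := C) μ X Y).trans (μ.row 0)).tensor
      (SigmaHom.IsId.id (X := [Z]) (Inj.one.trans (μ.row 1)))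
      (Inj.disjoint_trans _ _ _ (by decide))
      (Inj.disjoint_trans _ _ _ (by decide)) rfl rfl
    rw [Inj.join_at] at this
    exact this
  exact h.comp (nabla_isId μ _ Z)

theorem nabla_assoc_right (X Y Z : C.carrier) :
    SigmaHom.IsId (X := [X, Y, Z]) (Y := [C.tens [X, C.tens [Y, Z] μ] μ])
      (((nuFunctor C μ).obj X ◁ (nabla C μ Y Z).hom) ≫
        (nabla C μ X (C.tens [Y, Z] μ : C.carrier)).hom)
      μ.assocRight Inj.one := by
  have h : SigmaHom.IsId (X := [X, Y, Z]) (Y := [X, C.tens [Y, Z] μ])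
      ((nuFunctor C μ).obj X ◁ (nabla C μ Y Z).hom) μ.assocRight μ := by
    have := (SigmaHom.IsId.id (X := [X]) (Inj.one.trans (μ.row 0))).tensor
      ((nabla_isId (C := C) μ Y Z).trans (μ.row 1))
      (Inj.disjoint_trans _ _ _ (by decide))
      (Inj.disjoint_trans _ _ _ (by decide)) rfl rfl
    rw [Inj.join_at] at this
    exact this
  exact h.comp (nabla_isId μ X _)

variable (C)

/-- The data exhibiting `ν̃` as compatible with the monoidal structures. -/
def inducing : Monoidal.InducingFunctorData (nuFunctor C μ) where
  μIso := nabla C μ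
  εIso := iota C μ
  tensorHom_eq {X₁ Y₁ X₂ Y₂} f g := by
    rw [Iso.eq_inv_comp]
    exact nu_tensor (C := C) μ f g
  whiskerLeft_eq X {Y₁ Y₂} g := by
    rw [Iso.eq_inv_comp, ← id_tensorHom, ← (nuFunctor C μ).map_id]
    exact nu_tensor (C := C) μ (𝟙 X) g
  whiskerRight_eq {X₁ X₂} f Y := by
    rw [Iso.eq_inv_comp, ← tensorHom_id, ← (nuFunctor C μ).map_id]
    exact nu_tensor (C := C) μ f (𝟙 Y)
  associator_eq X Y Z := by
    simp only [Iso.trans_hom, Iso.symm_hom, tensorIso_hom, Iso.refl_hom, tensorHom_id,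
      id_tensorHom, Category.assoc]
    rw [Iso.eq_inv_comp, ← cancel_epi ((nabla C μ X Y).hom ▷ (nuFunctor C μ).obj Z),
      hom_inv_whiskerRight_assoc, ← Category.assoc]
    have h : (α_ ((nuFunctor C μ).obj X) ((nuFunctor C μ).obj Y) ((nuFunctor C μ).obj Z)).hom =
      𝟙 _ := rfl
    refine (SigmaHom.IsId.comp_nu (C := C) (nabla_assoc_left μ X Y Z) (nabla_assoc_right μ X Y Z)
      (transIso_hom _ _ _ _ _)).trans ?_
    exact (Category.id_comp _).symm
  leftUnitor_eq X := by
    simp only [Iso.trans_hom, Iso.symm_hom, tensorIso_hom, Iso.refl_hom, tensorHom_id,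
      Category.assoc]
    rw [Iso.eq_inv_comp, ← cancel_epi ((iota C μ).hom ▷ (nuFunctor C μ).obj X),
      hom_inv_whiskerRight_assoc, ← Category.assoc]
    refine (SigmaHom.IsId.comp_nu (C := C) (nabla_unit_left μ X)
      (SigmaHom.IsId.id (X := [X]) Inj.one) ?_).trans ?_
    · exact (trIso_hom _ _ _ _ _).trans (trans_singleton (C := C) X (Inj.one.trans (μ.row 1)) Inj.one).symm
    · rfl
  rightUnitor_eq X := by
    simp only [Iso.trans_hom, Iso.symm_hom, tensorIso_hom, Iso.refl_hom, id_tensorHom,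
      Category.assoc]
    rw [Iso.eq_inv_comp, ← cancel_epi ((nuFunctor C μ).obj X ◁ (iota C μ).hom),
      whiskerLeft_hom_inv_assoc, ← Category.assoc]
    refine (SigmaHom.IsId.comp_nu (C := C) (nabla_unit_right μ X)
      (SigmaHom.IsId.id (X := [X]) Inj.one) ?_).trans ?_
    · exact (trIso_hom _ _ _ _ _).trans (trans_singleton (C := C) X (Inj.one.trans (μ.row 0)) Inj.one).symm
    · rfl

instance : MonoidalCategory (MuStarCat μ C) := Monoidal.induced (nuFunctor C μ) (inducing C μ)

instance : (nuFunctor C μ).Monoidal :=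
  (Monoidal.fromInducedCoreMonoidal (nuFunctor C μ) (inducing C μ)).toMonoidal

/-- The symmetry isomorphism `[μ ∘ (π × id), μ] : μ_*(X, Y) ⟶ μ_*(Y, X)`. -/
def braiding (X Y : MuStarCat μ C) : X ⊗ Y ≅ Y ⊗ X :=
  transIso (C := C) [X, Y] μ μ.flip rfl (tens_flip μ X Y)

theorem nabla_flip (X Y : C.carrier) :
    SigmaHom.IsId (X := [X, Y]) (Y := [C.tens [Y, X] μ])
      ((β_ ((nuFunctor C μ).obj X) ((nuFunctor C μ).obj Y)).hom ≫ (nabla C μ Y X).hom)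
      μ.flip Inj.one := by
  have h : SigmaHom.IsId (X := [X, Y]) (Y := [Y, X])
      (β_ ((nuFunctor C μ).obj X) ((nuFunctor C μ).obj Y)).hom μ.flip μ := by
    have := SigmaHom.IsId.swap (X := [X]) (Y := [Y]) (Inj.one.trans (μ.row 1))
      (Inj.one.trans (μ.row 0)) (Inj.disjoint_trans _ _ _ (by decide)) rfl rfl
    rw [Inj.join_at, Inj.join_flip] at this
    exact this
  exact h.comp (nabla_isId μ Y X)

instance : BraidedCategory (MuStarCat μ C) :=
  BraidedCategory.ofFaithful (nuFunctor C μ) (braiding C μ) (fun X Y =>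
    SigmaHom.IsId.comp_nu (C := C) (nabla_isId μ X Y) (nabla_flip C μ X Y)
      (transIso_hom _ _ _ _ _))

instance nuBraided : (nuFunctor C μ).Braided where
  braided X Y := (SigmaHom.IsId.comp_nu (C := C) (nabla_isId μ X Y) (nabla_flip C μ X Y)
      (transIso_hom _ _ _ _ _))

instance : SymmetricCategory (MuStarCat μ C) := SymmetricCategory.ofFaithful (nuFunctor C μ)

/-- The symmetric monoidal category `μ^*(C)`. -/
def toSymMonCat : SymMonCat.{v, u} where
  carrier := MuStarCat μ C

/-- The strong symmetric monoidal functor `ν̃ : μ^*(C) ⟶ Σ(C)`, with underlying functor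
`nuFunctor` and structure isomorphisms `ι` and `∇`. -/
def nuTilde : toSymMonCat C μ ⟶ PermCat.incl.obj (Sigma.obj C) where
  functor := nuFunctor C μ
  braided := nuBraided C μ

theorem nuTilde_ε : Functor.LaxMonoidal.ε (nuFunctor C μ) = (iota C μ).hom := rfl

theorem nuTilde_μ (X Y : MuStarCat μ C) :
    Functor.LaxMonoidal.μ (nuFunctor C μ) X Y = (nabla C μ X Y).hom := rfl

theorem associator_hom (X Y Z : MuStarCat μ C) : (α_ X Y Z).hom =
    (transIso (C := C) [X, Y, Z] μ.assocLeft μ.assocRight (tens_assocLeft μ X Y Z)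
      (tens_assocRight μ X Y Z)).hom := rfl

theorem braiding_hom (X Y : MuStarCat μ C) : (β_ X Y).hom =
    (transIso (C := C) [X, Y] μ μ.flip rfl (tens_flip μ X Y)).hom := rfl

variable {C}

/-- The functor `μ^*(F)`, with the same underlying functor as `F`. -/
def map (F : C ⟶ D) : MuStarCat μ C ⥤ MuStarCat μ D where
  obj X := F.functor.obj X
  map f := F.functor.map (X := (_ : C.carrier)) f
  map_id X := F.functor.map_id X
  map_comp f g := F.functor.map_comp (X := (_ : C.carrier)) f g

theorem map_transIso (F : C ⟶ D) (L : List C.carrier) (L' : List D.carrier)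
    (hL : L.map F.functor.obj = L') (φ ψ : Inj L.length) (φ' ψ' : Inj L'.length)
    (hφ : ∀ i (hi : i < L.length) (hi' : i < L'.length) x, φ (⟨i, hi⟩, x) = φ' (⟨i, hi'⟩, x))
    (hψ : ∀ i (hi : i < L.length) (hi' : i < L'.length) x, ψ (⟨i, hi⟩, x) = ψ' (⟨i, hi'⟩, x))
    {A B : C.carrier} (hA : C.tens L φ = A) (hB : C.tens L ψ = B)
    {A' B' : D.carrier} (hA' : D.tens L' φ' = A') (hB' : D.tens L' ψ' = B') :
    F.functor.map (transIso L φ ψ hA hB).hom ≍ (transIso L' φ' ψ' hA' hB').hom := by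
  subst hA hB hL
  refine (functor_map_heq F.functor rfl rfl (transIso_hom _ _ _ _ _)).trans (HEq.trans ?_
    (transIso_hom _ _ _ _ _).symm)
  refine (Hom.map_trans F L φ ψ (List.length_map _)).trans ?_
  exact trans_congr rfl (fun i hi hi' x => hφ i _ _ x) (fun i hi hi' x => hψ i _ _ x)

theorem map_trIso (F : C ⟶ D) (X : C.carrier) (u v : ℕ ↪ ℕ) {A B : C.carrier}
    (hA : (C.em.act u).obj X = A) (hB : (C.em.act v).obj X = B) {A' B' : D.carrier}
    (hA' : (D.em.act u).obj (F.functor.obj X) = A')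
    (hB' : (D.em.act v).obj (F.functor.obj X) = B') :
    F.functor.map (trIso X u v hA hB).hom ≍ (trIso (F.functor.obj X) u v hA' hB').hom := by
  subst hA hB hA' hB'
  refine (functor_map_heq F.functor rfl rfl (trIso_hom _ _ _ _ _)).trans (HEq.trans ?_
    (trIso_hom _ _ _ _ _).symm)
  exact F.tr_comm u v X

theorem map_tens_pair (F : C ⟶ D) (X Y : C.carrier) :
    F.functor.obj (C.tens [X, Y] μ) = D.tens [F.functor.obj X, F.functor.obj Y] μ :=
  Hom.map_tens F [X, Y] μ rfl

theorem map_strict (F : C ⟶ D) : IsStrictSymm (map μ F) where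
  obj_unit := F.map_zero
  obj_tensor X Y := map_tens_pair μ F X Y
  map_tensor {X X' Y Y'} f g := by
    have h1 := fun X Y : C.carrier => F.disjoint (disjoint_rows μ X Y)
    refine (functor_map_heq F.functor (tens_pair μ X Y _) (tens_pair μ X' Y' _)
      (tensMap₂_eq (C := C) μ f g (disjoint_rows μ _ _) (disjoint_rows μ _ _))).trans ?_
    refine (F.map_addMap _ _ _ _ (h1 _ _) (h1 _ _)).trans ?_
    refine HEq.trans ?_ (tensMap₂_eq (C := D) μ _ _ (disjoint_rows μ _ _)
      (disjoint_rows μ _ _)).symm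
    exact addMap_heq (F.act_comm_obj _ _) (F.act_comm_obj _ _) (F.act_comm_obj _ _)
      (F.act_comm_obj _ _) (F.act_comm_map _ _) (F.act_comm_map _ _)
  map_associator X Y Z := map_transIso (C := C) (D := D) F [X, Y, Z]
    [F.functor.obj X, F.functor.obj Y, F.functor.obj Z] rfl _ _ _ _ (fun _ _ _ _ => rfl)
    (fun _ _ _ _ => rfl) _ _ _ _
  map_leftUnitor X := map_trIso (C := C) (D := D) F X _ _ _ _ _ _
  map_rightUnitor X := map_trIso (C := C) (D := D) F X _ _ _ _ _ _
  map_braiding X Y := map_transIso (C := C) (D := D) F [X, Y]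
    [F.functor.obj X, F.functor.obj Y] rfl _ _ _ _ (fun _ _ _ _ => rfl)
    (fun _ _ _ _ => rfl) _ _ _ _

end MuStarCat

/-- The functor `μ^*` from parsummable categories to symmetric monoidal categories. -/
def muStar (μ : Inj 2) : ParSumCat.{v, u} ⥤ SymMonCat.{v, u} where
  obj C := MuStarCat.toSymMonCat C μ
  map F := SymMonCat.Hom.ofStrict (MuStarCat.map μ F) (MuStarCat.map_strict μ F)
  map_id C := SymMonCat.Hom.ofStrict_id (MuStarCat.toSymMonCat C μ)
  map_comp {C D E} F G := SymMonCat.Hom.ofStrict_comp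
    (C := MuStarCat.toSymMonCat C μ) (D := MuStarCat.toSymMonCat D μ)
    (E := MuStarCat.toSymMonCat E μ)
    (MuStarCat.map μ F) (MuStarCat.map_strict μ F) (MuStarCat.map μ G) (MuStarCat.map_strict μ G)

end ParSumCat

/-! ## Coherence isomorphisms between permuted tensor products -/

section Sorting

variable {K : Type u₁}

/-- Insertion into a list, with respect to the order of the names. -/
def ins (p : ℕ × K) : List (ℕ × K) → List (ℕ × K)
  | [] => [p]
  | q :: L => if p.1 ≤ q.1 then p :: q :: L else q :: ins p L

/-- Insertion sort. -/
def isort : List (ℕ × K) → List (ℕ × K)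
  | [] => []
  | p :: L => ins p (isort L)

theorem ins_of_le {p q : ℕ × K} (h : p.1 ≤ q.1) (L : List (ℕ × K)) :
    ins p (q :: L) = p :: q :: L := if_pos h

theorem ins_of_not_le {p q : ℕ × K} (h : ¬ p.1 ≤ q.1) (L : List (ℕ × K)) :
    ins p (q :: L) = q :: ins p L := if_neg h

theorem ins_comm {p q : ℕ × K} (h : p.1 ≠ q.1) (L : List (ℕ × K)) :
    ins p (ins q L) = ins q (ins p L) := by
  induction L with
  | nil =>
    rcases lt_or_gt_of_ne h with h | h
    · simp [ins, h.le, h]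
    · simp [ins, h.le, h]
  | cons r L ih =>
    by_cases hp : p.1 ≤ r.1 <;> by_cases hq : q.1 ≤ r.1 <;>
      rcases lt_or_gt_of_ne h with h | h <;>
      simp [ins, hp, hq, h.le, h, ih] <;> omega

theorem ins_of_head {p : ℕ × K} {L : List (ℕ × K)} (h : ∀ r ∈ L.head?, p.1 ≤ r.1) :
    ins p L = p :: L := by
  cases L with
  | nil => rfl
  | cons r L => exact ins_of_le (h r rfl) L

theorem head_ins {p q : ℕ × K} (hpq : p.1 ≤ q.1) {L : List (ℕ × K)}
    (h : ∀ r ∈ L.head?, p.1 ≤ r.1) : ∀ r ∈ (ins q L).head?, p.1 ≤ r.1 := by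
  cases L with
  | nil => simpa [ins] using hpq
  | cons s L =>
    by_cases hs : q.1 ≤ s.1
    · rw [ins_of_le hs]; simpa using hpq
    · rw [ins_of_not_le hs]; simpa using h

end Sorting

section Coherence

variable {K : Type u₁} [Category.{v₁} K] [MonoidalCategory K]

/-- The tensor product of a finite list of objects, in which each object carries a name in `ω`. -/
def tensN : List (ℕ × K) → K
  | [] => 𝟙_ K
  | p :: L => p.2 ⊗ tensN L

theorem whiskerLeft_heq (A : K) {X X' Y Y' : K} {f : X ⟶ Y} {f' : X' ⟶ Y'} (hX : X = X')
    (hY : Y = Y') (h : f ≍ f') : A ◁ f ≍ A ◁ f' := by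
  subst hX hY; cases h; rfl

variable [SymmetricCategory K]

/-- The isomorphism `A ⊗ B ⊗ Z ⟶ B ⊗ A ⊗ Z` given by the symmetry isomorphism of `A` and `B`. -/
def sw (A B Z : K) : A ⊗ B ⊗ Z ⟶ B ⊗ A ⊗ Z :=
  (α_ A B Z).inv ≫ ((β_ A B).hom ▷ Z) ≫ (α_ B A Z).hom

theorem sw_naturality (A B : K) {Z Z' : K} (f : Z ⟶ Z') :
    (A ◁ B ◁ f) ≫ sw A B Z' = sw A B Z ≫ (B ◁ A ◁ f) := by
  simp only [sw, Category.assoc]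
  rw [associator_inv_naturality_right_assoc, ← associator_naturality_right,
    whisker_exchange_assoc]

theorem sw_sw (A B Z : K) : sw A B Z ≫ sw B A Z = 𝟙 _ := by
  simp [sw, ← comp_whiskerRight_assoc]

theorem sw_sw_sw (A B D Z : K) :
    (A ◁ sw B D Z) ≫ sw A D (B ⊗ Z) ≫ (D ◁ sw A B Z) =
      sw A B (D ⊗ Z) ≫ (B ◁ sw A D Z) ≫ sw B D (A ⊗ Z) := by
  have key := BraidedCategory.yang_baxter' A B D
  calc
    _ = 𝟙 (A ⊗ B ⊗ D ⊗ Z) ⊗≫ ((𝟙 ((A ⊗ B) ⊗ D) ⊗≫ (A ◁ (β_ B D).hom ⊗≫ (β_ A D).hom ▷ B ⊗≫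
        D ◁ (β_ A B).hom) ⊗≫ 𝟙 ((D ⊗ B) ⊗ A)) ▷ Z) ⊗≫ 𝟙 (D ⊗ B ⊗ A ⊗ Z) := by
      simp only [sw]; monoidal
    _ = 𝟙 (A ⊗ B ⊗ D ⊗ Z) ⊗≫ (((β_ A B).hom ▷ D ⊗≫ B ◁ (β_ A D).hom ⊗≫ (β_ B D).hom ▷ A) ▷ Z) ⊗≫
        𝟙 (D ⊗ B ⊗ A ⊗ Z) := by rw [← key]
    _ = _ := by simp only [sw]; monoidal

/-- The isomorphisms between tensor products of permuted lists that are composites of isomorphisms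
exchanging two adjacent entries. -/
inductive Coh : (L L' : List (ℕ × K)) → (tensN L ⟶ tensN L') → Prop
  | id (L : List (ℕ × K)) : Coh L L (𝟙 (tensN L))
  | comp {L L' L'' : List (ℕ × K)} {f : tensN L ⟶ tensN L'} {g : tensN L' ⟶ tensN L''} :
    Coh L L' f → Coh L' L'' g → Coh L L'' (f ≫ g)
  | cons (p : ℕ × K) {L L' : List (ℕ × K)} {f : tensN L ⟶ tensN L'} :
    Coh L L' f → Coh (p :: L) (p :: L') (p.2 ◁ f)
  | swap (p q : ℕ × K) (L : List (ℕ × K)) :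
    Coh (p :: q :: L) (q :: p :: L) (sw p.2 q.2 (tensN L))

theorem Coh.perm {L L' : List (ℕ × K)} {f : tensN L ⟶ tensN L'} (h : Coh L L' f) :
    L.Perm L' := by
  induction h with
  | id L => exact .refl _
  | comp _ _ h1 h2 => exact h1.trans h2
  | cons p _ h => exact h.cons p
  | swap p q L => exact .swap q p L

theorem Coh.exists_of_perm {L L' : List (ℕ × K)} (h : L.Perm L') : ∃ f, Coh L L' f := by
  induction h with
  | nil => exact ⟨_, .id _⟩
  | cons p _ h => obtain ⟨f, hf⟩ := h; exact ⟨_, .cons p hf⟩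
  | swap p q L => exact ⟨_, .swap q p L⟩
  | trans _ _ h1 h2 => obtain ⟨f, hf⟩ := h1; obtain ⟨g, hg⟩ := h2; exact ⟨_, .comp hf hg⟩

/-- The isomorphism corresponding to an insertion into a list. -/
def insHom (p : ℕ × K) : (L : List (ℕ × K)) → (p.2 ⊗ tensN L ⟶ tensN (ins p L))
  | [] => 𝟙 _
  | q :: L => if h : p.1 ≤ q.1 then eqToHom (by rw [ins_of_le h]; rfl) else
      sw p.2 q.2 (tensN L) ≫ (q.2 ◁ insHom p L) ≫ eqToHom (by rw [ins_of_not_le h]; rfl)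

theorem insHom_of_le {p q : ℕ × K} (h : p.1 ≤ q.1) (L : List (ℕ × K)) :
    insHom p (q :: L) = eqToHom (by rw [ins_of_le h]; rfl) := dif_pos h

theorem insHom_of_not_le {p q : ℕ × K} (h : ¬ p.1 ≤ q.1) (L : List (ℕ × K)) :
    insHom p (q :: L) ≍ sw p.2 q.2 (tensN L) ≫ (q.2 ◁ insHom p L) := by
  have h1 : insHom p (q :: L) = sw p.2 q.2 (tensN L) ≫ (q.2 ◁ insHom p L) ≫
      eqToHom (by rw [ins_of_not_le h]; rfl) := dif_neg h
  exact (heq_of_eq (h1.trans (Category.assoc _ _ _).symm)).trans (comp_eqToHom_heq _ _)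

theorem insHom_of_head {p : ℕ × K} {L : List (ℕ × K)} (h : ∀ r ∈ L.head?, p.1 ≤ r.1) :
    insHom p L ≍ 𝟙 (p.2 ⊗ tensN L) := by
  cases L with
  | nil => rfl
  | cons r L =>
    exact (heq_of_eq (insHom_of_le (h r rfl) L)).trans (eqToHom_heq_id_dom _ _ _)

theorem insHom_congr (p : ℕ × K) {L L' : List (ℕ × K)} (h : L = L') :
    insHom p L ≍ insHom p L' := by
  subst h; rfl

/-- The isomorphism corresponding to insertion sort. -/
def sortHom : (L : List (ℕ × K)) → (tensN L ⟶ tensN (isort L))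
  | [] => 𝟙 _
  | p :: L => (p.2 ◁ sortHom L) ≫ insHom p (isort L)

instance isIso_sw (A B Z : K) : IsIso (sw A B Z) := ⟨_, sw_sw A B Z, sw_sw B A Z⟩

theorem isIso_insHom (p : ℕ × K) (L : List (ℕ × K)) : IsIso (insHom p L) := by
  induction L with
  | nil => exact inferInstanceAs (IsIso (𝟙 _))
  | cons q L ih =>
    rw [insHom]
    split_ifs
    · infer_instance
    · exact inferInstanceAs (IsIso (sw p.2 q.2 (tensN L) ≫ (q.2 ◁ insHom p L) ≫ eqToHom _))

theorem isIso_sortHom (L : List (ℕ × K)) : IsIso (sortHom L) := by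
  induction L with
  | nil => exact inferInstanceAs (IsIso (𝟙 _))
  | cons q L ih =>
    have := isIso_insHom q (isort L)
    exact inferInstanceAs (IsIso ((q.2 ◁ sortHom L) ≫ insHom q (isort L)))

theorem insHom_comm_aux₁ {A B Z W : K} (f : B ⊗ Z ⟶ W) :
    (A ◁ f) ≫ 𝟙 _ = sw A B Z ≫ 𝟙 _ ≫ sw B A Z ≫ (A ◁ f) := by
  rw [Category.id_comp, ← Category.assoc, sw_sw, Category.comp_id, Category.id_comp]

theorem insHom_comm_aux₂ {A B D Z W V W' V' : K} (g : B ⊗ Z ⟶ W) (h : A ⊗ W ⟶ V)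
    (g' : A ⊗ Z ⟶ W') (h' : B ⊗ W' ⟶ V') (hV : V = V')
    (e : (A ◁ g) ≫ h ≍ sw A B Z ≫ (B ◁ g') ≫ h') :
    (A ◁ (sw B D Z ≫ (D ◁ g))) ≫ sw A D W ≫ (D ◁ h) ≍
      sw A B (D ⊗ Z) ≫ (B ◁ (sw A D Z ≫ (D ◁ g'))) ≫ sw B D W' ≫ (D ◁ h') := by
  subst hV
  apply heq_of_eq
  have e1 : D ◁ (A ◁ g) ≫ D ◁ h = D ◁ sw A B Z ≫ D ◁ (B ◁ g') ≫ D ◁ h' := by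
    simp only [← MonoidalCategory.whiskerLeft_comp, eq_of_heq e]
  have e2 := sw_naturality A D g
  have e3 := sw_naturality B D g'
  have e4 := sw_sw_sw A B D Z
  simp only [MonoidalCategory.whiskerLeft_comp, Category.assoc]
  rw [reassoc_of% e2, reassoc_of% e3, e1, reassoc_of% e4]

theorem insHom_comm_head {p q : ℕ × K} (h : p.1 < q.1) (L : List (ℕ × K))
    (hL : ∀ r ∈ L.head?, p.1 ≤ r.1) :
    (p.2 ◁ insHom q L) ≫ insHom p (ins q L) ≍
      sw p.2 q.2 (tensN L) ≫ (q.2 ◁ insHom p L) ≫ insHom q (ins p L) := by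
  have e1 := ins_of_head hL
  have e2 := ins_of_head (head_ins h.le hL)
  have e3 : ins q (p :: L) = p :: ins q L := ins_of_not_le (not_le.mpr h) L
  have h1 : insHom q (ins p L) ≍ sw q.2 p.2 (tensN L) ≫ (p.2 ◁ insHom q L) :=
    (insHom_congr q e1).trans (insHom_of_not_le (not_le.mpr h) L)
  refine (comp_heq rfl rfl (by rw [e2]; rfl)
    HEq.rfl (insHom_of_head (head_ins h.le hL))).trans ?_
  refine (heq_of_eq (insHom_comm_aux₁ _)).trans ?_
  refine comp_heq rfl rfl (by rw [ins_comm h.ne', e2]; rfl) HEq.rfl ?_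
  refine comp_heq rfl (by rw [e1]; rfl) (by rw [e1, e3]; rfl) ?_ h1.symm
  exact (heq_of_eq (MonoidalCategory.whiskerLeft_id _ _).symm).trans
    (whiskerLeft_heq q.2 rfl (by rw [e1]; rfl) (insHom_of_head hL).symm)

theorem insHom_comm_lt {p q : ℕ × K} (h : p.1 < q.1) (L : List (ℕ × K)) :
    (p.2 ◁ insHom q L) ≫ insHom p (ins q L) ≍
      sw p.2 q.2 (tensN L) ≫ (q.2 ◁ insHom p L) ≫ insHom q (ins p L) := by
  induction L with
  | nil => exact insHom_comm_head h [] (by simp)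
  | cons r L ih =>
    by_cases hr : p.1 ≤ r.1
    · exact insHom_comm_head h (r :: L) (by simpa using hr)
    have hr' : ¬ q.1 ≤ r.1 := by omega
    have e1 := ins_of_not_le hr L
    have e2 := ins_of_not_le hr' L
    have e3 := ins_of_not_le hr (ins q L)
    have e4 := ins_of_not_le hr' (ins p L)
    refine (comp_heq rfl (by rw [e2]; rfl) (by rw [e2, e3]; rfl)
      (whiskerLeft_heq p.2 rfl (by rw [e2]; rfl) (insHom_of_not_le hr' L))
      ((insHom_congr p e2).trans (insHom_of_not_le hr _))).trans ?_
    refine (insHom_comm_aux₂ (insHom q L) (insHom p (ins q L)) (insHom p L) (insHom q (ins p L))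
      (by rw [ins_comm h.ne]) ih).trans ?_
    refine comp_heq rfl rfl (by rw [e1, e4]; rfl) HEq.rfl ?_
    exact comp_heq rfl (by rw [e1]; rfl) (by rw [e1, e4]; rfl)
      (whiskerLeft_heq q.2 rfl (by rw [e1]; rfl) (insHom_of_not_le hr L).symm)
      ((insHom_congr q e1).trans (insHom_of_not_le hr' _)).symm

theorem insHom_comm {p q : ℕ × K} (h : p.1 ≠ q.1) (L : List (ℕ × K)) :
    (p.2 ◁ insHom q L) ≫ insHom p (ins q L) ≍
      sw p.2 q.2 (tensN L) ≫ (q.2 ◁ insHom p L) ≫ insHom q (ins p L) := by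
  rcases lt_or_gt_of_ne h with h | h
  · exact insHom_comm_lt h L
  · have := insHom_comm_lt h L
    refine HEq.trans ?_ (comp_heq rfl rfl (by rw [ins_comm h.ne']) (HEq.refl (sw p.2 q.2 (tensN L)))
      this.symm)
    rw [← Category.assoc, sw_sw, Category.id_comp]

theorem Coh.sort {L L' : List (ℕ × K)} {f : tensN L ⟶ tensN L'} (h : Coh L L' f)
    (hL : (L.map Prod.fst).Nodup) : isort L = isort L' ∧ sortHom L ≍ f ≫ sortHom L' := by
  induction h with
  | id L => exact ⟨rfl, by rw [Category.id_comp]⟩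
  | @comp L L' L'' f g hf hg h1 h2 =>
    obtain ⟨h3, h4⟩ := h1 hL
    obtain ⟨h5, h6⟩ := h2 ((hf.perm.map Prod.fst).nodup hL)
    refine ⟨h3.trans h5, h4.trans ?_⟩
    rw [Category.assoc]
    exact comp_heq rfl rfl (by rw [h5]) HEq.rfl h6
  | @cons p L L' f hf h =>
    obtain ⟨h1, h2⟩ := h (List.nodup_cons.mp hL).2
    refine ⟨congrArg (ins p) h1, ?_⟩
    refine (comp_heq rfl (by rw [h1]) (by rw [h1]) (whiskerLeft_heq p.2 rfl (by rw [h1]) h2)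
      (insHom_congr p h1)).trans ?_
    refine heq_of_eq ?_
    rw [MonoidalCategory.whiskerLeft_comp, Category.assoc]
    rfl
  | swap p q L =>
    have hpq : p.1 ≠ q.1 := by
      intro h; simp [h] at hL
    refine ⟨ins_comm hpq _, ?_⟩
    have h1 : sortHom (p :: q :: L) = (p.2 ◁ q.2 ◁ sortHom L) ≫ (p.2 ◁ insHom q (isort L)) ≫
        insHom p (ins q (isort L)) := by
      rw [← Category.assoc, ← MonoidalCategory.whiskerLeft_comp]; rfl
    have h2 : sortHom (q :: p :: L) = (q.2 ◁ p.2 ◁ sortHom L) ≫ (q.2 ◁ insHom p (isort L)) ≫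
        insHom q (ins p (isort L)) := by
      rw [← Category.assoc, ← MonoidalCategory.whiskerLeft_comp]; rfl
    have h3 : sw p.2 q.2 (tensN L) ≫ sortHom (q :: p :: L) = (p.2 ◁ q.2 ◁ sortHom L) ≫
        sw p.2 q.2 (tensN (isort L)) ≫ (q.2 ◁ insHom p (isort L)) ≫ insHom q (ins p (isort L)) := by
      rw [← Category.assoc, sw_naturality, Category.assoc]
      exact congrArg (sw p.2 q.2 (tensN L) ≫ ·) h2
    refine (heq_of_eq h1).trans (HEq.trans ?_ (heq_of_eq h3).symm)
    exact comp_heq rfl rfl (by rw [ins_comm hpq]) HEq.rfl (insHom_comm hpq (isort L))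

/-- There is at most one coherence isomorphism between two given lists, provided that the names
are pairwise distinct. -/
theorem Coh.unique {L L' : List (ℕ × K)} {f g : tensN L ⟶ tensN L'} (hf : Coh L L' f)
    (hg : Coh L L' g) (hL : (L.map Prod.fst).Nodup) : f = g := by
  have := isIso_sortHom L'
  rw [← cancel_mono (sortHom L')]
  exact eq_of_heq ((hf.sort hL).2.symm.trans (hg.sort hL).2)

end Coherence

theorem heq_of_square {K : Type u₁} [Category.{v₁} K] {X X' Y Y' : K} {f : X ⟶ Y} {g : X' ⟶ Y'}
    (hX : X = X') (hY : Y = Y') (h : f ≫ eqToHom hY = eqToHom hX ≫ g) : f ≍ g := by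
  subst hX hY; simpa using h

theorem whiskerRight_heq {K : Type u₁} [Category.{v₁} K] [MonoidalCategory K] (A : K)
    {X X' Y Y' : K} {f : X ⟶ Y} {f' : X' ⟶ Y'} (hX : X = X') (hY : Y = Y') (h : f ≍ f') :
    f ▷ A ≍ f' ▷ A := by
  subst hX hY; cases h; rfl

theorem sw_congr {K : Type u₁} [Category.{v₁} K] [MonoidalCategory K] [SymmetricCategory K]
    {A A' B B' Z Z' : K} (hA : A = A') (hB : B = B') (hZ : Z = Z') : sw A B Z ≍ sw A' B' Z' := by
  subst hA hB hZ; rfl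

theorem tensN_names {K : Type u₁} [Category.{v₁} K] [MonoidalCategory K] (u : ℕ → ℕ)
    (L : List (ℕ × K)) : tensN (L.map (fun p => (u p.1, p.2))) = tensN L := by
  induction L with
  | nil => rfl
  | cons p L ih => exact congrArg (p.2 ⊗ ·) ih

namespace Permutative

variable {K : Type u₁} [Category.{v₁} K] [MonoidalCategory K] [SymmetricCategory K] [Permutative K]

theorem unit_whiskerLeft_heq {X Y : K} (f : X ⟶ Y) : 𝟙_ K ◁ f ≍ f := by
  refine heq_of_square (unit_tensor X) (unit_tensor Y) ?_
  rw [← leftUnitor_eq, ← leftUnitor_eq]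
  exact leftUnitor_naturality f

theorem whiskerRight_unit_heq {X Y : K} (f : X ⟶ Y) : f ▷ 𝟙_ K ≍ f := by
  refine heq_of_square (tensor_unit X) (tensor_unit Y) ?_
  rw [← rightUnitor_eq, ← rightUnitor_eq]
  exact rightUnitor_naturality f

theorem tensor_tensor_heq {X X' Y Y' Z Z' : K} (f : X ⟶ X') (g : Y ⟶ Y') (h : Z ⟶ Z') :
    ((f ⊗ₘ g) ⊗ₘ h) ≍ (f ⊗ₘ g ⊗ₘ h) := by
  refine heq_of_square (tensor_assoc X Y Z) (tensor_assoc X' Y' Z') ?_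
  rw [← associator_eq, ← associator_eq]
  exact associator_naturality f g h

theorem tensor_whiskerLeft_heq (A B : K) {X Y : K} (f : X ⟶ Y) : (A ⊗ B) ◁ f ≍ A ◁ B ◁ f := by
  have := tensor_tensor_heq (𝟙 A) (𝟙 B) f
  rwa [id_tensorHom_id, id_tensorHom, id_tensorHom, id_tensorHom] at this

theorem whisker_assoc_heq (A B : K) {X Y : K} (f : X ⟶ Y) : (A ◁ f) ▷ B ≍ A ◁ (f ▷ B) := by
  have := tensor_tensor_heq (𝟙 A) f (𝟙 B)
  rwa [id_tensorHom, id_tensorHom, tensorHom_id, tensorHom_id] at this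

theorem whiskerRight_tensor_heq (A B : K) {X Y : K} (f : X ⟶ Y) : (f ▷ A) ▷ B ≍ f ▷ (A ⊗ B) := by
  have := tensor_tensor_heq f (𝟙 A) (𝟙 B)
  rwa [id_tensorHom_id, tensorHom_id, tensorHom_id, tensorHom_id] at this

theorem associator_inv_eq (A B Z : K) : (α_ A B Z).inv = eqToHom (tensor_assoc A B Z).symm := by
  rw [← cancel_epi (α_ A B Z).hom, Iso.hom_inv_id, associator_eq, eqToHom_trans, eqToHom_refl]

theorem sw_heq (A B Z : K) : sw A B Z ≍ (β_ A B).hom ▷ Z := by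
  refine heq_of_square (tensor_assoc A B Z).symm (tensor_assoc B A Z).symm ?_
  rw [← associator_inv_eq, ← associator_inv_eq, sw, Category.assoc, Category.assoc, Iso.hom_inv_id, Category.comp_id]

theorem braiding_unit_left (A : K) : (β_ (𝟙_ K) A).hom ≍ 𝟙 A := by
  refine heq_of_square (unit_tensor A) (tensor_unit A) ?_
  rw [← leftUnitor_eq, ← rightUnitor_eq, braiding_rightUnitor, Category.comp_id]

theorem braiding_unit_right (A : K) : (β_ A (𝟙_ K)).hom ≍ 𝟙 A := by
  refine heq_of_square (tensor_unit A) (unit_tensor A) ?_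
  rw [← leftUnitor_eq, ← rightUnitor_eq, braiding_leftUnitor, Category.comp_id]

theorem braiding_tensor_right_heq (A B Z : K) :
    (β_ A (B ⊗ Z)).hom ≍ sw A B Z ≫ (B ◁ (β_ A Z).hom) := by
  have h := BraidedCategory.hexagon_forward A B Z
  have h' : (β_ A (B ⊗ Z)).hom ≫ (α_ B Z A).hom = sw A B Z ≫ (B ◁ (β_ A Z).hom) := by
    rw [sw, Category.assoc, Category.assoc, ← h, Iso.inv_hom_id_assoc]
  rw [← h', associator_eq]
  exact (comp_eqToHom_heq _ _).symm

theorem braiding_tensor_left_heq (A W Z : K) :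
    (β_ (A ⊗ W) Z).hom ≍ (A ◁ (β_ W Z).hom) ≫ eqToHom (tensor_assoc A Z W).symm ≫
      ((β_ A Z).hom ▷ W) := by
  have h := BraidedCategory.hexagon_reverse A W Z
  refine heq_of_square (tensor_assoc A W Z) (tensor_assoc Z A W).symm ?_
  rw [← associator_inv_eq, ← associator_inv_eq, ← associator_eq, ← h, Iso.hom_inv_id_assoc]

theorem sw_whiskerRight_heq (A B Z W : K) : sw A B Z ▷ W ≍ sw A B (Z ⊗ W) :=
  (whiskerRight_heq W (tensor_assoc _ _ _).symm (tensor_assoc _ _ _).symm (sw_heq A B Z)).trans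
    ((whiskerRight_tensor_heq _ _ _).trans (sw_heq _ _ _).symm)

theorem sw_unit_left {A : K} (h : A = 𝟙_ K) (B Z : K) : sw A B Z ≍ 𝟙 (B ⊗ Z) := by
  subst h
  refine (sw_heq _ _ _).trans ((whiskerRight_heq Z (unit_tensor _) (tensor_unit _)
    (braiding_unit_left B)).trans ?_)
  rw [id_whiskerRight]

theorem sw_unit_right {B : K} (h : B = 𝟙_ K) (A Z : K) : sw A B Z ≍ 𝟙 (A ⊗ Z) := by
  subst h
  refine (sw_heq _ _ _).trans ((whiskerRight_heq Z (tensor_unit _) (unit_tensor _)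
    (braiding_unit_right A)).trans ?_)
  rw [id_whiskerRight]

variable {K' : Type u₂} [Category.{v₂} K'] [MonoidalCategory K'] [SymmetricCategory K']
  [Permutative K'] {F : K ⥤ K'}

theorem _root_.ParSum.IsStrictSymm.map_whiskerLeft (hF : IsStrictSymm F) (A : K) {X Y : K}
    (f : X ⟶ Y) : F.map (A ◁ f) ≍ F.obj A ◁ F.map f := by
  have := hF.map_tensor (𝟙 A) f
  rwa [F.map_id, id_tensorHom, id_tensorHom] at this

theorem _root_.ParSum.IsStrictSymm.map_whiskerRight (hF : IsStrictSymm F) (A : K) {X Y : K}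
    (f : X ⟶ Y) : F.map (f ▷ A) ≍ F.map f ▷ F.obj A := by
  have := hF.map_tensor f (𝟙 A)
  rwa [F.map_id, tensorHom_id, tensorHom_id] at this

theorem _root_.ParSum.IsStrictSymm.map_sw (hF : IsStrictSymm F) (A B Z : K) :
    F.map (sw A B Z) ≍ sw (F.obj A) (F.obj B) (F.obj Z) := by
  refine (functor_map_heq F (tensor_assoc _ _ _).symm (tensor_assoc _ _ _).symm
    (sw_heq A B Z)).trans ((hF.map_whiskerRight _ _).trans ?_)
  exact (whiskerRight_heq _ (hF.obj_tensor _ _) (hF.obj_tensor _ _) (hF.map_braiding _ _)).trans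
    (sw_heq _ _ _).symm

end Permutative

section IsCoh

open Permutative

variable {K : Type u₁} [Category.{v₁} K] [MonoidalCategory K] [SymmetricCategory K]
  {K' : Type u₂} [Category.{v₂} K'] [MonoidalCategory K'] [SymmetricCategory K']

/-- `f : A ⟶ B` is a coherence isomorphism from the tensor product of `L` to that of `L'`. -/
def IsCoh (L L' : List (ℕ × K)) {A B : K} (f : A ⟶ B) : Prop :=
  ∃ g : tensN L ⟶ tensN L', tensN L = A ∧ tensN L' = B ∧ Coh L L' g ∧ g ≍ f

namespace IsCoh

variable {L L' L'' M M' : List (ℕ × K)} {A B D A' B' : K}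

theorem of_coh {g : tensN L ⟶ tensN L'} (h : Coh L L' g) : IsCoh L L' g :=
  ⟨g, rfl, rfl, h, HEq.rfl⟩

theorem congr {f : A ⟶ B} {f' : A' ⟶ B'} (h : IsCoh L L' f) (hA : A = A') (hB : B = B')
    (hf : f ≍ f') : IsCoh L L' f' := by
  subst hA hB; cases hf; exact h

theorem id (h : tensN L = A) : IsCoh L L (𝟙 A) := by
  subst h; exact of_coh (.id L)

theorem eqToHom (h : tensN L = A) (e : A = B) : IsCoh L L (eqToHom e) := by
  subst h e; exact of_coh (.id L)

theorem comp {f : A ⟶ B} {g : B ⟶ D} (hf : IsCoh L L' f) (hg : IsCoh L' L'' g) :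
    IsCoh L L'' (f ≫ g) := by
  obtain ⟨f, rfl, rfl, hf, h⟩ := hf
  obtain ⟨g, _, rfl, hg, h'⟩ := hg
  cases h; cases h'
  exact of_coh (hf.comp hg)

theorem cons (p : ℕ × K) {f : A ⟶ B} (hf : IsCoh L L' f) :
    IsCoh (p :: L) (p :: L') (p.2 ◁ f) := by
  obtain ⟨f, rfl, rfl, hf, h⟩ := hf
  cases h
  exact of_coh (hf.cons p)

theorem swap (p q : ℕ × K) (h : tensN L = A) : IsCoh (p :: q :: L) (q :: p :: L) (sw p.2 q.2 A) := by
  subst h; exact of_coh (.swap p q L)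

theorem unique {f : A ⟶ B} {g : A' ⟶ B'} (hf : IsCoh L L' f) (hg : IsCoh L L' g)
    (hL : (L.map Prod.fst).Nodup) : f ≍ g := by
  obtain ⟨f, rfl, rfl, hf, h⟩ := hf
  obtain ⟨g, rfl, rfl, hg, h'⟩ := hg
  cases h; cases h'
  exact heq_of_eq (hf.unique hg hL)

theorem exists_of_perm (h : L.Perm L') (hA : tensN L = A) (hB : tensN L' = B) :
    ∃ f : A ⟶ B, IsCoh L L' f := by
  subst hA hB
  obtain ⟨f, hf⟩ := Coh.exists_of_perm h
  exact ⟨f, of_coh hf⟩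

theorem perm {f : A ⟶ B} (h : IsCoh L L' f) : L.Perm L' := h.choose_spec.2.2.1.perm

theorem inverse {f : A ⟶ B} {g : B ⟶ A} (hf : IsCoh L L' f) (hg : IsCoh L' L g)
    (hL : (L.map Prod.fst).Nodup) : f ≫ g = 𝟙 A :=
  eq_of_heq ((hf.comp hg).unique (id hf.choose_spec.1) hL)

theorem names (u : ℕ → ℕ) {f : A ⟶ B} (h : IsCoh L L' f) :
    IsCoh (L.map (fun p => (u p.1, p.2))) (L'.map (fun p => (u p.1, p.2))) f := by
  obtain ⟨f, rfl, rfl, hf, h⟩ := h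
  cases h
  induction hf with
  | id L => exact id (tensN_names u L)
  | comp _ _ h1 h2 => exact h1.comp h2
  | cons p _ h => exact h.cons _
  | swap p q L =>
    exact swap (u p.1, p.2) (u q.1, q.2) (tensN_names u L)

theorem tensN_map {F : K ⥤ K'} (hF : IsStrictSymm F) (L : List (ℕ × K)) :
    tensN (L.map (fun p => (p.1, F.obj p.2))) = F.obj (tensN L) := by
  induction L with
  | nil => exact hF.obj_unit.symm
  | cons p L ih => exact (congrArg (F.obj p.2 ⊗ ·) ih).trans (hF.obj_tensor _ _).symm

variable [Permutative K]

theorem tensN_append (L M : List (ℕ × K)) : tensN (L ++ M) = tensN L ⊗ tensN M := by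
  induction L with
  | nil => exact (unit_tensor _).symm
  | cons p L ih => exact (congrArg (p.2 ⊗ ·) ih).trans (tensor_assoc _ _ _).symm

theorem tensN_filter [DecidablePred fun p : ℕ × K => p.2 ≠ 𝟙_ K] (L : List (ℕ × K)) :
    tensN (L.filter (fun p => p.2 ≠ 𝟙_ K)) = tensN L := by
  induction L with
  | nil => rfl
  | cons p L ih =>
    by_cases h : p.2 = 𝟙_ K
    · rw [List.filter_cons_of_neg (by simpa using h), ih]
      change _ = p.2 ⊗ tensN L
      rw [h, unit_tensor]
    · rw [List.filter_cons_of_pos (by simpa using h)]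
      exact congrArg (p.2 ⊗ ·) ih

theorem whiskerRight {f : A ⟶ B} (hf : IsCoh L L' f) (hD : tensN M = D) :
    IsCoh (L ++ M) (L' ++ M) (f ▷ D) := by
  obtain ⟨f, rfl, rfl, hf, h⟩ := hf
  cases h
  subst hD
  induction hf with
  | id L =>
    rw [id_whiskerRight]
    exact id (tensN_append _ _)
  | comp _ _ h1 h2 => rw [comp_whiskerRight]; exact h1.comp h2
  | cons p _ h =>
    exact (h.cons p).congr (tensor_assoc _ _ _).symm (tensor_assoc _ _ _).symm
      (whisker_assoc_heq _ _ _).symm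
  | swap p q L =>
    exact (swap p q (tensN_append L M)).congr
      (by rw [← tensor_assoc, ← tensor_assoc, tensor_assoc p.2]; rfl)
      (by rw [← tensor_assoc, ← tensor_assoc, tensor_assoc q.2]; rfl)
      (sw_whiskerRight_heq _ _ _ _).symm

theorem whiskerLeft {f : A ⟶ B} (hf : IsCoh L L' f) (hD : tensN M = D) :
    IsCoh (M ++ L) (M ++ L') (D ◁ f) := by
  subst hD
  induction M with
  | nil => exact hf.congr (unit_tensor _).symm (unit_tensor _).symm (unit_whiskerLeft_heq _).symm
  | cons p M ih =>
    exact (ih.cons p).congr (tensor_assoc _ _ _).symm (tensor_assoc _ _ _).symm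
      (tensor_whiskerLeft_heq _ _ _).symm

theorem tensor {f : A ⟶ B} {g : A' ⟶ B'} (hf : IsCoh L L' f) (hg : IsCoh M M' g) :
    IsCoh (L ++ M) (L' ++ M') (f ⊗ₘ g) := by
  rw [MonoidalCategory.tensorHom_def]
  exact (hf.whiskerRight hg.choose_spec.1).comp (hg.whiskerLeft hf.choose_spec.2.1)

theorem braiding_one (p : ℕ × K) (M : List (ℕ × K)) :
    IsCoh (p :: M) (M ++ [p]) (β_ p.2 (tensN M)).hom := by
  induction M with
  | nil =>
    exact (id (L := [p]) rfl).congr rfl ((tensor_unit _).trans (unit_tensor _).symm)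
      ((id_heq (tensor_unit _)).trans (braiding_unit_right p.2).symm)
  | cons q M ih =>
    exact ((swap p q rfl).comp (ih.cons q)).congr rfl (tensor_assoc _ _ _).symm
      (braiding_tensor_right_heq _ _ _).symm

theorem braiding (hA : tensN L = A) (hB : tensN M = B) :
    IsCoh (L ++ M) (M ++ L) (β_ A B).hom := by
  subst hA hB
  induction L with
  | nil =>
    rw [List.append_nil]
    exact (id (L := M) rfl).congr (unit_tensor _).symm (tensor_unit _).symm
      (braiding_unit_left _).symm
  | cons p L ih =>
    have h1 := (braiding_one p M).whiskerRight (M := L) rfl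
    rw [List.append_assoc, List.singleton_append] at h1
    have h2 : IsCoh (p :: (M ++ L)) (p :: (M ++ L))
        (CategoryTheory.eqToHom (tensor_assoc p.2 (tensN M) (tensN L)).symm) :=
      eqToHom (L := p :: (M ++ L)) (congrArg (p.2 ⊗ ·) (tensN_append M L)) _
    exact ((ih.cons p).comp (h2.comp h1)).congr (tensor_assoc _ _ _).symm (tensor_assoc _ _ _)
      (braiding_tensor_left_heq _ _ _).symm

theorem filter [DecidablePred fun p : ℕ × K => p.2 ≠ 𝟙_ K] {f : A ⟶ B} (h : IsCoh L L' f) :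
    IsCoh (L.filter (fun p => p.2 ≠ 𝟙_ K)) (L'.filter (fun p => p.2 ≠ 𝟙_ K)) f := by
  obtain ⟨f, rfl, rfl, hf, h⟩ := h
  cases h
  induction hf with
  | id L => exact id (tensN_filter L)
  | comp _ _ h1 h2 => exact h1.comp h2
  | @cons p L L' f hf h =>
    by_cases hp : p.2 = 𝟙_ K
    · rw [List.filter_cons_of_neg (by simpa using hp), List.filter_cons_of_neg (by simpa using hp)]
      refine h.congr ?_ ?_ ?_
      · change _ = p.2 ⊗ _; rw [hp, unit_tensor]
      · change _ = p.2 ⊗ _; rw [hp, unit_tensor]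
      · change f ≍ p.2 ◁ f; rw [hp]; exact (unit_whiskerLeft_heq f).symm
    · rw [List.filter_cons_of_pos (by simpa using hp), List.filter_cons_of_pos (by simpa using hp)]
      exact h.cons p
  | swap p q L =>
    by_cases hp : p.2 = 𝟙_ K <;> by_cases hq : q.2 = 𝟙_ K
    · rw [List.filter_cons_of_neg (by simpa using hp), List.filter_cons_of_neg (by simpa using hq),
        List.filter_cons_of_neg (by simpa using hq), List.filter_cons_of_neg (by simpa using hp)]
      refine (id (tensN_filter L)).congr ?_ ?_ (HEq.trans (id_heq ?_) (sw_unit_left hp _ _).symm)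
      · change _ = p.2 ⊗ q.2 ⊗ _; rw [hp, hq, unit_tensor, unit_tensor]
      · change _ = q.2 ⊗ p.2 ⊗ _; rw [hp, hq, unit_tensor, unit_tensor]
      · rw [hq, unit_tensor]
    · rw [List.filter_cons_of_neg (by simpa using hp), List.filter_cons_of_pos (by simpa using hq),
        List.filter_cons_of_pos (by simpa using hq), List.filter_cons_of_neg (by simpa using hp)]
      refine (id (L := q :: L.filter _) (congrArg (q.2 ⊗ ·) (tensN_filter L))).congr ?_ ?_
        (sw_unit_left hp _ _).symm
      · change _ = p.2 ⊗ q.2 ⊗ _; rw [hp, unit_tensor]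
      · change _ = q.2 ⊗ p.2 ⊗ _; rw [hp, unit_tensor]
    · rw [List.filter_cons_of_pos (by simpa using hp), List.filter_cons_of_neg (by simpa using hq),
        List.filter_cons_of_neg (by simpa using hq), List.filter_cons_of_pos (by simpa using hp)]
      refine (id (L := p :: L.filter _) (congrArg (p.2 ⊗ ·) (tensN_filter L))).congr ?_ ?_
        (sw_unit_right hq _ _).symm
      · change _ = p.2 ⊗ q.2 ⊗ _; rw [hq, unit_tensor]
      · change _ = q.2 ⊗ p.2 ⊗ _; rw [hq, unit_tensor]
    · rw [List.filter_cons_of_pos (by simpa using hp), List.filter_cons_of_pos (by simpa using hq),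
        List.filter_cons_of_pos (by simpa using hq), List.filter_cons_of_pos (by simpa using hp)]
      exact swap p q (tensN_filter L)

theorem map {K' : Type u₂} [Category.{v₂} K'] [MonoidalCategory K'] [SymmetricCategory K']
    [Permutative K'] {F : K ⥤ K'} (hF : IsStrictSymm F) {f : A ⟶ B} (h : IsCoh L L' f) :
    IsCoh (L.map (fun p => (p.1, F.obj p.2))) (L'.map (fun p => (p.1, F.obj p.2))) (F.map f) := by
  obtain ⟨f, rfl, rfl, hf, h⟩ := h
  cases h
  induction hf with
  | id L => rw [F.map_id]; exact id (tensN_map hF L)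
  | comp _ _ h1 h2 => rw [F.map_comp]; exact h1.comp h2
  | cons p _ h =>
    exact (h.cons _).congr (hF.obj_tensor _ _).symm (hF.obj_tensor _ _).symm
      (hF.map_whiskerLeft _ _).symm
  | swap p q L =>
    have h : ∀ A B Z : K, F.obj (A ⊗ B ⊗ Z) = F.obj A ⊗ F.obj B ⊗ F.obj Z := fun A B Z => by
      rw [hF.obj_tensor, hF.obj_tensor]
    exact (swap (p.1, F.obj p.2) (q.1, F.obj q.2) (tensN_map hF L)).congr (h _ _ _).symm
      (h _ _ _).symm (hF.map_sw _ _ _).symm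

end IsCoh

end IsCoh

/-! ## The parsummable category `Φ(K)` -/

theorem IsCoh.exists_iso {K : Type u₁} [Category.{v₁} K] [MonoidalCategory K] [SymmetricCategory K]
    {L L' : List (ℕ × K)} {A B : K} (h : L.Perm L') (hL : (L.map Prod.fst).Nodup)
    (hA : tensN L = A) (hB : tensN L' = B) :
    ∃ e : A ≅ B, IsCoh L L' e.hom ∧ IsCoh L' L e.inv := by
  obtain ⟨f, hf⟩ := IsCoh.exists_of_perm h hA hB
  obtain ⟨g, hg⟩ := IsCoh.exists_of_perm h.symm hB hA
  exact ⟨⟨f, g, hf.inverse hg hL, hg.inverse hf ((h.map _).nodup hL)⟩, hf, hg⟩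

theorem IsCoh.unique_of_eq {K : Type u₁} [Category.{v₁} K] [MonoidalCategory K]
    [SymmetricCategory K] {L L' M M' : List (ℕ × K)} {A B A' B' : K} {f : A ⟶ B} {g : A' ⟶ B'}
    (hf : IsCoh L L' f) (hg : IsCoh M M' g) (e : L = M) (e' : L' = M')
    (hL : (L.map Prod.fst).Nodup) : f ≍ g := by
  subst e e'; exact hf.unique hg hL

theorem list_ext {K : Type u₁} {L L' : List (ℕ × K)} (h : L.Pairwise (fun p q => p.1 < q.1))
    (h' : L'.Pairwise (fun p q => p.1 < q.1)) (hL : ∀ p, p ∈ L ↔ p ∈ L') : L = L' := by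
  have nd : ∀ {L : List (ℕ × K)}, L.Pairwise (fun p q => p.1 < q.1) → L.Nodup := fun h =>
    h.imp (fun hpq e => by rw [e] at hpq; exact lt_irrefl _ hpq)
  exact ((List.perm_ext_iff_of_nodup (nd h) (nd h')).mpr hL).eq_of_pairwise
    (fun _ _ _ _ h1 h2 => absurd h1 (lt_asymm h2)) h h'

/-- The objects of `Φ(K)`: sequences of objects of `K`, almost all of which are the unit. -/
@[ext]
structure PhiObj (K : Type u₁) [Category.{v₁} K] [MonoidalCategory K] where
  seq : ℕ → K
  finite : {i | seq i ≠ 𝟙_ K}.Finite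

namespace PhiObj

section Obj

variable {K : Type u₁} [Category.{v₁} K] [MonoidalCategory K]

theorem ext' {X Y : PhiObj K} (h : ∀ i, X.seq i = Y.seq i) : X = Y := PhiObj.ext (funext h)

/-- The list of the pairs `(i, X_i)` with `X_i ≠ 1`, in increasing order of `i`. -/
def list (X : PhiObj K) : List (ℕ × K) :=
  (X.finite.toFinset.sort (· ≤ ·)).map (fun i => (i, X.seq i))

/-- The tensor product of all `X_i` in increasing order of `i`. Since the tensor product of a
permutative category is strictly unital, we may leave out the trivial factors. -/
def obj (X : PhiObj K) : K := tensN X.list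

/-- A morphism `X ⟶ Y` in `Φ(K)` is a morphism `⨂ X_i ⟶ ⨂ Y_i` in `K`. -/
instance : Category.{v₁} (PhiObj K) where
  Hom X Y := X.obj ⟶ Y.obj
  id X := 𝟙 X.obj
  comp f g := f ≫ g

theorem mem_list (X : PhiObj K) (p : ℕ × K) : p ∈ X.list ↔ X.seq p.1 = p.2 ∧ p.2 ≠ 𝟙_ K := by
  obtain ⟨i, A⟩ := p
  simp only [list, List.mem_map, Finset.mem_sort, Set.Finite.mem_toFinset, Set.mem_ofPred_eq,
    Prod.mk.injEq]
  constructor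
  · rintro ⟨i, h, rfl, rfl⟩; exact ⟨rfl, h⟩
  · rintro ⟨rfl, h⟩; exact ⟨i, h, rfl, rfl⟩

theorem pairwise_list (X : PhiObj K) : X.list.Pairwise (fun p q => p.1 < q.1) := by
  rw [list, List.pairwise_map]
  exact X.finite.toFinset.sortedLT_sort.pairwise

theorem nodup_fst (X : PhiObj K) : (X.list.map Prod.fst).Nodup := by
  rw [List.Nodup, List.pairwise_map]
  exact X.pairwise_list.imp (fun h => h.ne)

theorem nodup_list (X : PhiObj K) : X.list.Nodup := X.nodup_fst.of_map _

/-- The sequence `u_*(X)`, with `u_*(X)_{u(j)} = X_j` and all other entries trivial. -/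
def act (u : ℕ ↪ ℕ) (X : PhiObj K) : PhiObj K where
  seq := Function.extend u X.seq (fun _ => 𝟙_ K)
  finite := (X.finite.image u).subset (by
    intro i hi
    by_cases h : ∃ j, u j = i
    · obtain ⟨j, rfl⟩ := h
      rw [Set.mem_ofPred_eq, u.injective.extend_apply] at hi
      exact ⟨j, hi, rfl⟩
    · rw [Set.mem_ofPred_eq, Function.extend_apply' _ _ _ h] at hi
      exact absurd rfl hi)

theorem act_seq (u : ℕ ↪ ℕ) (X : PhiObj K) (j : ℕ) : (act u X).seq (u j) = X.seq j :=
  u.injective.extend_apply X.seq (fun _ => 𝟙_ K) j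

theorem act_seq' (u : ℕ ↪ ℕ) (X : PhiObj K) (i : ℕ) (h : ¬ ∃ j, u j = i) :
    (act u X).seq i = 𝟙_ K :=
  Function.extend_apply' X.seq (fun _ => 𝟙_ K) i h

theorem act_refl (X : PhiObj K) : act (Function.Embedding.refl ℕ) X = X :=
  ext' (fun i => act_seq (Function.Embedding.refl ℕ) X i)

theorem act_trans (u v : ℕ ↪ ℕ) (X : PhiObj K) : act (v.trans u) X = act u (act v X) := by
  refine ext' (fun i => ?_)
  by_cases h : ∃ j, u j = i
  · obtain ⟨j, rfl⟩ := h
    rw [act_seq]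
    by_cases h' : ∃ k, v k = j
    · obtain ⟨k, rfl⟩ := h'
      rw [act_seq]
      exact act_seq (v.trans u) X k
    · rw [act_seq' v X j h', act_seq']
      rintro ⟨k, hk⟩
      exact h' ⟨k, u.injective hk⟩
  · rw [act_seq' u _ i h, act_seq']
    rintro ⟨k, hk⟩
    exact h ⟨v k, hk⟩

/-- The list of `X`, with the names changed by `u`. -/
def relist (u : ℕ ↪ ℕ) (X : PhiObj K) : List (ℕ × K) := X.list.map (fun p => (u p.1, p.2))

theorem nodup_relist (u : ℕ ↪ ℕ) (X : PhiObj K) : ((relist u X).map Prod.fst).Nodup := by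
  have : (relist u X).map Prod.fst = (X.list.map Prod.fst).map u := by
    simp [relist, List.map_map, Function.comp_def]
  rw [this]
  exact X.nodup_fst.map u.injective

theorem perm_act (u : ℕ ↪ ℕ) (X : PhiObj K) : (relist u X).Perm (act u X).list := by
  rw [List.perm_ext_iff_of_nodup ((nodup_relist u X).of_map _) (nodup_list _)]
  rintro ⟨i, A⟩
  simp only [relist, List.mem_map, mem_list, Prod.mk.injEq, Prod.exists]
  constructor
  · rintro ⟨j, B, ⟨rfl, h⟩, rfl, rfl⟩
    exact ⟨act_seq u X j, h⟩
  · rintro ⟨rfl, h⟩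
    by_cases h' : ∃ j, u j = i
    · obtain ⟨j, rfl⟩ := h'
      exact ⟨j, X.seq j, ⟨rfl, by rwa [act_seq] at h⟩, rfl, (act_seq u X j).symm⟩
    · exact absurd (act_seq' u X i h') h

variable (K) in
/-- The zero object: the constant sequence at the unit. -/
def zero : PhiObj K := ⟨fun _ => 𝟙_ K, by simp⟩

theorem zero_list : (zero K).list = [] := by
  rw [List.eq_nil_iff_forall_not_mem]
  intro p hp
  rw [mem_list] at hp
  exact hp.2 hp.1.symm

theorem act_zero (u : ℕ ↪ ℕ) : act u (zero K) = zero K := by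
  refine ext' (fun i => ?_)
  by_cases h : ∃ j, u j = i
  · obtain ⟨j, rfl⟩ := h
    exact act_seq u _ j
  · exact act_seq' u _ i h

open Classical in
/-- The sum of `X` and `Y`, with `(X + Y)_i = X_i` for all `i` with `X_i ≠ 1`, and
`(X + Y)_i = Y_i` for the remaining `i`. -/
def add (X Y : PhiObj K) : PhiObj K where
  seq i := if X.seq i ≠ 𝟙_ K then X.seq i else Y.seq i
  finite := (X.finite.union Y.finite).subset (by
    intro i hi
    by_cases h : X.seq i = 𝟙_ K
    · right; simpa [h] using hi
    · left; exact h)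

theorem add_of_ne {X Y : PhiObj K} {i : ℕ} (h : X.seq i ≠ 𝟙_ K) : (add X Y).seq i = X.seq i :=
  if_pos h

theorem add_of_eq {X Y : PhiObj K} {i : ℕ} (h : X.seq i = 𝟙_ K) : (add X Y).seq i = Y.seq i :=
  if_neg (not_not.mpr h)

/-- The sequences `X` and `Y` are disjointly supported. -/
def Disj (X Y : PhiObj K) : Prop := ∀ i, X.seq i = 𝟙_ K ∨ Y.seq i = 𝟙_ K

theorem Disj.symm {X Y : PhiObj K} (h : Disj X Y) : Disj Y X := fun i => (h i).symm

theorem perm_add {X Y : PhiObj K} (h : Disj X Y) : (X.list ++ Y.list).Perm (add X Y).list := by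
  have hnd : (X.list ++ Y.list).Nodup := List.nodup_append.mpr ⟨X.nodup_list, Y.nodup_list, by
    rintro p hp q hq rfl
    rw [mem_list] at hp hq
    rcases h p.1 with h | h
    · exact hp.2 (hp.1.symm.trans h)
    · exact hq.2 (hq.1.symm.trans h)⟩
  rw [List.perm_ext_iff_of_nodup hnd (nodup_list _)]
  rintro ⟨i, A⟩
  simp only [List.mem_append, mem_list]
  by_cases hX : X.seq i = 𝟙_ K
  · rw [add_of_eq hX, hX]
    constructor
    · rintro (h | h)
      · exact absurd h.1.symm h.2
      · exact h
    · exact Or.inr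
  · rw [add_of_ne hX, (h i).resolve_left hX]
    constructor
    · rintro (h | h)
      · exact h
      · exact absurd h.1.symm h.2
    · exact Or.inl

theorem nodup_append {X Y : PhiObj K} (h : Disj X Y) :
    ((X.list ++ Y.list).map Prod.fst).Nodup :=
  ((perm_add h).symm.map _).nodup (nodup_fst _)

theorem add_comm {X Y : PhiObj K} (h : Disj X Y) : add X Y = add Y X := by
  refine ext' (fun i => ?_)
  by_cases hX : X.seq i = 𝟙_ K
  · by_cases hY : Y.seq i = 𝟙_ K
    · rw [add_of_eq hX, add_of_eq hY, hX, hY]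
    · rw [add_of_eq hX, add_of_ne hY]
  · rw [add_of_ne hX, add_of_eq ((h i).resolve_left hX)]

theorem zero_add (X : PhiObj K) : add (zero K) X = X := ext' (fun _ => add_of_eq rfl)

theorem add_assoc (X Y Z : PhiObj K) : add (add X Y) Z = add X (add Y Z) := by
  refine ext' (fun i => ?_)
  by_cases hX : X.seq i = 𝟙_ K
  · rw [add_of_eq hX]
    by_cases hY : Y.seq i = 𝟙_ K
    · rw [add_of_eq hY, add_of_eq (by rw [add_of_eq hX, hY])]
    · rw [add_of_ne hY, add_of_ne (by rwa [add_of_eq hX]), add_of_eq hX]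
  · rw [add_of_ne hX, add_of_ne (by rwa [add_of_ne hX]), add_of_ne hX]

theorem act_add (u : ℕ ↪ ℕ) (X Y : PhiObj K) : act u (add X Y) = add (act u X) (act u Y) := by
  refine ext' (fun i => ?_)
  by_cases h : ∃ j, u j = i
  · obtain ⟨j, rfl⟩ := h
    rw [act_seq]
    by_cases hX : X.seq j = 𝟙_ K
    · rw [add_of_eq hX, add_of_eq (by rwa [act_seq]), act_seq]
    · rw [add_of_ne hX, add_of_ne (by rwa [act_seq]), act_seq]
  · rw [act_seq' u _ i h, add_of_eq (act_seq' u _ i h), act_seq' u _ i h]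

theorem Disj.act {X Y : PhiObj K} (h : Disj X Y) (u : ℕ ↪ ℕ) : Disj (act u X) (act u Y) := by
  intro i
  by_cases hi : ∃ j, u j = i
  · obtain ⟨j, rfl⟩ := hi
    rw [act_seq, act_seq]; exact h j
  · exact Or.inl (act_seq' u _ i hi)

theorem disj_add_left {X Y Z : PhiObj K} (h : Disj X Z) (h' : Disj Y Z) : Disj (add X Y) Z := by
  intro i
  by_cases hX : X.seq i = 𝟙_ K
  · rw [add_of_eq hX]; exact h' i
  · rw [add_of_ne hX]; exact h i

end Obj

section Hom

variable {K : Type u₁} [Category.{v₁} K] [MonoidalCategory K] [SymmetricCategory K]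

theorem exists_circ (u : ℕ ↪ ℕ) (X : PhiObj K) : ∃ e : X.obj ≅ (act u X).obj,
    IsCoh (relist u X) (act u X).list e.hom ∧ IsCoh (act u X).list (relist u X) e.inv :=
  IsCoh.exists_iso (perm_act u X) (nodup_relist u X) (tensN_names u _) rfl

/-- The isomorphism `u_∘`: the coherence isomorphism `⨂ X_i ≅ ⨂ u_*(X)_i`, given by permuting the
non-trivial factors according to `u`. -/
def circ (u : ℕ ↪ ℕ) (X : PhiObj K) : X.obj ≅ (act u X).obj := (exists_circ u X).choose

theorem circ_hom (u : ℕ ↪ ℕ) (X : PhiObj K) :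
    IsCoh (relist u X) (act u X).list (circ u X).hom := (exists_circ u X).choose_spec.1

theorem circ_inv (u : ℕ ↪ ℕ) (X : PhiObj K) :
    IsCoh (act u X).list (relist u X) (circ u X).inv := (exists_circ u X).choose_spec.2

theorem circ_refl_hom (X : PhiObj K) : (circ (Function.Embedding.refl ℕ) X).hom ≍ 𝟙 X.obj := by
  have h := circ_hom (Function.Embedding.refl ℕ) X
  have e : relist (Function.Embedding.refl ℕ) X = X.list := List.map_id _
  exact h.unique_of_eq (IsCoh.id (L := X.list) rfl) e (congrArg list (act_refl X))
    (nodup_relist _ _)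

theorem circ_refl_inv (X : PhiObj K) : (circ (Function.Embedding.refl ℕ) X).inv ≍ 𝟙 X.obj := by
  have h := circ_inv (Function.Embedding.refl ℕ) X
  have e : relist (Function.Embedding.refl ℕ) X = X.list := List.map_id _
  exact h.unique_of_eq (IsCoh.id (L := X.list) rfl) (congrArg list (act_refl X)) e (nodup_fst _)

theorem relist_trans (u v : ℕ ↪ ℕ) (X : PhiObj K) :
    (relist v X).map (fun p => (u p.1, p.2)) = relist (v.trans u) X := by
  simp [relist, List.map_map, Function.comp_def]

theorem circ_trans_hom (u v : ℕ ↪ ℕ) (X : PhiObj K) :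
    (circ (v.trans u) X).hom ≍ (circ v X).hom ≫ (circ u (act v X)).hom := by
  have h := circ_hom (v.trans u) X
  have h' := ((circ_hom v X).names u).comp (circ_hom u (act v X))
  exact h.unique_of_eq h' (relist_trans u v X).symm (congrArg list (act_trans u v X))
    (nodup_relist _ _)

theorem circ_trans_inv (u v : ℕ ↪ ℕ) (X : PhiObj K) :
    (circ (v.trans u) X).inv ≍ (circ u (act v X)).inv ≫ (circ v X).inv := by
  have h := circ_inv (v.trans u) X
  have h' := (circ_inv u (act v X)).comp ((circ_inv v X).names u)
  exact h.unique_of_eq h' (congrArg list (act_trans u v X)) (relist_trans u v X).symm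
    (nodup_fst _)

variable (K) in
/-- The `Eℳ`-action on `Φ(K)`. -/
def em : EMAction (PhiObj K) where
  act u :=
    { obj := act u
      map := fun {X Y} (f : X.obj ⟶ Y.obj) => (circ u X).inv ≫ f ≫ (circ u Y).hom
      map_id := fun X => by
        change (circ u X).inv ≫ 𝟙 X.obj ≫ (circ u X).hom = 𝟙 _
        simp
      map_comp := fun {X Y Z} (f : X.obj ⟶ Y.obj) (g : Y.obj ⟶ Z.obj) => by
        change (circ u X).inv ≫ (f ≫ g) ≫ (circ u Z).hom =
          ((circ u X).inv ≫ f ≫ (circ u Y).hom) ≫ (circ u Y).inv ≫ g ≫ (circ u Z).hom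
        simp }
  tr u v :=
    { app := fun X => (circ u X).inv ≫ (circ v X).hom
      naturality := fun X Y (f : X.obj ⟶ Y.obj) => by
        change ((circ u X).inv ≫ f ≫ (circ u Y).hom) ≫ (circ u Y).inv ≫ (circ v Y).hom =
          ((circ u X).inv ≫ (circ v X).hom) ≫ (circ v X).inv ≫ f ≫ (circ v Y).hom
        simp }
  tr_self u := by
    ext X
    change (circ u X).inv ≫ (circ u X).hom = 𝟙 _
    simp
  tr_trans u v w := by
    ext X
    change ((circ u X).inv ≫ (circ v X).hom) ≫ (circ v X).inv ≫ (circ w X).hom =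
      (circ u X).inv ≫ (circ w X).hom
    simp
  act_one := by
    refine Functor.hext act_refl (fun X Y (f : X.obj ⟶ Y.obj) => ?_)
    refine (comp_heq (by rw [act_refl]) rfl (by rw [act_refl]) (circ_refl_inv X)
      (comp_heq rfl rfl (by rw [act_refl]) HEq.rfl (circ_refl_hom Y))).trans ?_
    exact heq_of_eq ((Category.id_comp _).trans (Category.comp_id f))
  act_mul u v := by
    refine Functor.hext (act_trans u v) (fun X Y (f : X.obj ⟶ Y.obj) => ?_)
    refine (comp_heq (by rw [act_trans]) rfl (by rw [act_trans]) (circ_trans_inv u v X)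
      (comp_heq rfl rfl (by rw [act_trans]) (HEq.refl f) (circ_trans_hom u v Y))).trans ?_
    refine heq_of_eq ?_
    change _ = (circ u (act v X)).inv ≫ ((circ v X).inv ≫ f ≫ (circ v Y).hom) ≫
      (circ u (act v Y)).hom
    simp
  tr_mul u u' v v' X := by
    refine (comp_heq (by rw [act_trans]) rfl (by rw [act_trans]) (circ_trans_inv u v X)
      (circ_trans_hom u' v' X)).trans ?_
    refine heq_of_eq ?_
    change _ = ((circ u (act v X)).inv ≫ ((circ v X).inv ≫ (circ v' X).hom) ≫
      (circ u (act v' X)).hom) ≫ (circ u (act v' X)).inv ≫ (circ u' (act v' X)).hom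
    simp

theorem supportedOn_iff (X : PhiObj K) (A : Finset ℕ) :
    (em K).SupportedOn X A ↔ ∀ i ∉ A, X.seq i = 𝟙_ K := by
  constructor
  · intro h i hi
    have hle : ∀ n ∈ A, n ≤ A.sup _root_.id := fun n hn => Finset.le_sup (f := _root_.id) hn
    let u : ℕ ↪ ℕ := ⟨fun n => if n ∈ A then n else n + (i + 1 + A.sup _root_.id), fun a b hab => by
      by_cases ha : a ∈ A <;> by_cases hb : b ∈ A <;> simp only [ha, hb, if_true, if_false] at hab
      · exact hab
      · have := hle a ha; omega
      · have := hle b hb; omega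
      · omega⟩
    have h1 : act u X = X := h u (fun n hn => if_pos hn)
    rw [← h1]
    refine act_seq' u X i ?_
    rintro ⟨j, hj⟩
    change (if j ∈ A then j else _) = i at hj
    split_ifs at hj with h2
    · exact hi (hj ▸ h2)
    · omega
  · intro h u hu
    refine ext' (fun i => ?_)
    change (act u X).seq i = _
    by_cases hi : ∃ j, u j = i
    · obtain ⟨j, rfl⟩ := hi
      rw [act_seq]
      by_cases hj : j ∈ A
      · rw [hu j hj]
      · rw [h j hj, h]
        intro h'
        exact hj (u.injective (hu _ h') ▸ h')
    · rw [act_seq' u X i hi, h]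
      intro h'
      exact hi ⟨i, hu i h'⟩

theorem em_supp (X : PhiObj K) : (em K).supp X = {i | X.seq i ≠ 𝟙_ K} := by
  ext i
  constructor
  · intro h
    have := h X.finite.toFinset ((supportedOn_iff X _).mpr (fun i hi => by simpa using hi))
    simpa using this
  · intro h A hA
    by_contra hi
    exact h ((supportedOn_iff X A).mp hA i hi)

theorem tame : (em K).IsTame := fun X =>
  ⟨X.finite.toFinset, (supportedOn_iff X _).mpr (fun i hi => by simpa using hi)⟩

theorem disj_of_disjoint {X Y : PhiObj K} (h : Disjoint ((em K).supp X) ((em K).supp Y)) :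
    Disj X Y := by
  intro i
  by_contra hi
  rw [not_or] at hi
  rw [em_supp, em_supp] at h
  exact Set.disjoint_left.mp h hi.1 hi.2

variable [Permutative K]

theorem exists_mix {X Y : PhiObj K} (h : Disj X Y) : ∃ e : X.obj ⊗ Y.obj ≅ (add X Y).obj,
    IsCoh (X.list ++ Y.list) (add X Y).list e.hom ∧ IsCoh (add X Y).list (X.list ++ Y.list) e.inv :=
  IsCoh.exists_iso (perm_add h) (nodup_append h) (IsCoh.tensN_append _ _) rfl

/-- The coherence isomorphism `(⨂ X_i) ⊗ (⨂ Y_i) ≅ ⨂ (X + Y)_i`. -/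
def mix {X Y : PhiObj K} (h : Disj X Y) : X.obj ⊗ Y.obj ≅ (add X Y).obj := (exists_mix h).choose

theorem mix_hom {X Y : PhiObj K} (h : Disj X Y) :
    IsCoh (X.list ++ Y.list) (add X Y).list (mix h).hom := (exists_mix h).choose_spec.1

theorem mix_inv {X Y : PhiObj K} (h : Disj X Y) :
    IsCoh (add X Y).list (X.list ++ Y.list) (mix h).inv := (exists_mix h).choose_spec.2

/-- The sum of morphisms: their tensor product, conjugated by coherence isomorphisms. -/
def addMap {X X' Y Y' : PhiObj K} (h : Disj X Y) (h' : Disj X' Y') (f : X.obj ⟶ X'.obj)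
    (g : Y.obj ⟶ Y'.obj) : (add X Y).obj ⟶ (add X' Y').obj :=
  (mix h).inv ≫ (f ⊗ₘ g) ≫ (mix h').hom

theorem relist_append (u : ℕ ↪ ℕ) (X Y : PhiObj K) :
    (X.list ++ Y.list).map (fun p => (u p.1, p.2)) = relist u X ++ relist u Y :=
  List.map_append

theorem nodup_relist_append (u : ℕ ↪ ℕ) {X Y : PhiObj K} (h : Disj X Y) :
    ((relist u X ++ relist u Y).map Prod.fst).Nodup := by
  have e : (relist u X ++ relist u Y).map Prod.fst =
      ((X.list ++ Y.list).map Prod.fst).map u := by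
    simp [relist, List.map_map, Function.comp_def]
  rw [e]
  exact (nodup_append h).map u.injective

theorem mix_circ_hom (u : ℕ ↪ ℕ) {X Y : PhiObj K} (h : Disj X Y) :
    (mix h).hom ≫ (circ u (add X Y)).hom ≍
      ((circ u X).hom ⊗ₘ (circ u Y).hom) ≫ (mix (h.act u)).hom := by
  have h1 := ((mix_hom h).names u).comp (circ_hom u (add X Y))
  have h2 := ((circ_hom u X).tensor (circ_hom u Y)).comp (mix_hom (h.act u))
  refine h1.unique_of_eq h2 (relist_append u X Y) (congrArg list (act_add u X Y)) ?_
  rw [relist_append]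
  exact nodup_relist_append u h

theorem mix_circ_inv (u : ℕ ↪ ℕ) {X Y : PhiObj K} (h : Disj X Y) :
    (circ u (add X Y)).inv ≫ (mix h).inv ≍
      (mix (h.act u)).inv ≫ ((circ u X).inv ⊗ₘ (circ u Y).inv) := by
  have h1 := (circ_inv u (add X Y)).comp ((mix_inv h).names u)
  have h2 := (mix_inv (h.act u)).comp ((circ_inv u X).tensor (circ_inv u Y))
  exact h1.unique_of_eq h2 (congrArg list (act_add u X Y)) (relist_append u X Y) (nodup_fst _)

theorem conj_heq {A B A' B' Z Z' : K} {a : A ⟶ Z} {a' : A' ⟶ Z} {f : Z ⟶ Z'} {b : Z' ⟶ B}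
    {b' : Z' ⟶ B'} (hA : A = A') (hB : B = B') (ha : a ≍ a') (hb : b ≍ b') :
    a ≫ f ≫ b ≍ a' ≫ f ≫ b' := by
  subst hA hB; cases ha; cases hb; rfl

theorem act_addMap (u : ℕ ↪ ℕ) {X X' Y Y' : PhiObj K} (h : Disj X Y) (h' : Disj X' Y')
    (f : X.obj ⟶ X'.obj) (g : Y.obj ⟶ Y'.obj) :
    (circ u (add X Y)).inv ≫ addMap h h' f g ≫ (circ u (add X' Y')).hom ≍
      addMap (h.act u) (h'.act u) ((circ u X).inv ≫ f ≫ (circ u X').hom)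
        ((circ u Y).inv ≫ g ≫ (circ u Y').hom) := by
  have := conj_heq (f := f ⊗ₘ g) (by rw [act_add]) (by rw [act_add]) (mix_circ_inv u h)
    (mix_circ_hom u h')
  simpa only [addMap, Category.assoc, ← tensorHom_comp_tensorHom] using this

theorem tr_add (u v : ℕ ↪ ℕ) {X Y : PhiObj K} (h : Disj X Y) :
    (circ u (add X Y)).inv ≫ (circ v (add X Y)).hom ≍
      addMap (h.act u) (h.act v) ((circ u X).inv ≫ (circ v X).hom)
        ((circ u Y).inv ≫ (circ v Y).hom) := by
  have := conj_heq (f := 𝟙 _) (by rw [act_add]) (by rw [act_add]) (mix_circ_inv u h)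
    (mix_circ_hom v h)
  simpa only [addMap, Category.assoc, ← tensorHom_comp_tensorHom, Category.id_comp,
    Iso.inv_hom_id_assoc] using this

theorem zero_obj : (zero K).obj = 𝟙_ K := by
  rw [obj, zero_list]; rfl

theorem mix_zero_hom {X : PhiObj K} (h : Disj (zero K) X) : (mix h).hom ≍ 𝟙 X.obj := by
  refine (mix_hom h).unique_of_eq (IsCoh.id (L := X.list) rfl) ?_ (congrArg list (zero_add X))
    (nodup_append h)
  rw [zero_list, List.nil_append]

theorem mix_zero_inv {X : PhiObj K} (h : Disj (zero K) X) : (mix h).inv ≍ 𝟙 X.obj := by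
  refine (mix_inv h).unique_of_eq (IsCoh.id (L := X.list) rfl) (congrArg list (zero_add X)) ?_
    (nodup_fst _)
  rw [zero_list, List.nil_append]

theorem zero_tensor (X : PhiObj K) : (zero K).obj ⊗ X.obj = X.obj := by
  rw [zero_obj, Permutative.unit_tensor]

theorem zero_addMap {X X' : PhiObj K} (h : Disj (zero K) X) (h' : Disj (zero K) X')
    (f : X.obj ⟶ X'.obj) : addMap h h' (𝟙 _) f ≍ f := by
  have h1 : (𝟙 (zero K).obj ⊗ₘ f) ≍ f := by
    rw [id_tensorHom, zero_obj]; exact Permutative.unit_whiskerLeft_heq f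
  refine (comp_heq (by rw [zero_add]) (zero_tensor X) (by rw [zero_add]) (mix_zero_inv h)
    (comp_heq (zero_tensor X) (zero_tensor X') (by rw [zero_add]) h1 (mix_zero_hom h'))).trans ?_
  rw [Category.id_comp, Category.comp_id]

theorem mix_comm_hom {X Y : PhiObj K} (h : Disj X Y) :
    (mix h).hom ≍ (β_ X.obj Y.obj).hom ≫ (mix h.symm).hom := by
  have h1 := mix_hom h
  have h2 := (IsCoh.braiding (L := X.list) (M := Y.list) rfl rfl).comp (mix_hom h.symm)
  exact h1.unique_of_eq h2 rfl (congrArg list (add_comm h)) (nodup_append h)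

theorem mix_comm_inv {X Y : PhiObj K} (h : Disj X Y) :
    (mix h).inv ≍ (mix h.symm).inv ≫ (β_ Y.obj X.obj).hom := by
  have h1 := mix_inv h
  have h2 := (mix_inv h.symm).comp (IsCoh.braiding (L := Y.list) (M := X.list) rfl rfl)
  exact h1.unique_of_eq h2 (congrArg list (add_comm h)) rfl (nodup_fst _)

theorem addMap_comm {X X' Y Y' : PhiObj K} (h : Disj X Y) (h' : Disj X' Y')
    (f : X.obj ⟶ X'.obj) (g : Y.obj ⟶ Y'.obj) :
    addMap h h' f g ≍ addMap h.symm h'.symm g f := by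
  refine (conj_heq (by rw [add_comm h]) (by rw [add_comm h']) (mix_comm_inv h)
    (mix_comm_hom h')).trans (heq_of_eq ?_)
  rw [addMap, Category.assoc, ← BraidedCategory.braiding_naturality_assoc]
  simp

theorem mix_assoc_hom {X Y Z : PhiObj K} (hXY : Disj X Y) (hXZ : Disj X Z) (hYZ : Disj Y Z)
    (h : Disj (add X Y) Z) (h' : Disj X (add Y Z)) :
    ((mix hXY).hom ⊗ₘ 𝟙 Z.obj) ≫ (mix h).hom ≍ (𝟙 X.obj ⊗ₘ (mix hYZ).hom) ≫ (mix h').hom := by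
  have h1 := ((mix_hom hXY).tensor (IsCoh.id (L := Z.list) rfl)).comp (mix_hom h)
  have h2 := ((IsCoh.id (L := X.list) rfl).tensor (mix_hom hYZ)).comp (mix_hom h')
  exact h1.unique_of_eq h2 (List.append_assoc _ _ _) (congrArg list (add_assoc X Y Z))
    ((h1.perm.symm.map _).nodup (nodup_fst _))

theorem mix_assoc_inv {X Y Z : PhiObj K} (hXY : Disj X Y) (hXZ : Disj X Z) (hYZ : Disj Y Z)
    (h : Disj (add X Y) Z) (h' : Disj X (add Y Z)) :
    (mix h).inv ≫ ((mix hXY).inv ⊗ₘ 𝟙 Z.obj) ≍ (mix h').inv ≫ (𝟙 X.obj ⊗ₘ (mix hYZ).inv) := by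
  have h1 := (mix_inv h).comp ((mix_inv hXY).tensor (IsCoh.id (L := Z.list) rfl))
  have h2 := (mix_inv h').comp ((IsCoh.id (L := X.list) rfl).tensor (mix_inv hYZ))
  exact h1.unique_of_eq h2 (congrArg list (add_assoc X Y Z)) (List.append_assoc _ _ _)
    (nodup_fst _)

theorem addMap_assoc {X X' Y Y' Z Z' : PhiObj K} (f : X.obj ⟶ X'.obj) (g : Y.obj ⟶ Y'.obj)
    (k : Z.obj ⟶ Z'.obj) (hXY : Disj X Y) (hXZ : Disj X Z) (hYZ : Disj Y Z)
    (h : Disj (add X Y) Z) (h' : Disj X (add Y Z)) (hXY' : Disj X' Y') (hXZ' : Disj X' Z')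
    (hYZ' : Disj Y' Z') (l : Disj (add X' Y') Z') (l' : Disj X' (add Y' Z')) :
    addMap h l (addMap hXY hXY' f g) k ≍ addMap h' l' f (addMap hYZ hYZ' g k) := by
  have e1 : addMap h l (addMap hXY hXY' f g) k = ((mix h).inv ≫ ((mix hXY).inv ⊗ₘ 𝟙 Z.obj)) ≫
      ((f ⊗ₘ g) ⊗ₘ k) ≫ (((mix hXY').hom ⊗ₘ 𝟙 Z'.obj) ≫ (mix l).hom) := by
    simp only [addMap, Category.assoc, tensorHom_comp_tensorHom_assoc, Category.id_comp,
      Category.comp_id]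
  have e2 : addMap h' l' f (addMap hYZ hYZ' g k) = ((mix h').inv ≫ (𝟙 X.obj ⊗ₘ (mix hYZ).inv)) ≫
      (f ⊗ₘ (g ⊗ₘ k)) ≫ ((𝟙 X'.obj ⊗ₘ (mix hYZ').hom) ≫ (mix l').hom) := by
    simp only [addMap, Category.assoc, tensorHom_comp_tensorHom_assoc, Category.id_comp,
      Category.comp_id]
  rw [e1, e2]
  exact comp_heq (by rw [add_assoc]) (Permutative.tensor_assoc _ _ _) (by rw [add_assoc])
    (mix_assoc_inv hXY hXZ hYZ h h') (comp_heq (Permutative.tensor_assoc _ _ _)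
      (Permutative.tensor_assoc _ _ _) (by rw [add_assoc])
      (Permutative.tensor_tensor_heq f g k) (mix_assoc_hom hXY' hXZ' hYZ' l l'))

end Hom

end PhiObj

/-- The parsummable category `Φ(K)` of a permutative category `K`. -/
def phiObj (K : PermCat.{v, u}) : ParSumCat.{v, u} where
  carrier := PhiObj K.carrier
  em := PhiObj.em K.carrier
  tame := PhiObj.tame
  zero := PhiObj.zero K.carrier
  act_zero u := PhiObj.act_zero u
  tr_zero u v := by
    have e : ∀ u : ℕ ↪ ℕ, (PhiObj.act u (PhiObj.zero K.carrier)).list = [] := fun u => by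
      rw [PhiObj.act_zero, PhiObj.zero_list]
    have e' : ∀ u : ℕ ↪ ℕ, PhiObj.relist u (PhiObj.zero K.carrier) = [] := fun u => by
      rw [PhiObj.relist, PhiObj.zero_list, List.map_nil]
    have h1 := PhiObj.circ_inv u (PhiObj.zero K.carrier)
    have h2 := PhiObj.circ_hom v (PhiObj.zero K.carrier)
    rw [e'] at h1 h2
    exact (h1.comp h2).unique_of_eq (IsCoh.id (L := (PhiObj.zero K.carrier).list) rfl)
      ((e u).trans PhiObj.zero_list.symm) ((e v).trans PhiObj.zero_list.symm)
      (PhiObj.nodup_fst _)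
  add X Y _ := PhiObj.add X Y
  addMap h h' f g :=
    PhiObj.addMap (PhiObj.disj_of_disjoint h) (PhiObj.disj_of_disjoint h') f g
  addMap_id X Y h := by
    change (PhiObj.mix _).inv ≫ (𝟙 X.obj ⊗ₘ 𝟙 Y.obj) ≫ (PhiObj.mix _).hom = 𝟙 _
    simp
  addMap_comp {X X' X'' Y Y' Y''} h h' h'' f f' g g' := by
    change X.obj ⟶ X'.obj at f
    change X'.obj ⟶ X''.obj at f'
    change Y.obj ⟶ Y'.obj at g
    change Y'.obj ⟶ Y''.obj at g'
    change (PhiObj.mix _).inv ≫ ((f ≫ f') ⊗ₘ (g ≫ g')) ≫ (PhiObj.mix _).hom =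
      ((PhiObj.mix _).inv ≫ (f ⊗ₘ g) ≫ (PhiObj.mix _).hom) ≫
        (PhiObj.mix _).inv ≫ (f' ⊗ₘ g') ≫ (PhiObj.mix _).hom
    simp only [Category.assoc, Iso.hom_inv_id_assoc, tensorHom_comp_tensorHom_assoc]
  act_add u X Y _ _ := PhiObj.act_add u X Y
  act_addMap u _ _ _ _ h h' f g _ _ :=
    PhiObj.act_addMap u (PhiObj.disj_of_disjoint h) (PhiObj.disj_of_disjoint h') f g
  tr_add u v _ _ h _ _ := PhiObj.tr_add u v (PhiObj.disj_of_disjoint h)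
  zero_add X _ := PhiObj.zero_add X
  zero_addMap h h' f :=
    PhiObj.zero_addMap (PhiObj.disj_of_disjoint h) (PhiObj.disj_of_disjoint h') f
  add_comm _ _ h := PhiObj.add_comm (PhiObj.disj_of_disjoint h)
  addMap_comm h h' f g :=
    PhiObj.addMap_comm (PhiObj.disj_of_disjoint h) (PhiObj.disj_of_disjoint h') f g
  add_assoc X Y Z _ _ _ _ _ := PhiObj.add_assoc X Y Z
  addMap_assoc f g k hXY hXZ hYZ h h' hXY' hXZ' hYZ' l l' :=
    PhiObj.addMap_assoc f g k (PhiObj.disj_of_disjoint hXY) (PhiObj.disj_of_disjoint hXZ)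
      (PhiObj.disj_of_disjoint hYZ) (PhiObj.disj_of_disjoint h) (PhiObj.disj_of_disjoint h')
      (PhiObj.disj_of_disjoint hXY') (PhiObj.disj_of_disjoint hXZ')
      (PhiObj.disj_of_disjoint hYZ') (PhiObj.disj_of_disjoint l) (PhiObj.disj_of_disjoint l')

namespace PhiObj

section Map

variable {K : Type u₁} [Category.{v₁} K] [MonoidalCategory K] [SymmetricCategory K]
  {K' : Type u₂} [Category.{v₂} K'] [MonoidalCategory K'] [SymmetricCategory K'] {F : K ⥤ K'}

/-- The sequence `F(X_i)`. -/
def mapObj (hF : IsStrictSymm F) (X : PhiObj K) : PhiObj K' where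
  seq i := F.obj (X.seq i)
  finite := X.finite.subset (fun i hi h => hi (by
    change X.seq i = 𝟙_ K at h
    change F.obj (X.seq i) = 𝟙_ K'
    rw [h, hF.obj_unit]))

theorem mapObj_act (hF : IsStrictSymm F) (u : ℕ ↪ ℕ) (X : PhiObj K) :
    mapObj hF (act u X) = act u (mapObj hF X) := by
  refine ext' (fun i => ?_)
  change F.obj ((act u X).seq i) = _
  by_cases h : ∃ j, u j = i
  · obtain ⟨j, rfl⟩ := h
    rw [act_seq, act_seq]; rfl
  · rw [act_seq' u X i h, act_seq' u _ i h, hF.obj_unit]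

theorem mapObj_zero (hF : IsStrictSymm F) : mapObj hF (zero K) = zero K' :=
  ext' (fun _ => hF.obj_unit)

theorem mapObj_add (hF : IsStrictSymm F) {X Y : PhiObj K} (h : Disj X Y) :
    mapObj hF (add X Y) = add (mapObj hF X) (mapObj hF Y) := by
  have h0 : ∀ (X : PhiObj K) i, X.seq i = 𝟙_ K → (mapObj hF X).seq i = 𝟙_ K' := fun X i hX => by
    change F.obj (X.seq i) = _
    rw [hX, hF.obj_unit]
  refine ext' (fun i => ?_)
  change F.obj ((add X Y).seq i) = _
  by_cases hX : X.seq i = 𝟙_ K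
  · rw [add_of_eq hX, add_of_eq (h0 X i hX)]; rfl
  · have hY := (h i).resolve_left hX
    rw [add_of_ne hX]
    by_cases hX' : (mapObj hF X).seq i = 𝟙_ K'
    · rw [add_of_eq hX', h0 Y i hY, ← hX']; rfl
    · rw [add_of_ne hX']; rfl

open Classical in
/-- The list of the `F(A)` with `A` in `L`, with all trivial entries removed. -/
def mapList (F : K ⥤ K') (L : List (ℕ × K)) : List (ℕ × K') :=
  (L.map (fun p => (p.1, F.obj p.2))).filter (fun p => p.2 ≠ 𝟙_ K')

theorem mapList_append (L M : List (ℕ × K)) :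
    mapList F (L ++ M) = mapList F L ++ mapList F M := by
  rw [mapList, List.map_append, List.filter_append]; rfl

theorem list_mapObj (hF : IsStrictSymm F) (X : PhiObj K) :
    (mapObj hF X).list = mapList F X.list := by
  refine list_ext (pairwise_list _) ?_ ?_
  · refine List.Pairwise.filter _ ?_
    rw [List.pairwise_map]
    exact X.pairwise_list
  · rintro ⟨i, A⟩
    simp only [mapList, mem_list, List.mem_filter, List.mem_map, Prod.mk.injEq, Prod.exists,
      decide_eq_true_eq]
    constructor
    · rintro ⟨rfl, h⟩
      refine ⟨⟨i, X.seq i, ⟨rfl, fun h' => h ?_⟩, rfl, rfl⟩, h⟩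
      change F.obj (X.seq i) = _
      rw [h', hF.obj_unit]
    · rintro ⟨⟨j, B, ⟨rfl, _⟩, rfl, rfl⟩, h⟩
      exact ⟨rfl, h⟩

theorem relist_mapObj (hF : IsStrictSymm F) (u : ℕ ↪ ℕ) (X : PhiObj K) :
    relist u (mapObj hF X) = mapList F (relist u X) := by
  rw [relist, list_mapObj, relist, mapList, mapList, List.map_map, List.filter_map, List.map_map,
    List.filter_map]
  rfl

variable [Permutative K] [Permutative K']

theorem _root_.ParSum.IsCoh.mapList (hF : IsStrictSymm F) {L L' : List (ℕ × K)} {A B : K}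
    {f : A ⟶ B} (h : IsCoh L L' f) :
    IsCoh (mapList F L) (mapList F L') (F.map f) := by
  classical
  exact (h.map hF).filter

theorem obj_mapObj (hF : IsStrictSymm F) (X : PhiObj K) :
    F.obj X.obj = (mapObj hF X).obj := by
  classical
  rw [obj, obj, list_mapObj, PhiObj.mapList, IsCoh.tensN_filter, IsCoh.tensN_map hF]

/-- The morphism `F(f)`, viewed as a morphism `⨂ F(X_i) ⟶ ⨂ F(Y_i)`. -/
def mapHom (hF : IsStrictSymm F) {X Y : PhiObj K} (f : X.obj ⟶ Y.obj) :
    (mapObj hF X).obj ⟶ (mapObj hF Y).obj :=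
  eqToHom (obj_mapObj hF X).symm ≫ F.map f ≫ eqToHom (obj_mapObj hF Y)

theorem mapHom_heq (hF : IsStrictSymm F) {X Y : PhiObj K} (f : X.obj ⟶ Y.obj) :
    mapHom hF f ≍ F.map f :=
  (eqToHom_comp_heq _ _).trans (comp_eqToHom_heq _ _)

theorem map_circ_hom (hF : IsStrictSymm F) (u : ℕ ↪ ℕ) (X : PhiObj K) :
    F.map (circ u X).hom ≍ (circ u (mapObj hF X)).hom := by
  refine ((circ_hom u X).mapList hF).unique_of_eq (circ_hom u (mapObj hF X))
    (relist_mapObj hF u X).symm ?_ ?_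
  · rw [← list_mapObj hF, mapObj_act]
  · rw [← relist_mapObj hF]; exact nodup_relist _ _

theorem map_circ_inv (hF : IsStrictSymm F) (u : ℕ ↪ ℕ) (X : PhiObj K) :
    F.map (circ u X).inv ≍ (circ u (mapObj hF X)).inv := by
  refine ((circ_inv u X).mapList hF).unique_of_eq (circ_inv u (mapObj hF X)) ?_
    (relist_mapObj hF u X).symm ?_
  · rw [← list_mapObj hF, mapObj_act]
  · rw [← list_mapObj hF]; exact nodup_fst _

theorem map_mix_hom (hF : IsStrictSymm F) {X Y : PhiObj K} (h : Disj X Y)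
    (h' : Disj (mapObj hF X) (mapObj hF Y)) : F.map (mix h).hom ≍ (mix h').hom := by
  refine ((mix_hom h).mapList hF).unique_of_eq (mix_hom h') ?_ ?_ ?_
  · rw [mapList_append, ← list_mapObj hF, ← list_mapObj hF]
  · rw [← list_mapObj hF, mapObj_add hF h]
  · rw [mapList_append, ← list_mapObj hF, ← list_mapObj hF]; exact nodup_append h'

theorem map_mix_inv (hF : IsStrictSymm F) {X Y : PhiObj K} (h : Disj X Y)
    (h' : Disj (mapObj hF X) (mapObj hF Y)) : F.map (mix h).inv ≍ (mix h').inv := by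
  refine ((mix_inv h).mapList hF).unique_of_eq (mix_inv h') ?_ ?_ ?_
  · rw [← list_mapObj hF, mapObj_add hF h]
  · rw [mapList_append, ← list_mapObj hF, ← list_mapObj hF]
  · rw [← list_mapObj hF]; exact nodup_fst _

theorem map_act_hom (hF : IsStrictSymm F) (u : ℕ ↪ ℕ) {X Y : PhiObj K} (f : X.obj ⟶ Y.obj) :
    mapHom hF (X := act u X) (Y := act u Y) ((circ u X).inv ≫ f ≫ (circ u Y).hom) ≍
      (circ u (mapObj hF X)).inv ≫ mapHom hF f ≫ (circ u (mapObj hF Y)).hom := by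
  refine (mapHom_heq hF _).trans ?_
  rw [F.map_comp, F.map_comp]
  have e : ∀ X, F.obj (act u X).obj = (act u (mapObj hF X)).obj := fun X => by
    rw [obj_mapObj hF, mapObj_act]
  exact comp_heq (e X) (obj_mapObj hF X) (e Y) (map_circ_inv hF u X)
    (comp_heq (obj_mapObj hF X) (obj_mapObj hF Y) (e Y) (mapHom_heq hF f).symm
      (map_circ_hom hF u Y))

theorem map_tr (hF : IsStrictSymm F) (u v : ℕ ↪ ℕ) (X : PhiObj K) :
    mapHom hF (X := act u X) (Y := act v X) ((circ u X).inv ≫ (circ v X).hom) ≍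
      (circ u (mapObj hF X)).inv ≫ (circ v (mapObj hF X)).hom := by
  refine (mapHom_heq hF _).trans ?_
  rw [F.map_comp]
  have e : ∀ u X, F.obj (act u X).obj = (act u (mapObj hF X)).obj := fun u X => by
    rw [obj_mapObj hF, mapObj_act]
  exact comp_heq (e u X) (obj_mapObj hF X) (e v X) (map_circ_inv hF u X) (map_circ_hom hF v X)

theorem map_addHom (hF : IsStrictSymm F) {X X' Y Y' : PhiObj K} (h : Disj X Y) (h' : Disj X' Y')
    (f : X.obj ⟶ X'.obj) (g : Y.obj ⟶ Y'.obj) (k : Disj (mapObj hF X) (mapObj hF Y))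
    (k' : Disj (mapObj hF X') (mapObj hF Y')) :
    mapHom hF (addMap h h' f g) ≍ addMap k k' (mapHom hF f) (mapHom hF g) := by
  refine (mapHom_heq hF _).trans ?_
  rw [addMap, F.map_comp, F.map_comp]
  have e : ∀ {X Y : PhiObj K}, Disj X Y → F.obj (add X Y).obj =
      (add (mapObj hF X) (mapObj hF Y)).obj := fun h => by
    rw [obj_mapObj hF, mapObj_add hF h]
  have e' : ∀ X Y : PhiObj K, F.obj (X.obj ⊗ Y.obj) = (mapObj hF X).obj ⊗ (mapObj hF Y).obj :=
    fun X Y => by rw [hF.obj_tensor, obj_mapObj hF, obj_mapObj hF]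
  exact comp_heq (e h) (e' X Y) (e h') (map_mix_inv hF h k)
    (comp_heq (e' X Y) (e' X' Y') (e h') ((hF.map_tensor f g).trans
      (tensorHom_heq (obj_mapObj hF _) (obj_mapObj hF _) (obj_mapObj hF _) (obj_mapObj hF _)
        (mapHom_heq hF f).symm (mapHom_heq hF g).symm)) (map_mix_hom hF h' k'))

/-- The functor `Φ(F)`. -/
def mapFunctor (hF : IsStrictSymm F) : PhiObj K ⥤ PhiObj K' where
  obj := mapObj hF
  map f := mapHom hF f
  map_id X := by
    change eqToHom _ ≫ F.map (𝟙 X.obj) ≫ eqToHom _ = 𝟙 (mapObj hF X).obj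
    simp
  map_comp {X Y Z} f g := by
    change X.obj ⟶ Y.obj at f
    change Y.obj ⟶ Z.obj at g
    change eqToHom _ ≫ F.map (f ≫ g) ≫ eqToHom _ =
      (eqToHom _ ≫ F.map f ≫ eqToHom _) ≫ eqToHom _ ≫ F.map g ≫ eqToHom _
    simp

end Map

end PhiObj

/-- The morphism of parsummable categories `Φ(F)`. -/
def phiMap {K K' : PermCat.{v, u}} (F : K ⟶ K') : phiObj K ⟶ phiObj K' where
  functor := PhiObj.mapFunctor F.strict
  act_comm u := Functor.hext (fun X => PhiObj.mapObj_act F.strict u X)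
    (fun X Y f => PhiObj.map_act_hom F.strict u f)
  tr_comm u v X := PhiObj.map_tr F.strict u v X
  map_zero := PhiObj.mapObj_zero F.strict
  map_add X Y h _ := PhiObj.mapObj_add F.strict (PhiObj.disj_of_disjoint h)
  map_addMap h h' f g k k' := PhiObj.map_addHom F.strict (PhiObj.disj_of_disjoint h)
    (PhiObj.disj_of_disjoint h') f g (PhiObj.disj_of_disjoint k) (PhiObj.disj_of_disjoint k')

/-- The functor `Φ` from permutative categories to parsummable categories. -/
def PermCat.Phi : PermCat.{v, u} ⥤ ParSumCat.{v, u} where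
  obj K := phiObj K
  map F := phiMap F
  map_id K := ParSumCat.Hom.ext (Functor.hext (fun X => PhiObj.ext' (fun _ => rfl))
    (fun X Y f => PhiObj.mapHom_heq _ _))
  map_comp {K K' K''} F G := ParSumCat.Hom.ext (Functor.hext (fun X => PhiObj.ext' (fun _ => rfl))
    (fun X Y f => (PhiObj.mapHom_heq _ _).trans (HEq.symm ((PhiObj.mapHom_heq _ _).trans
      (functor_map_heq G.functor (PhiObj.obj_mapObj F.strict _).symm
        (PhiObj.obj_mapObj F.strict _).symm (PhiObj.mapHom_heq F.strict f))))))

namespace PermCat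

variable (K : PermCat.{v, u})

/-- The object `⨂_i ⨂_j X^(i)_j` of `K`, for a finite sequence `X^(1), …, X^(m)` of objects of
`Φ(K)`. -/
def totalTensor (X : List (Phi.obj K).carrier) : K.carrier :=
  X.foldr (fun Y A => PhiObj.obj (K := K.carrier) Y ⊗ A) (𝟙_ K.carrier)

variable {K}

/-- An injection `φ` is `X`-monotone if `φ(i, j) < φ(i', j')` whenever `(i, j)` is lexicographically
smaller than `(i', j')` and both `X^(i)_j` and `X^(i')_{j'}` are different from the unit. -/
def IsMonotone (X : List (Phi.obj K).carrier) (φ : Inj X.length) : Prop :=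
  ∀ (i i' : Fin X.length) (j j' : ℕ), i < i' ∨ i = i' ∧ j < j' →
    PhiObj.seq (K := K.carrier) (X.get i) j ≠ 𝟙_ K.carrier →
    PhiObj.seq (K := K.carrier) (X.get i') j' ≠ 𝟙_ K.carrier → φ (i, j) < φ (i', j')

/-- The functor `T : Σ(Φ(K)) ⥤ K` is given on objects by `(X^(1), …, X^(m)) ↦ ⨂_i ⨂_j X^(i)_j`, and
on morphisms by `[ψ, f, φ] ↦ f` for any monotone representative; recall that a morphism `f` of
`Φ(K)` is by definition a morphism between certain tensor products in `K`. The latter makes sense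
since the source and target of `f` and of `T [ψ, f, φ]` agree in `K`. -/
def IsEvaluation (T : (ParSumCat.Sigma.obj (Phi.obj K)).carrier ⥤ K.carrier) : Prop :=
  (∀ X : List (Phi.obj K).carrier, T.obj X = totalTensor K X) ∧
  ∀ (X Y : List (Phi.obj K).carrier) (φ : Inj X.length) (ψ : Inj Y.length),
    IsMonotone X φ → IsMonotone Y ψ →
    ∀ f : PhiObj.obj (K := K.carrier) ((Phi.obj K).tens X φ) ⟶
        PhiObj.obj (K := K.carrier) ((Phi.obj K).tens Y ψ),
      ∃ (hX : T.obj X = PhiObj.obj (K := K.carrier) ((Phi.obj K).tens X φ))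
        (hY : PhiObj.obj (K := K.carrier) ((Phi.obj K).tens Y ψ) = T.obj Y),
        T.map (X := X) (Y := Y) (ParSumCat.SigmaHom.mk (C := Phi.obj K) φ ψ f) =
          eqToHom hX ≫ f ≫ eqToHom hY

end PermCat

end ParSum

end

open ParSum

noncomputable section

namespace ParSum

/-! ## The transformation `ν̃` -/

namespace ParSumCat

variable {C D : ParSumCat.{v, u}}

theorem SigmaHom.map_nu (F : C ⟶ D) {A B : C.carrier} (f : A ⟶ B) :
    SigmaHom.map F (SigmaHom.nu f) = SigmaHom.nu (F.functor.map f) :=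
  SigmaHom.ext_rep (X := [F.functor.obj A]) (Y := [F.functor.obj B]) Inj.one Inj.one
    (eq_of_heq (((SigmaHom.rep_map F (SigmaHom.nu f) Inj.one Inj.one rfl rfl).trans
      (functor_map_heq F.functor (tens_one A) (tens_one B) (SigmaHom.rep_nu f))).trans
      (SigmaHom.rep_nu _).symm))

namespace MuStarCat

variable (μ : Inj 2)

instance : (nuFunctor C μ).Full where
  map_surjective {X Y} α := by
    change SigmaHom (C := C) [X] [Y] at α
    refine ⟨(eqToHom (tens_one (C := C) X).symm ≫ α.rep Inj.one Inj.one ≫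
      eqToHom (tens_one (C := C) Y) : (X : C.carrier) ⟶ Y),
      SigmaHom.ext_rep (C := C) (X := [X]) (Y := [Y]) Inj.one Inj.one (eq_of_heq ?_)⟩
    exact (SigmaHom.rep_nu (C := C) _).trans
      ((eqToHom_comp_heq _ _).trans (comp_eqToHom_heq _ _))

instance : (nuFunctor C μ).EssSurj where
  mem_essImage L := ⟨(C.tens L (Inj.std _ 0) : C.carrier),
    ⟨SigmaHom.idIso (C := C) [C.tens L (Inj.std _ 0)] L Inj.one (Inj.std _ 0) (tens_one _)⟩⟩

instance : (nuFunctor C μ).IsEquivalence where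

variable {μ}

theorem map_comp_nuFunctor (F : C ⟶ D) :
    map μ F ⋙ nuFunctor D μ = nuFunctor C μ ⋙ sigmaFunctor F :=
  Functor.hext (fun _ => rfl) (fun _ _ f => heq_of_eq (SigmaHom.map_nu (C := C) F f).symm)

theorem iota_isId_one (C : ParSumCat.{v, u}) :
    SigmaHom.IsId (X := []) (Y := [C.zero]) (iota C μ).hom Inj.nil Inj.one :=
  SigmaHom.IsId.mk _

theorem map_iota (F : C ⟶ D) : (iota D μ).hom ≍ (sigmaFunctor F).map (iota C μ).hom := by
  refine SigmaHom.IsId.heq (X := []) (X' := []) (Y := [D.zero]) (Y' := [F.functor.obj C.zero])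
    rfl (by rw [F.map_zero]) (iota_isId_one D)
    (SigmaHom.IsId.map (iota_isId_one C) F)
    (fun i hi => absurd hi (Nat.not_lt_zero i)) (fun _ _ _ _ => rfl)

theorem map_nabla (F : C ⟶ D) (X Y : C.carrier) :
    (nabla D μ (F.functor.obj X) (F.functor.obj Y)).hom ≍
      (sigmaFunctor F).map (nabla C μ X Y).hom := by
  refine SigmaHom.IsId.heq (X := [F.functor.obj X, F.functor.obj Y])
    (X' := [F.functor.obj X, F.functor.obj Y])
    (Y := [D.tens [F.functor.obj X, F.functor.obj Y] μ])
    (Y' := [F.functor.obj (C.tens [X, Y] μ)])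
    rfl (by rw [map_tens_pair]) (nabla_isId (C := D) μ _ _)
    (SigmaHom.IsId.map (nabla_isId (C := C) μ X Y) F)
    (fun _ _ _ _ => rfl) (fun _ _ _ _ => rfl)

end MuStarCat

/-- The natural transformation `ν̃` from `μ^*` to `Σ`. -/
def nuTrans (μ : Inj 2) : muStar.{v, u} μ ⟶ Sigma.{v, u} ⋙ PermCat.incl.{v, u} where
  app C := MuStarCat.nuTilde C μ
  naturality {C D} F := by
    refine SymMonCat.Hom.ext' (MuStarCat.map_comp_nuFunctor F) ?_ (fun X Y => ?_)
    · change (MuStarCat.iota D μ).hom ≫ (MuStarCat.nuFunctor D μ).map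
          (eqToHom (MuStarCat.map_strict μ F).obj_unit.symm) ≍
        eqToHom (sigmaFunctor_strict F).obj_unit.symm ≫
          (sigmaFunctor F).map (MuStarCat.iota C μ).hom
      rw [eqToHom_map]
      exact (comp_eqToHom_heq _ _).trans
        ((MuStarCat.map_iota F).trans (eqToHom_comp_heq _ _).symm)
    · change (MuStarCat.nabla D μ _ _).hom ≫ (MuStarCat.nuFunctor D μ).map
          (eqToHom ((MuStarCat.map_strict μ F).obj_tensor X Y).symm) ≍
        eqToHom ((sigmaFunctor_strict F).obj_tensor _ _).symm ≫
          (sigmaFunctor F).map (MuStarCat.nabla C μ X Y).hom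
      rw [eqToHom_map]
      exact (comp_eqToHom_heq _ _).trans
        ((MuStarCat.map_nabla (C := C) F X Y).trans (eqToHom_comp_heq _ _).symm)

end ParSumCat

/-! ## The transformation `T` -/

theorem PhiObj.tensor_mix_addMap {K : Type u₁} [Category.{v₁} K] [MonoidalCategory K]
    [SymmetricCategory K] [Permutative K] {A B : K} {X X' Y Y' : PhiObj K} (h : Disj X Y)
    (h' : Disj X' Y') (a : A ⟶ X.obj) (b : B ⟶ Y.obj) (f : X.obj ⟶ X'.obj) (g : Y.obj ⟶ Y'.obj) :
    ((a ⊗ₘ b) ≫ (mix h).hom) ≫ addMap h h' f g = ((a ≫ f) ⊗ₘ (b ≫ g)) ≫ (mix h').hom := by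
  simp [addMap]

namespace PermCat

open ParSumCat

variable {K : PermCat.{v, u}}

/-- The object of `K` underlying an object of `Φ(K)`. -/
abbrev phiTensor (X : (Phi.obj K).carrier) : K.carrier := PhiObj.obj (K := K.carrier) X

/-- The generalized sum `φ_*(X)` in `Φ(K)`, as a sequence of objects of `K`. -/
abbrev phiSum (X : List (Phi.obj K).carrier) (φ : Inj X.length) : PhiObj K.carrier :=
  (Phi.obj K).tens X φ

/-- The concatenation of the lists of the `X^(i)`, where `X^(i)_j` is named `φ(i, j)`. -/
def names : (X : List (Phi.obj K).carrier) → (φ : Inj X.length) → List (ℕ × K.carrier)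
  | [], _ => []
  | X :: L, φ => PhiObj.relist (K := K.carrier) (φ.row 0) X ++ names L φ.tail

theorem disj_act_phiSum (X : (Phi.obj K).carrier) (L : List (Phi.obj K).carrier)
    (φ : Inj (L.length + 1)) :
    PhiObj.Disj (K := K.carrier) (PhiObj.act (φ.row 0) X) (phiSum L φ.tail) :=
  PhiObj.disj_of_disjoint (disjoint_act_tens (C := Phi.obj K) X L φ)

/-- The coherence isomorphism from `⨂_i ⨂_j X^(i)_j` to the tensor product of all entries of
`φ_*(X)`. -/
def shuffle : (X : List (Phi.obj K).carrier) → (φ : Inj X.length) →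
    (totalTensor K X ≅ (phiSum X φ).obj)
  | [], _ => eqToIso PhiObj.zero_obj.symm
  | X :: L, φ => (PhiObj.circ (K := K.carrier) (φ.row 0) X ⊗ᵢ shuffle L φ.tail) ≪≫
      PhiObj.mix (disj_act_phiSum X L φ)

theorem shuffle_isCoh (X : List (Phi.obj K).carrier) (φ : Inj X.length) :
    IsCoh (names X φ) (phiSum X φ).list (shuffle X φ).hom := by
  induction X with
  | nil =>
    have h : (phiSum [] φ).list = ([] : List (ℕ × K.carrier)) := PhiObj.zero_list
    rw [h]
    exact IsCoh.eqToHom (L := []) rfl PhiObj.zero_obj.symm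
  | cons X L ih =>
    exact ((PhiObj.circ_hom (K := K.carrier) (φ.row 0) X).tensor (ih φ.tail)).comp
      (PhiObj.mix_hom (disj_act_phiSum X L φ))

theorem shuffle_isCoh_inv (X : List (Phi.obj K).carrier) (φ : Inj X.length) :
    IsCoh (phiSum X φ).list (names X φ) (shuffle X φ).inv := by
  obtain ⟨g, hg⟩ := IsCoh.exists_of_perm (shuffle_isCoh X φ).perm.symm
    (shuffle_isCoh X φ).choose_spec.2.1 (shuffle_isCoh X φ).choose_spec.1
  have h := hg.inverse (shuffle_isCoh X φ) (PhiObj.nodup_fst _)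
  rwa [← Category.comp_id g, ← (shuffle X φ).hom_inv_id, ← Category.assoc, h,
    Category.id_comp] at hg

theorem nodup_names (X : List (Phi.obj K).carrier) (φ : Inj X.length) :
    ((names X φ).map Prod.fst).Nodup :=
  ((shuffle_isCoh X φ).perm.symm.map _).nodup (PhiObj.nodup_fst _)

/-- The isomorphism `[ψ, φ]`, viewed as a morphism of `K`. -/
def transHom (X : List (Phi.obj K).carrier) (φ ψ : Inj X.length) :
    (phiSum X φ).obj ⟶ (phiSum X ψ).obj :=
  (Phi.obj K).trans X φ ψ

theorem shuffle_trans (X : List (Phi.obj K).carrier) (φ ψ : Inj X.length) :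
    (shuffle X φ).hom ≫ transHom X φ ψ = (shuffle X ψ).hom := by
  induction X with
  | nil => exact Category.comp_id _
  | cons X L ih =>
    refine (PhiObj.tensor_mix_addMap (K := K.carrier) (disj_act_phiSum X L φ)
      (disj_act_phiSum X L ψ) (PhiObj.circ (K := K.carrier) (φ.row 0) X).hom
      (shuffle L φ.tail).hom ((PhiObj.circ (K := K.carrier) (φ.row 0) X).inv ≫
          (PhiObj.circ (K := K.carrier) (ψ.row 0) X).hom) (transHom L φ.tail ψ.tail)).trans ?_
    rw [Iso.hom_inv_id_assoc, ih]
    rfl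

theorem shuffle_trans_inv (X : List (Phi.obj K).carrier) (φ ψ : Inj X.length) :
    transHom X φ ψ ≫ (shuffle X ψ).inv = (shuffle X φ).inv := by
  rw [Iso.comp_inv_eq, ← shuffle_trans X φ ψ, Iso.inv_hom_id_assoc]

/-- The representative of a morphism of `Σ(Φ(K))`, viewed as a morphism of `K`. -/
def repHom {X Y : List (Phi.obj K).carrier} (α : SigmaHom X Y) (φ : Inj X.length)
    (ψ : Inj Y.length) : (phiSum X φ).obj ⟶ (phiSum Y ψ).obj :=
  α.rep φ ψ

/-- The value of `T` on morphisms, see `evalMap_eq` for the independence of representatives. -/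
def evalMap {X Y : List (Phi.obj K).carrier} (α : SigmaHom X Y) :
    totalTensor K X ⟶ totalTensor K Y :=
  (shuffle X (Inj.std _ 0)).hom ≫ repHom α (Inj.std _ 0) (Inj.std _ 0) ≫
    (shuffle Y (Inj.std _ 0)).inv

theorem evalMap_eq {X Y : List (Phi.obj K).carrier} (α : SigmaHom X Y) (φ : Inj X.length)
    (ψ : Inj Y.length) :
    evalMap α = (shuffle X φ).hom ≫ repHom α φ ψ ≫ (shuffle Y ψ).inv := by
  have h : repHom α φ ψ = transHom X φ (Inj.std _ 0) ≫ repHom α (Inj.std _ 0) (Inj.std _ 0) ≫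
      transHom Y (Inj.std _ 0) ψ := SigmaHom.rep_change α (Inj.std _ 0) φ (Inj.std _ 0) ψ
  rw [h, evalMap, ← shuffle_trans X φ, ← shuffle_trans_inv Y _ ψ]
  simp only [Category.assoc]

variable (K) in
/-- The functor `T : Σ(Φ(K)) ⥤ K`. -/
def evalFunctor : (Phi.obj K).SigmaCat ⥤ K.carrier where
  obj X := totalTensor K X
  map {X Y} α := evalMap (X := X) (Y := Y) α
  map_id X := by
    have h : repHom (SigmaHom.id (C := Phi.obj K) X) (Inj.std _ 0) (Inj.std _ 0) = 𝟙 _ :=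
      (SigmaHom.rep_id (C := Phi.obj K) _ _).trans (trans_self (C := Phi.obj K) _ _)
    refine (congrArg (fun f => (shuffle X (Inj.std _ 0)).hom ≫ f ≫
      (shuffle X (Inj.std _ 0)).inv) h).trans ?_
    simp
  map_comp {X Y Z} α β := by
    have h : repHom (SigmaHom.comp (C := Phi.obj K) α β) (Inj.std _ 0) (Inj.std _ 0) =
        repHom (X := X) (Y := Y) α (Inj.std _ 0) (Inj.std _ 0) ≫
          repHom (X := Y) (Y := Z) β (Inj.std _ 0) (Inj.std _ 0) :=
      SigmaHom.rep_comp (C := Phi.obj K) α β (Inj.std _ 0) (Inj.std _ 0) (Inj.std _ 0)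
    refine (congrArg (fun f => (shuffle X (Inj.std _ 0)).hom ≫ f ≫
      (shuffle Z (Inj.std _ 0)).inv) h).trans ?_
    change _ = ((shuffle X (Inj.std _ 0)).hom ≫ _ ≫ (shuffle Y (Inj.std _ 0)).inv) ≫
      ((shuffle Y (Inj.std _ 0)).hom ≫ _ ≫ (shuffle Z (Inj.std _ 0)).inv)
    simp

theorem totalTensor_append (X Y : List (Phi.obj K).carrier) :
    totalTensor K (X ++ Y) = totalTensor K X ⊗ totalTensor K Y := by
  induction X with
  | nil => exact (Permutative.unit_tensor _).symm
  | cons X L ih =>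
    exact (congrArg (phiTensor X ⊗ ·) ih).trans (Permutative.tensor_assoc _ _ _).symm

theorem names_join (X Y : List (Phi.obj K).carrier) (φ : Inj X.length) (θ : Inj Y.length)
    (h : Disjoint (Set.range φ) (Set.range θ)) (e) :
    names (X ++ Y) (Inj.join φ θ h e) = names X φ ++ names Y θ := by
  induction X with
  | nil => exact congrArg (names Y) (join_nil φ θ h e)
  | cons X L ih =>
    refine (congrArg₂ (fun u ρ => PhiObj.relist (K := K.carrier) u X ++ names (L ++ Y) ρ)
      (row_join φ θ h e) (tail_join φ θ h e)).trans ?_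
    exact (congrArg (_ ++ ·) (ih φ.tail (h.mono_left φ.range_tail_subset) _)).trans
      (List.append_assoc _ _ _).symm

theorem disj_phiSum {X Y : List (Phi.obj K).carrier} {φ : Inj X.length} {θ : Inj Y.length}
    (h : Disjoint (Set.range φ) (Set.range θ)) : PhiObj.Disj (phiSum X φ) (phiSum Y θ) :=
  PhiObj.disj_of_disjoint (disjoint_tens (C := Phi.obj K) h)

theorem phiSum_append (X Y : List (Phi.obj K).carrier) (φ : Inj X.length) (θ : Inj Y.length)
    (h : Disjoint (Set.range φ) (Set.range θ)) (e) :
    phiSum (X ++ Y) (Inj.join φ θ h e) = PhiObj.add (phiSum X φ) (phiSum Y θ) :=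
  tens_append (C := Phi.obj K) X Y φ θ h e

theorem shuffle_join_hom (X Y : List (Phi.obj K).carrier) (φ : Inj X.length) (θ : Inj Y.length)
    (h : Disjoint (Set.range φ) (Set.range θ)) (e) :
    (shuffle (X ++ Y) (Inj.join φ θ h e)).hom ≍
      ((shuffle X φ).hom ⊗ₘ (shuffle Y θ).hom) ≫ (PhiObj.mix (disj_phiSum h)).hom :=
  (shuffle_isCoh _ _).unique_of_eq
    (((shuffle_isCoh X φ).tensor (shuffle_isCoh Y θ)).comp (PhiObj.mix_hom (disj_phiSum h)))
    (names_join X Y φ θ h e) (congrArg PhiObj.list (phiSum_append X Y φ θ h e)) (nodup_names _ _)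

theorem shuffle_join_inv (X Y : List (Phi.obj K).carrier) (φ : Inj X.length) (θ : Inj Y.length)
    (h : Disjoint (Set.range φ) (Set.range θ)) (e) :
    (shuffle (X ++ Y) (Inj.join φ θ h e)).inv ≍
      (PhiObj.mix (disj_phiSum h)).inv ≫ ((shuffle X φ).inv ⊗ₘ (shuffle Y θ).inv) :=
  (shuffle_isCoh_inv _ _).unique_of_eq
    ((PhiObj.mix_inv (disj_phiSum h)).comp
      ((shuffle_isCoh_inv X φ).tensor (shuffle_isCoh_inv Y θ)))
    (congrArg PhiObj.list (phiSum_append X Y φ θ h e)) (names_join X Y φ θ h e)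
    (PhiObj.nodup_fst _)

theorem evalMap_tensor {X Y X' Y' : List (Phi.obj K).carrier} (α : SigmaHom X Y)
    (β : SigmaHom X' Y') : evalMap (SigmaHom.tensor α β) ≍ evalMap α ⊗ₘ evalMap β := by
  have hs := fun m n => Inj.disjoint_std m n (k := 0) (l := 1) (by decide)
  rw [evalMap_eq α (Inj.std _ 0) (Inj.std _ 0), evalMap_eq β (Inj.std _ 1) (Inj.std _ 1),
    evalMap_eq _ (Inj.join (Inj.std _ 0) (Inj.std _ 1) (hs _ _) List.length_append)
      (Inj.join (Inj.std _ 0) (Inj.std _ 1) (hs _ _) List.length_append)]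
  have h := SigmaHom.rep_tensor (C := Phi.obj K) α β (Inj.std _ 0) (Inj.std _ 1) (Inj.std _ 0)
    (Inj.std _ 1) (hs _ _) (hs _ _) List.length_append List.length_append
  have h' : repHom (SigmaHom.tensor α β)
      (Inj.join (Inj.std _ 0) (Inj.std _ 1) (hs _ _) List.length_append)
      (Inj.join (Inj.std _ 0) (Inj.std _ 1) (hs _ _) List.length_append) ≍
      PhiObj.addMap (disj_phiSum (hs _ _)) (disj_phiSum (hs _ _))
        (repHom α (Inj.std _ 0) (Inj.std _ 0)) (repHom β (Inj.std _ 1) (Inj.std _ 1)) := h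
  refine (comp_heq (totalTensor_append _ _) (congrArg PhiObj.obj (phiSum_append _ _ _ _ _ _))
    (totalTensor_append _ _) (shuffle_join_hom _ _ _ _ _ _)
    (comp_heq (congrArg PhiObj.obj (phiSum_append _ _ _ _ _ _))
      (congrArg PhiObj.obj (phiSum_append _ _ _ _ _ _))
      (totalTensor_append _ _) h' (shuffle_join_inv _ _ _ _ _ _))).trans (heq_of_eq ?_)
  simp [PhiObj.addMap]

theorem _root_.ParSum.PhiObj.isCoh_eqToHom {X Y : PhiObj K.carrier} (h : X = Y) :
    IsCoh X.list Y.list (eqToHom (congrArg PhiObj.obj h)) := by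
  subst h; exact IsCoh.id rfl

theorem phi_eqToHom {X Y : PhiObj K.carrier} (h : X = Y) :
    (eqToHom h : X ⟶ Y) = (eqToHom (congrArg PhiObj.obj h) : X.obj ⟶ Y.obj) := by
  subst h; rfl

theorem evalMap_swap (X Y : List (Phi.obj K).carrier) :
    evalMap (SigmaHom.swap X Y) ≍ (β_ (totalTensor K X) (totalTensor K Y)).hom := by
  have hs := Inj.disjoint_std X.length Y.length (k := 0) (l := 1) (by decide)
  rw [evalMap_eq _ (Inj.join (Inj.std _ 0) (Inj.std _ 1) hs List.length_append)
      (Inj.join (Inj.std _ 1) (Inj.std _ 0) hs.symm List.length_append)]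
  obtain ⟨h1, h2⟩ := SigmaHom.IsId.swap (C := Phi.obj K) (X := X) (Y := Y) (Inj.std _ 0)
    (Inj.std _ 1) hs List.length_append List.length_append
  have h3 : repHom (SigmaHom.swap X Y)
      (Inj.join (Inj.std _ 0) (Inj.std _ 1) hs List.length_append)
      (Inj.join (Inj.std _ 1) (Inj.std _ 0) hs.symm List.length_append) =
      eqToHom (congrArg PhiObj.obj h1) := by
    refine h2.trans ?_
    exact phi_eqToHom h1
  rw [h3]
  have h4 := (shuffle_isCoh (X ++ Y) _).comp
    ((PhiObj.isCoh_eqToHom h1).comp (shuffle_isCoh_inv (Y ++ X) _))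
  exact h4.unique_of_eq (IsCoh.braiding (shuffle_isCoh X (Inj.std _ 0)).choose_spec.1
    (shuffle_isCoh Y (Inj.std _ 1)).choose_spec.1) (names_join X Y _ _ hs _)
    (names_join Y X _ _ hs.symm _) (nodup_names _ _)

section

variable (K : PermCat.{v, u})

theorem evalFunctor_strict : IsStrictSymm (evalFunctor K) where
  obj_unit := rfl
  obj_tensor X Y := totalTensor_append X Y
  map_tensor f g := evalMap_tensor f g
  map_associator X Y Z := by
    rw [SigmaCat.associator_hom, eqToHom_map, Permutative.associator_eq]
    refine eqToHom_heq_eqToHom ?_ ?_ _ _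
    · exact (totalTensor_append _ _).trans (congrArg (· ⊗ _) (totalTensor_append _ _))
    · exact (totalTensor_append _ _).trans (congrArg (_ ⊗ ·) (totalTensor_append _ _))
  map_leftUnitor X := by
    rw [SigmaCat.leftUnitor_hom, eqToHom_map, Permutative.leftUnitor_eq]
    exact eqToHom_heq_eqToHom (totalTensor_append [] _) rfl _ _
  map_rightUnitor X := by
    rw [SigmaCat.rightUnitor_hom, eqToHom_map, Permutative.rightUnitor_eq]
    exact eqToHom_heq_eqToHom (totalTensor_append _ []) rfl _ _
  map_braiding X Y := evalMap_swap X Y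

instance : (evalFunctor K).Faithful where
  map_injective {X Y} α β h := by
    change SigmaHom (C := Phi.obj K) X Y at α β
    have h : (shuffle X (Inj.std _ 0)).hom ≫ repHom α (Inj.std _ 0) (Inj.std _ 0) ≫
        (shuffle Y (Inj.std _ 0)).inv = (shuffle X (Inj.std _ 0)).hom ≫
        repHom β (Inj.std _ 0) (Inj.std _ 0) ≫ (shuffle Y (Inj.std _ 0)).inv := h
    rw [cancel_epi, cancel_mono] at h
    exact SigmaHom.ext_rep _ _ h

instance : (evalFunctor K).Full where
  map_surjective {X Y} f := by
    change totalTensor K X ⟶ totalTensor K Y at f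
    obtain ⟨φ, hφ⟩ : ∃ φ : Inj (List.length X), φ = Inj.std _ 0 := ⟨_, rfl⟩
    obtain ⟨ψ, hψ⟩ : ∃ ψ : Inj (List.length Y), ψ = Inj.std _ 0 := ⟨_, rfl⟩
    let g : (phiSum X φ).obj ⟶ (phiSum Y ψ).obj := (shuffle X φ).inv ≫ f ≫ (shuffle Y ψ).hom
    refine ⟨SigmaHom.mk (C := Phi.obj K) φ ψ g, ?_⟩
    refine (evalMap_eq (SigmaHom.mk (C := Phi.obj K) φ ψ g) φ ψ).trans ?_
    have h : repHom (SigmaHom.mk (C := Phi.obj K) φ ψ g) φ ψ = g :=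
      SigmaHom.rep_mk_self (C := Phi.obj K) _ _ _
    rw [h]
    simp [g]

end

open Classical in
/-- The sequence `(A, 1, 1, …)`. -/
def _root_.ParSum.PhiObj.single {K : Type u₁} [Category.{v₁} K] [MonoidalCategory K] (A : K) :
    PhiObj K where
  seq i := if i = 0 then A else 𝟙_ K
  finite := (Set.finite_singleton 0).subset (fun i hi => by
    by_contra h
    exact hi (if_neg h))

theorem _root_.ParSum.PhiObj.single_obj {K : Type u₁} [Category.{v₁} K] [MonoidalCategory K]
    [SymmetricCategory K] [Permutative K] (A : K) : (PhiObj.single A).obj = A := by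
  classical
  have h : (PhiObj.single A).list = [(0, A)].filter (fun p => p.2 ≠ 𝟙_ K) := by
    refine list_ext (PhiObj.pairwise_list _) ((List.pairwise_singleton _ _).filter _) ?_
    rintro ⟨i, B⟩
    simp only [PhiObj.mem_list, List.mem_filter, List.mem_singleton, Prod.mk.injEq,
      decide_eq_true_eq, PhiObj.single]
    constructor
    · rintro ⟨h, hB⟩
      split_ifs at h with hi
      · exact ⟨⟨hi, h.symm⟩, hB⟩
      · exact absurd h.symm hB
    · rintro ⟨⟨rfl, rfl⟩, hB⟩
      exact ⟨if_pos rfl, hB⟩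
  rw [PhiObj.obj, h, IsCoh.tensN_filter]
  exact Permutative.tensor_unit A

instance (K : PermCat.{v, u}) : (evalFunctor K).EssSurj where
  mem_essImage A := ⟨([PhiObj.single A] : List (Phi.obj K).carrier),
    ⟨eqToIso ((Permutative.tensor_unit _).trans (PhiObj.single_obj A))⟩⟩

instance (K : PermCat.{v, u}) : (evalFunctor K).IsEquivalence where

section Monotone

variable {K : PermCat.{v, u}}

theorem mem_names {X : List (Phi.obj K).carrier} {φ : Inj X.length} {p : ℕ × K.carrier}
    (hp : p ∈ names X φ) : ∃ (i : Fin X.length) (j : ℕ), p.1 = φ (i, j) ∧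
      PhiObj.seq (K := K.carrier) (X.get i) j ≠ 𝟙_ K.carrier := by
  induction X with
  | nil => exact absurd hp List.not_mem_nil
  | cons X L ih =>
    rcases List.mem_append.mp hp with hp | hp
    · obtain ⟨q, hq, rfl⟩ := List.mem_map.mp hp
      obtain ⟨h1, h2⟩ := (PhiObj.mem_list (K := K.carrier) X q).mp hq
      exact ⟨0, q.1, rfl, fun h => h2 (h1.symm.trans h)⟩
    · obtain ⟨i, j, h1, h2⟩ := ih hp
      exact ⟨i.succ, j, h1, h2⟩

theorem IsMonotone.pairwise_names {X : List (Phi.obj K).carrier} {φ : Inj X.length}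
    (h : IsMonotone X φ) : (names X φ).Pairwise (fun p q => p.1 < q.1) := by
  induction X with
  | nil => exact List.Pairwise.nil
  | cons X L ih =>
    refine List.pairwise_append.mpr ⟨?_, ih (φ := φ.tail) ?_, ?_⟩
    · refine List.pairwise_map.mpr ((PhiObj.pairwise_list (K := K.carrier) X).imp_of_mem ?_)
      intro p q hp hq hpq
      obtain ⟨h1, h2⟩ := (PhiObj.mem_list (K := K.carrier) X p).mp hp
      obtain ⟨h3, h4⟩ := (PhiObj.mem_list (K := K.carrier) X q).mp hq
      exact h 0 0 p.1 q.1 (Or.inr ⟨rfl, hpq⟩) (fun h => h2 (h1.symm.trans h))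
        (fun h => h4 (h3.symm.trans h))
    · intro i i' j j' hij
      exact h i.succ i'.succ j j' (hij.imp Fin.succ_lt_succ_iff.mpr
        (And.imp_left (congrArg Fin.succ)))
    · intro p hp q hq
      obtain ⟨r, hr, rfl⟩ := List.mem_map.mp hp
      obtain ⟨h1, h2⟩ := (PhiObj.mem_list (K := K.carrier) X r).mp hr
      obtain ⟨i, j, h3, h4⟩ := mem_names hq
      rw [h3]
      exact h 0 i.succ r.1 j (Or.inl i.succ_pos) (fun h => h2 (h1.symm.trans h)) h4

theorem IsMonotone.names_eq {X : List (Phi.obj K).carrier} {φ : Inj X.length}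
    (h : IsMonotone X φ) : names X φ = (phiSum X φ).list :=
  list_ext h.pairwise_names (PhiObj.pairwise_list _) (fun _ => (shuffle_isCoh X φ).perm.mem_iff)

theorem IsMonotone.totalTensor_eq {X : List (Phi.obj K).carrier} {φ : Inj X.length}
    (h : IsMonotone X φ) : totalTensor K X = (phiSum X φ).obj := by
  rw [← (shuffle_isCoh X φ).choose_spec.1, h.names_eq]
  rfl

theorem IsMonotone.shuffle_eq {X : List (Phi.obj K).carrier} {φ : Inj X.length}
    (h : IsMonotone X φ) : shuffle X φ = eqToIso h.totalTensor_eq := by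
  refine Iso.ext (eq_of_heq ((shuffle_isCoh X φ).unique_of_eq
    (IsCoh.eqToHom (shuffle_isCoh X φ).choose_spec.1 h.totalTensor_eq) rfl h.names_eq.symm
    (nodup_names X φ)))

variable (K) in
theorem evalFunctor_isEvaluation : IsEvaluation (evalFunctor K) := by
  refine ⟨fun _ => rfl, fun X Y φ ψ hφ hψ f =>
    ⟨hφ.totalTensor_eq, hψ.totalTensor_eq.symm, ?_⟩⟩
  refine (evalMap_eq (SigmaHom.mk (C := Phi.obj K) φ ψ f) φ ψ).trans ?_
  have h : repHom (SigmaHom.mk (C := Phi.obj K) φ ψ f) φ ψ = f :=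
    SigmaHom.rep_mk_self (C := Phi.obj K) _ _ _
  rw [h, hφ.shuffle_eq, hψ.shuffle_eq]
  rfl

end Monotone

section Naturality

variable {K K' : PermCat.{v, u}} (F : K ⟶ K')

/-- The effect of `Φ(F)` on sequences of objects. -/
abbrev phiMapList (X : List (Phi.obj K).carrier) : List (Phi.obj K').carrier :=
  X.map (Phi.map F).functor.obj

theorem totalTensor_map (X : List (Phi.obj K).carrier) :
    totalTensor K' (phiMapList F X) = F.functor.obj (totalTensor K X) := by
  induction X with
  | nil => exact F.strict.obj_unit.symm
  | cons X L ih =>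
    exact (congrArg₂ (· ⊗ ·) (PhiObj.obj_mapObj F.strict X).symm ih).trans
      (F.strict.obj_tensor _ _).symm

theorem names_map (X : List (Phi.obj K).carrier) (φ : Inj X.length) (e) :
    names (phiMapList F X) (φ.cast e) = PhiObj.mapList F.functor (names X φ) := by
  induction X with
  | nil => rfl
  | cons X L ih =>
    refine Eq.trans ?_ (PhiObj.mapList_append _ _).symm
    exact congrArg₂ (· ++ ·) (PhiObj.relist_mapObj F.strict (φ.row 0) X)
      (ih φ.tail (List.length_map _))

theorem phiSum_map (X : List (Phi.obj K).carrier) (φ : Inj X.length) (e) :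
    phiSum (phiMapList F X) (φ.cast e) = PhiObj.mapObj F.strict (phiSum X φ) :=
  (Hom.map_tens (Phi.map F) X φ e).symm

theorem list_phiSum_map (X : List (Phi.obj K).carrier) (φ : Inj X.length) (e) :
    (phiSum (phiMapList F X) (φ.cast e)).list = PhiObj.mapList F.functor (phiSum X φ).list :=
  (congrArg PhiObj.list (phiSum_map F X φ e)).trans (PhiObj.list_mapObj F.strict _)

theorem obj_phiSum_map (X : List (Phi.obj K).carrier) (φ : Inj X.length) (e) :
    (phiSum (phiMapList F X) (φ.cast e)).obj = F.functor.obj (phiSum X φ).obj :=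
  (congrArg PhiObj.obj (phiSum_map F X φ e)).trans (PhiObj.obj_mapObj F.strict _).symm

theorem shuffle_map_hom (X : List (Phi.obj K).carrier) (φ : Inj X.length) (e) :
    (shuffle (phiMapList F X) (φ.cast e)).hom ≍ F.functor.map (shuffle X φ).hom :=
  (shuffle_isCoh _ _).unique_of_eq ((shuffle_isCoh X φ).mapList F.strict)
    (names_map F X φ e) (list_phiSum_map F X φ e) (nodup_names _ _)

theorem shuffle_map_inv (X : List (Phi.obj K).carrier) (φ : Inj X.length) (e) :
    (shuffle (phiMapList F X) (φ.cast e)).inv ≍ F.functor.map (shuffle X φ).inv :=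
  (shuffle_isCoh_inv _ _).unique_of_eq ((shuffle_isCoh_inv X φ).mapList F.strict)
    (list_phiSum_map F X φ e) (names_map F X φ e) (PhiObj.nodup_fst _)

theorem evalMap_map {X Y : List (Phi.obj K).carrier} (α : SigmaHom X Y) :
    evalMap (SigmaHom.map (Phi.map F) α) ≍ F.functor.map (evalMap α) := by
  rw [evalMap_eq _ ((Inj.std _ 0).cast (List.length_map _))
    ((Inj.std _ 0).cast (List.length_map _)), evalMap, F.functor.map_comp, F.functor.map_comp]
  have h : repHom (SigmaHom.map (Phi.map F) α) ((Inj.std _ 0).cast (List.length_map _))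
      ((Inj.std _ 0).cast (List.length_map _)) ≍
      F.functor.map (repHom α (Inj.std _ 0) (Inj.std _ 0)) := by
    have h1 := SigmaHom.rep_map (Phi.map F) α (Inj.std _ 0) (Inj.std _ 0) (List.length_map _)
      (List.length_map _)
    have h2 := PhiObj.mapHom_heq F.strict (repHom α (Inj.std _ 0) (Inj.std _ 0))
    exact HEq.trans h1 h2
  exact comp_heq (totalTensor_map F X) (obj_phiSum_map F X _ _) (totalTensor_map F Y)
    (shuffle_map_hom F X _ _) (comp_heq (obj_phiSum_map F X _ _) (obj_phiSum_map F Y _ _)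
      (totalTensor_map F Y) h (shuffle_map_inv F Y _ _))

end Naturality

/-- The natural transformation `T` from `Σ ∘ Φ` to the identity. -/
def evalTrans : Phi.{v, u} ⋙ ParSumCat.Sigma.{v, u} ⟶ 𝟭 PermCat.{v, u} where
  app K := ⟨evalFunctor K, evalFunctor_strict K⟩
  naturality {_ _} F := PermCat.Hom.ext (Functor.hext (fun X => totalTensor_map F X)
    (fun X Y α => evalMap_map (X := X) (Y := Y) F α))

end PermCat

end ParSum

end

theorem mainTheorem4 (μ : Fin 2 × ℕ ↪ ℕ) :
    ∃ ν : ParSumCat.muStar.{v, u} μ ⟶ ParSumCat.Sigma.{v, u} ⋙ PermCat.incl.{v, u},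
      (∀ C : ParSumCat.{v, u}, ν.app C = ParSumCat.MuStarCat.nuTilde C μ) ∧
      (∀ C : ParSumCat.{v, u}, (ν.app C).functor.IsEquivalence) ∧
      ∃ T : PermCat.Phi.{v, u} ⋙ ParSumCat.Sigma.{v, u} ⟶ 𝟭 PermCat.{v, u},
        (∀ K : PermCat.{v, u}, PermCat.IsEvaluation (T.app K).functor) ∧
        (∀ K : PermCat.{v, u}, (T.app K).functor.IsEquivalence) ∧
        ∃ κ : PermCat.Phi.{v, u} ⋙ ParSumCat.muStar.{v, u} μ ⟶ PermCat.incl.{v, u},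
          (∀ K : PermCat.{v, u},
            κ.app K = ν.app (PermCat.Phi.obj K) ≫ PermCat.incl.map (T.app K)) ∧
          ∀ K : PermCat.{v, u}, (κ.app K).functor.IsEquivalence := by
  have hν : ∀ C : ParSumCat.{v, u}, (ParSumCat.MuStarCat.nuFunctor C μ).IsEquivalence :=
    fun _ => inferInstance
  have hT : ∀ K : PermCat.{v, u}, (PermCat.evalFunctor K).IsEquivalence :=
    fun _ => inferInstance
  let κ : PermCat.Phi.{v, u} ⋙ ParSumCat.muStar.{v, u} μ ⟶ PermCat.incl.{v, u} :=
    Functor.whiskerLeft PermCat.Phi (ParSumCat.nuTrans μ) ≫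
      Functor.whiskerRight PermCat.evalTrans PermCat.incl
  refine ⟨ParSumCat.nuTrans μ, fun _ => rfl, hν, PermCat.evalTrans,
    PermCat.evalFunctor_isEvaluation, hT, κ, fun _ => rfl, fun K => ?_⟩
  exact Functor.isEquivalence_trans (ParSumCat.MuStarCat.nuFunctor (PermCat.Phi.obj K) μ)
    (PermCat.evalFunctor K)
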